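/- **Proposition G.1 (SignSGD risk recursion, isotropic data, general batch size).** Let $W^\star, W_0\in\mathbb R^{N_{out}\times N_{in}}$ and $\eta>0$. At each step draw a fresh minibatch $(x_{out}^{a},x_{in}^{a})_{a\le B}$ of independent pairs, with $x_{out}^a\sim\mathcal N(0,I_{N_{out}})$ and $x_{in}^a\sim\mathcal N(0,I_{N_{in}})$ independent, and run entrywise SignSGD, $$W_{t+1}=W_t-\eta\,\mathrm{sign}(G_{t+1}),\qquad G_{t+1}=\frac1B\sum_{a=1}^B (x_{out}^a\otimes x_{in}^a)\,\langle x_{out}^a\otimes x_{in}^a,\Delta_t\rangle,\qquad \Delta_t=W_t-W^\star .$$ Let $R_t=\tfrac12\mathbb E\big[\langle x_{out}\otimes x_{in},\Delta\rangle^2\big]\big|_{\Delta=\Delta_t}$ be the population risk of $W_t$, let $\mathcal F_t$ be generated by the minibatches used to compute $W_t$, let $m=\min\{N_{in},N_{out},B\}$, and let $$\mathcal N_B=\mathbb E\Big[\Big(\sum_{a=1}^B x_a^2y_a^2\Big)^{1/2}\Big],\qquad x_a,y_a \text{ i.i.d. } \mathcal N(0,1).$$ Let $C>0$ and $\kappa\ge1$.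 For every $\varepsilon>0$ there is an $m_0=m_0(C,\kappa,\varepsilon)$ such that, whenever $m\ge m_0$ and $\max\{N_{in},N_{out},B\}\le\kappa m$, for all $\eta$, $W_0$, $W^\star$ and $t$, almost surely on the event that $R_t>0$ and the residual is diffuse, $\max_{i,j}|(\Delta_t)_{ij}|\le C/m$, $$\Big|\,\mathbb E[R_{t+1}\mid\mathcal F_t]-\Big(R_t-\eta\,\mathcal N_B\sqrt{\tfrac{4R_t}{\pi}}+\tfrac{\eta^2}{2}N_{in}N_{out}\Big)\Big|\le\frac{\varepsilon\,\eta}{\sqrt{R_t}} .$$ In particular, for risks bounded below the error is $\eta\cdot o(1)$ as $N_{in},N_{out},B\to\infty$ at comparable rates. -/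

import Mathlib

open MeasureTheory ProbabilityTheory
open scoped Matrix

namespace SignSGD

/-- The pairing `⟨x_out ⊗ x_in, D⟩ = ∑ᵢⱼ (x_out)ᵢ (x_in)ⱼ Dᵢⱼ`. -/
def pairing {Nout Nin : ℕ} (xout : EuclideanSpace ℝ (Fin Nout)) (xin : EuclideanSpace ℝ (Fin Nin))
    (D : Matrix (Fin Nout) (Fin Nin) ℝ) : ℝ :=
  ∑ i, ∑ j, xout i * xin j * D i j

/-- The population risk `R(W) = ½ E[⟨x_out ⊗ x_in, W - W⋆⟩²]`, for independent
`x_out ∼ N(0, Sout)` and `x_in ∼ N(0, Sin)`. -/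
noncomputable def risk {Nout Nin : ℕ} (Sout : Matrix (Fin Nout) (Fin Nout) ℝ)
    (Sin : Matrix (Fin Nin) (Fin Nin) ℝ) (Wstar W : Matrix (Fin Nout) (Fin Nin) ℝ) : ℝ :=
  (1 / 2) * ∫ x, (pairing x.1 x.2 (W - Wstar)) ^ 2
    ∂((multivariateGaussian 0 Sout).prod (multivariateGaussian 0 Sin))

/-- The minibatch gradient `G(D) = B⁻¹ ∑ₐ (x_outᵃ ⊗ x_inᵃ) ⟨x_outᵃ ⊗ x_inᵃ, D⟩`. -/
noncomputable def minibatchGradient {Nout Nin B : ℕ}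
    (xout : Fin B → EuclideanSpace ℝ (Fin Nout)) (xin : Fin B → EuclideanSpace ℝ (Fin Nin))
    (D : Matrix (Fin Nout) (Fin Nin) ℝ) : Matrix (Fin Nout) (Fin Nin) ℝ :=
  Matrix.of fun i j => (1 / (B : ℝ)) * ∑ a, xout a i * xin a j * pairing (xout a) (xin a) D

/-- The entrywise SignSGD iterates `W₀ = W0`, `Wₜ₊₁ = Wₜ - η sign(Gₜ₊₁)`, where `Gₜ₊₁` is the
minibatch gradient at `Wₜ - W⋆` computed from the fresh minibatch `(xout t a, xin t a)`, `a < B`. -/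
noncomputable def iterate {Nout Nin B : ℕ} (η : ℝ) (Wstar W0 : Matrix (Fin Nout) (Fin Nin) ℝ)
    (xout : ℕ → Fin B → EuclideanSpace ℝ (Fin Nout))
    (xin : ℕ → Fin B → EuclideanSpace ℝ (Fin Nin)) : ℕ → Matrix (Fin Nout) (Fin Nin) ℝ
  | 0 => W0
  | t + 1 =>
      let W := iterate η Wstar W0 xout xin t
      W - η • (minibatchGradient (xout t) (xin t) (W - Wstar)).map Real.sign

/-- Streaming data: for all steps `t` and all positions `a` in the minibatch, `xout t a` and
`xin t a` are independent with laws `N(0, Sout)` and `N(0, Sin)`, and the pairs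
`(xout t a, xin t a)` are mutually independent. -/
structure IsStream {Ω : Type*} [MeasurableSpace Ω] (P : Measure Ω) {Nout Nin B : ℕ}
    (Sout : Matrix (Fin Nout) (Fin Nout) ℝ) (Sin : Matrix (Fin Nin) (Fin Nin) ℝ)
    (xout : ℕ → Fin B → Ω → EuclideanSpace ℝ (Fin Nout))
    (xin : ℕ → Fin B → Ω → EuclideanSpace ℝ (Fin Nin)) : Prop where
  measurable_out : ∀ t a, Measurable (xout t a)
  measurable_in : ∀ t a, Measurable (xin t a)
  law_out : ∀ t a, P.map (xout t a) = multivariateGaussian 0 Sout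
  law_in : ∀ t a, P.map (xin t a) = multivariateGaussian 0 Sin
  indep_out_in : ∀ t a, IndepFun (xout t a) (xin t a) P
  indep_samples :
    iIndepFun (fun (k : ℕ × Fin B) (ω : Ω) => (xout k.1 k.2 ω, xin k.1 k.2 ω)) P

/-- The information `ℱₜ` contained in the minibatches of the steps before `t`, that is, in all
those that `Wₜ` is computed from. -/
abbrev past {Ω : Type*} {Nout Nin B : ℕ}
    (xout : ℕ → Fin B → Ω → EuclideanSpace ℝ (Fin Nout))
    (xin : ℕ → Fin B → Ω → EuclideanSpace ℝ (Fin Nin)) (t : ℕ) : MeasurableSpace Ω :=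
  ⨆ (s : ℕ) (_ : s < t) (a : Fin B),
    MeasurableSpace.comap (fun ω => (xout s a ω, xin s a ω)) inferInstance

/-- `𝒩_B = E[(∑_{a ≤ B} x_a² y_a²)^{1/2}]` with all `x_a`, `y_a` independent `N(0, 1)`. -/
noncomputable def NB (B : ℕ) : ℝ :=
  ∫ z : Fin B → ℝ × ℝ, √(∑ a, (z a).1 ^ 2 * (z a).2 ^ 2)
    ∂(Measure.pi fun _ => (gaussianReal 0 1).prod (gaussianReal 0 1))

end SignSGD

/-! For isotropic data the risk is half the squared Frobenius norm of the residual `Δ` (`risk_one`).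
Expanding the square after one step gives `R - η ∑ Δᵢⱼ sign Gᵢⱼ + η²/2 · Nin · Nout`, since almost
surely no entry of `G` vanishes (`ae_gradSum_ne_zero`). Conditioning on the past freezes `Δ` and
averages over the fresh minibatch (`condExp_comp_of_indep`). It remains to show that `∑ Δᵢⱼ E[sign
Gᵢⱼ]` is close to `√(2/π) 𝒩_B ‖Δ‖`.

Signs are scale invariant, so let `‖Δ‖ = 1` and `d = Δᵢⱼ`. In each sample let `u` be output
coordinate `i`, `v` input coordinate `j`, and `x`, `y` the remaining coordinates. Then `B Gᵢⱼ = d S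
+ Z +` a linear form in the `y`'s, with `S = ∑ u²v²` and `Z = ∑ u v² ⟨column j, x⟩`. Given `(u, v,
x)` this is exactly Gaussian, so no central limit theorem enters (`integral_sign_gradSum`). The term
`Z` need not be small against `d S`, but it is odd in `x`, while the conditional variance is even in
`x` up to the small contribution of row `i`. After removing that contribution
(`abs_integral_meanSign_sub_le`), averaging over `x ↦ -x` cancels `Z` to first order
(`integral_goodEvent_symm`, `abs_meanSign_add_sub`) and leaves `√(2/π) d S / √V`. Both `S` and `V`
concentrate near `B`, so the mean sign is about `√(2/π) d √B`. Summing against `d` gives `√(2/π)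
√B`, and `𝒩_B = √B + O(1/√B)` (`abs_NB_sub_sqrt_le`).

For risks of order one the main term has order `√m` while the admissible error is `o(1)`. Each mean
sign, of typical size `m^(-1/2)`, is therefore needed to accuracy `o(1/m)`, which is why the
expansions go to second order. Diffuseness makes row and column norms of order `m^(-1/2)`; the
accumulated error is then `O(m^(-1/2))` (`sum_sum_mul_entryError_le`, `total_error_le`). -/

namespace SignSGD

/-! ### Random variables with all moments. -/

section Moments

open scoped ENNReal

variable {Ω Ω' : Type*} [MeasurableSpace Ω] [MeasurableSpace Ω'] {μ : Measure Ω} {ν : Measure Ω'}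

/-- All absolute moments of `f` are finite. -/
def HasMoments (f : Ω → ℝ) (μ : Measure Ω) : Prop := ∀ p : ℕ, MemLp f p μ

namespace HasMoments

variable {f g : Ω → ℝ}

lemma memLp_two (hf : HasMoments f μ) : MemLp f 2 μ := hf 2

lemma integrable (hf : HasMoments f μ) : Integrable f μ := memLp_one_iff_integrable.1 (by
  simpa using hf 1)

lemma const [IsFiniteMeasure μ] (c : ℝ) : HasMoments (fun _ => c) μ := fun _ => memLp_const c

lemma add (hf : HasMoments f μ) (hg : HasMoments g μ) : HasMoments (fun x => f x + g x) μ :=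
  fun p => (hf p).add (hg p)

lemma sub (hf : HasMoments f μ) (hg : HasMoments g μ) : HasMoments (fun x => f x - g x) μ :=
  fun p => (hf p).sub (hg p)

/-- Hölder with exponents `2p, 2p`. Asking for all moments at once makes the class closed under
products, so integrability of any polynomial expression is automatic. -/
lemma mul (hf : HasMoments f μ) (hg : HasMoments g μ) : HasMoments (fun x => f x * g x) μ := by
  intro p
  have : ENNReal.HolderTriple ((2 * p : ℕ) : ℝ≥0∞) ((2 * p : ℕ) : ℝ≥0∞) (p : ℝ≥0∞) := by
    constructor
    rw [← two_mul]
    push_cast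
    rw [ENNReal.mul_inv (by simp) (by simp), ← mul_assoc,
      ENNReal.mul_inv_cancel (by simp) (by simp), one_mul]
  exact MemLp.mul' (hg (2 * p)) (hf (2 * p))

lemma pow [IsFiniteMeasure μ] (hf : HasMoments f μ) (n : ℕ) : HasMoments (fun x => f x ^ n) μ := by
  induction n with
  | zero => simpa using const 1
  | succ n ih => simpa [pow_succ] using ih.mul hf

lemma abs (hf : HasMoments f μ) : HasMoments (fun x => |f x|) μ := fun p => (hf p).norm

lemma sum {ι : Type*} (s : Finset ι) {F : ι → Ω → ℝ} (hF : ∀ i ∈ s, HasMoments (F i) μ) :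
    HasMoments (fun x => ∑ i ∈ s, F i x) μ :=
  fun p => memLp_finsetSum s fun i hi => hF i hi p

lemma comp {T : Ω' → Ω} (hf : HasMoments f μ) (hT : MeasurePreserving T ν μ) :
    HasMoments (fun x => f (T x)) ν :=
  fun p => (hf p).comp_measurePreserving hT

lemma mono (hf : HasMoments f μ) (hg : AEStronglyMeasurable g μ) (h : ∀ x, |g x| ≤ |f x|) :
    HasMoments g μ :=
  fun p => (hf p).mono hg (Filter.Eventually.of_forall fun x => by simpa using h x)

end HasMoments

/-- Cauchy-Schwarz for expectations. -/
lemma integral_abs_mul_le {f g : Ω → ℝ} (hf : HasMoments f μ) (hg : HasMoments g μ) :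
    ∫ x, |f x| * |g x| ∂μ ≤ √(∫ x, f x ^ 2 ∂μ) * √(∫ x, g x ^ 2 ∂μ) := by
  have := integral_mul_norm_le_Lp_mul_Lq (μ := μ) (f := f) (g := g) (p := 2) (q := 2)
    Real.HolderConjugate.two_two (by simpa using hf.memLp_two) (by simpa using hg.memLp_two)
  simpa [Real.sqrt_eq_rpow] using this

end Moments

/-! ### Gaussian moments and linear forms. -/

section Gauss

/-- The standard Gaussian law on `ℝ`. -/
noncomputable abbrev gauss : Measure ℝ := gaussianReal 0 1

/-- The law of a family of independent standard Gaussians. -/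
noncomputable abbrev gaussPi (ι : Type*) [Fintype ι] : Measure (ι → ℝ) := Measure.pi fun _ => gauss

lemma hasMoments_id_gauss : HasMoments (fun x => x) gauss :=
  fun p => memLp_id_gaussianReal' p (by simp)

lemma gaussianPDFReal_std (x : ℝ) :
    gaussianPDFReal 0 1 x = (√(2 * Real.pi))⁻¹ * Real.exp (-x ^ 2 / 2) := by
  simp [gaussianPDFReal]

lemma hasDerivAt_gaussianPDFReal_std (x : ℝ) :
    HasDerivAt (gaussianPDFReal 0 1) (-x * gaussianPDFReal 0 1 x) x := by
  have h : gaussianPDFReal 0 1 = fun x => (√(2 * Real.pi))⁻¹ * Real.exp (-x ^ 2 / 2) := by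
    ext x; exact gaussianPDFReal_std x
  rw [h]
  have h1 : HasDerivAt (fun x : ℝ => -x ^ 2 / 2) (-x) x := by
    refine (((hasDerivAt_pow 2 x).neg).div_const 2).congr_deriv ?_
    norm_num; ring
  exact (h1.exp.const_mul (√(2 * Real.pi))⁻¹).congr_deriv (by ring)

lemma integrable_pow_mul_gaussianPDFReal (n : ℕ) :
    Integrable (fun x : ℝ => x ^ n * gaussianPDFReal 0 1 x) := by
  have h := (hasMoments_id_gauss.pow n).integrable
  rw [gauss, gaussianReal_of_var_ne_zero _ one_ne_zero,
    integrable_withDensity_iff_integrable_smul' (measurable_gaussianPDF 0 1)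
      (Filter.Eventually.of_forall fun _ => gaussianPDF_lt_top)] at h
  simpa [toReal_gaussianPDF, mul_comm] using h

/-- Integration by parts against the density `φ`, using `φ' = -x φ`. -/
lemma integral_pow_gauss (n : ℕ) :
    ∫ x, x ^ (n + 2) ∂gauss = (n + 1) * ∫ x, x ^ n ∂gauss := by
  rw [gauss, integral_gaussianReal_eq_integral_smul one_ne_zero,
    integral_gaussianReal_eq_integral_smul one_ne_zero]
  have h := integral_mul_deriv_eq_deriv_mul_of_integrable (u := fun x : ℝ => x ^ (n + 1))
    (v := gaussianPDFReal 0 1) (u' := fun x => ((n + 1 : ℕ) : ℝ) * x ^ n)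
    (v' := fun x => -x * gaussianPDFReal 0 1 x)
    (fun x _ => hasDerivAt_pow (n + 1) x) (fun x _ => hasDerivAt_gaussianPDFReal_std x)
    ((integrable_pow_mul_gaussianPDFReal (n + 2)).neg.congr (Filter.Eventually.of_forall fun x => by
      simp; ring))
    (((integrable_pow_mul_gaussianPDFReal n).const_mul (n + 1)).congr
      (Filter.Eventually.of_forall fun x => by simp; ring))
    (integrable_pow_mul_gaussianPDFReal (n + 1))
  rw [← integral_const_mul]
  have e1 : ∫ x : ℝ, x ^ (n + 1) * (-x * gaussianPDFReal 0 1 x)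
      = - ∫ x : ℝ, gaussianPDFReal 0 1 x • x ^ (n + 2) := by
    rw [← integral_neg]; congr 1; ext x; simp; ring
  rw [e1, neg_inj] at h
  rw [h]; congr 1; ext x; simp; ring

lemma integral_sq_gauss : ∫ x, x ^ 2 ∂gauss = 1 := by
  have := integral_pow_gauss 0; simpa using this

lemma integral_pow_four_gauss : ∫ x, x ^ 4 ∂gauss = 3 := by
  have := integral_pow_gauss 2; rw [integral_sq_gauss] at this; norm_num at this; exact this

lemma integral_pow_six_gauss : ∫ x, x ^ 6 ∂gauss = 15 := by
  have := integral_pow_gauss 4; rw [integral_pow_four_gauss] at this; norm_num at this; exact this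

lemma integral_pow_eight_gauss : ∫ x, x ^ 8 ∂gauss = 105 := by
  have := integral_pow_gauss 6; rw [integral_pow_six_gauss] at this; norm_num at this; exact this

lemma measurePreserving_neg_gauss : MeasurePreserving (fun x : ℝ => -x) gauss gauss :=
  ⟨by fun_prop, by simp [gauss, gaussianReal_map_neg]⟩

/-- A sum of independent centred Gaussians is Gaussian. -/
lemma map_sum_pi_gaussianReal {ι Ω : Type*} [Fintype ι] [MeasurableSpace Ω] {μ : Measure Ω}
    [IsProbabilityMeasure μ] {f : ι → Ω → ℝ} {s : ι → NNReal} (hf : ∀ i, Measurable (f i))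
    (h : ∀ i, μ.map (f i) = gaussianReal 0 (s i)) :
    (Measure.pi fun _ : ι => μ).map (fun ω => ∑ i, f i (ω i)) = gaussianReal 0 (∑ i, s i) := by
  have hm : Measurable (fun ω : ι → Ω => ∑ i, f i (ω i)) := by fun_prop
  have := Measure.isProbabilityMeasure_map (μ := Measure.pi fun _ : ι => μ) hm.aemeasurable
  apply Measure.ext_of_charFun
  ext t
  rw [charFun_gaussianReal, charFun_apply_real, integral_map hm.aemeasurable (by fun_prop)]
  have e : ∀ i, ∫ ω, Complex.exp (t * f i ω * Complex.I) ∂μ = Complex.exp (- (s i) * t ^ 2 / 2) := by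
    intro i
    have := charFun_gaussianReal (μ := 0) (v := s i) t
    rw [← h i, charFun_apply_real, integral_map (hf i).aemeasurable (by fun_prop)] at this
    rw [this]; congr 1; simp; ring
  have : ∀ ω : ι → Ω, Complex.exp (t * ((∑ i, f i (ω i) : ℝ) : ℂ) * Complex.I)
      = ∏ i, Complex.exp (t * f i (ω i) * Complex.I) := by
    intro ω; rw [← Complex.exp_sum]; push_cast; rw [Finset.mul_sum, Finset.sum_mul]
  simp_rw [this]
  rw [integral_fintype_prod_eq_prod (f := fun i ω => Complex.exp (t * f i ω * Complex.I))]
  simp_rw [e]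
  rw [← Complex.exp_sum]
  congr 1
  push_cast
  simp [Finset.sum_mul, Finset.sum_div, neg_div]

/-- The linear form with coefficients `w`. -/
def lin {ι : Type*} [Fintype ι] (w x : ι → ℝ) : ℝ := ∑ k, w k * x k

variable {ι : Type*} [Fintype ι]

@[fun_prop]
lemma measurable_lin (w : ι → ℝ) : Measurable (lin w) := by unfold lin; fun_prop

lemma map_lin_gaussPi (w : ι → ℝ) :
    (gaussPi ι).map (lin w) = gaussianReal 0 (∑ k, w k ^ 2).toNNReal := by
  have := map_sum_pi_gaussianReal (ι := ι) (μ := gauss) (f := fun k x => w k * x)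
    (s := fun k => (w k ^ 2).toNNReal) (by fun_prop) (fun k => by
      rw [gauss, gaussianReal_map_const_mul, mul_zero, mul_one]
      congr 1
      exact (Real.toNNReal_of_nonneg (sq_nonneg _)).symm)
  rw [Real.toNNReal_sum_of_nonneg fun k _ => sq_nonneg _]
  exact this

lemma map_sqrt_mul_gauss {s : ℝ} (hs : 0 ≤ s) :
    gauss.map (fun g => √s * g) = gaussianReal 0 s.toNNReal := by
  rw [gauss, gaussianReal_map_const_mul]; congr 1
  · simp
  · apply NNReal.coe_injective; simp [Real.sq_sqrt hs, Real.coe_toNNReal _ hs]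

lemma hasMoments_lin (w : ι → ℝ) : HasMoments (lin w) (gaussPi ι) :=
  HasMoments.sum _ fun k _ => (HasMoments.const (w k)).mul
    (hasMoments_id_gauss.comp (measurePreserving_eval _ k))

/-- A linear form of independent Gaussians is one Gaussian scaled by the norm of its coefficients,
so its moments reduce to one-dimensional ones. -/
lemma integral_comp_lin (w : ι → ℝ) {F : ℝ → ℝ} (hF : Measurable F) :
    ∫ x, F (lin w x) ∂(gaussPi ι) = ∫ g, F (√(∑ k, w k ^ 2) * g) ∂gauss := by
  rw [← integral_map (φ := lin w) (by fun_prop) hF.aestronglyMeasurable, map_lin_gaussPi,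
    ← map_sqrt_mul_gauss (by positivity),
    integral_map (by fun_prop) hF.aestronglyMeasurable]

lemma integral_lin_sq (w : ι → ℝ) : ∫ x, lin w x ^ 2 ∂(gaussPi ι) = ∑ k, w k ^ 2 := by
  rw [integral_comp_lin w (F := fun x => x ^ 2) (by fun_prop)]
  simp_rw [mul_pow]
  rw [integral_const_mul, integral_sq_gauss, Real.sq_sqrt (by positivity), mul_one]

lemma integral_lin (w : ι → ℝ) : ∫ x, lin w x ∂(gaussPi ι) = 0 := by
  rw [integral_comp_lin w (F := fun x => x) (by fun_prop), integral_const_mul]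
  simp [gauss]

lemma integral_lin_pow_four (w : ι → ℝ) :
    ∫ x, lin w x ^ 4 ∂(gaussPi ι) = 3 * (∑ k, w k ^ 2) ^ 2 := by
  rw [integral_comp_lin w (F := fun x => x ^ 4) (by fun_prop)]
  simp_rw [mul_pow]
  rw [integral_const_mul, integral_pow_four_gauss, show 4 = 2 * 2 from rfl, pow_mul,
    Real.sq_sqrt (by positivity), mul_comm]

lemma ae_lin_ne_zero {w : ι → ℝ} (hw : w ≠ 0) : ∀ᵐ x ∂(gaussPi ι), lin w x ≠ 0 := by
  obtain ⟨k, hk⟩ := Function.ne_iff.1 hw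
  have hpos : 0 < ∑ k, w k ^ 2 := Finset.sum_pos' (fun i _ => sq_nonneg _)
    ⟨k, Finset.mem_univ _, by have : w k ≠ 0 := hk; positivity⟩
  have hne : (∑ k, w k ^ 2).toNNReal ≠ 0 := by simpa using hpos
  have := nullSingletonClass_gaussianReal (μ := 0) hne
  have h : ∀ᵐ y ∂((gaussPi ι).map (lin w)), y ≠ 0 := by
    rw [map_lin_gaussPi, ae_iff]; simp
  exact ae_of_ae_map (p := fun y : ℝ => y ≠ 0) (measurable_lin w).aemeasurable h

end Gauss

/-! ### Resampling one coordinate. -/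

section Update

variable {ι Ω : Type*} [Fintype ι] [DecidableEq ι] [MeasurableSpace Ω] {μ : Measure Ω}
  [IsProbabilityMeasure μ]

/-- Replacing one coordinate of a product law by an independent copy preserves the law. -/
lemma measurePreserving_update (i : ι) :
    MeasurePreserving (fun z : Ω × (ι → Ω) => Function.update z.2 i z.1)
      (μ.prod (Measure.pi fun _ : ι => μ)) (Measure.pi fun _ : ι => μ) := by
  have hm : Measurable (fun z : Ω × (ι → Ω) => Function.update z.2 i z.1) := by
    rw [measurable_pi_iff]
    intro k
    by_cases h : k = i
    · subst h; simpa using measurable_fst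
    · simpa [h] using (by fun_prop : Measurable fun z : Ω × (ι → Ω) => z.2 k)
  refine ⟨hm, ?_⟩
  symm
  apply Measure.pi_eq
  intro s hs
  rw [Measure.map_apply hm (MeasurableSet.univ_pi hs)]
  -- The preimage of a box is again a box: the old coordinate `i` becomes unconstrained and the
  -- fresh one takes over its side.
  have : (fun z : Ω × (ι → Ω) => Function.update z.2 i z.1) ⁻¹' (Set.univ.pi s)
      = s i ×ˢ (Set.univ.pi (Function.update s i Set.univ)) := by
    ext ⟨t, x⟩
    simp only [Set.mem_preimage, Set.mem_pi, Set.mem_univ, true_imp_iff, Set.mem_prod]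
    constructor
    · intro h
      refine ⟨by simpa using h i, fun k => ?_⟩
      by_cases hk : k = i
      · subst hk; simp
      · simpa [hk] using h k
    · rintro ⟨h1, h2⟩ k
      by_cases hk : k = i
      · subst hk; simpa using h1
      · simpa [hk] using h2 k
  rw [this, Measure.prod_prod, Measure.pi_pi, ← Finset.mul_prod_erase _ _ (Finset.mem_univ i),
    ← Finset.mul_prod_erase (a := i) (f := fun k => μ (s k)) _ (Finset.mem_univ i)]
  simp only [Function.update_self, measure_univ, one_mul]
  congr 1
  exact Finset.prod_congr rfl fun k hk => by rw [Function.update_of_ne (Finset.ne_of_mem_erase hk)]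

end Update

/-! ### Moments and lower tails of i.i.d. sums. -/

section IIDSums

variable {B : ℕ} {Ω : Type*} [MeasurableSpace Ω] {μ : Measure Ω} [IsProbabilityMeasure μ]

lemma hasMoments_eval {h : Ω → ℝ} (hh : HasMoments h μ) (a : Fin B) :
    HasMoments (fun ω : Fin B → Ω => h (ω a)) (Measure.pi fun _ => μ) :=
  hh.comp (measurePreserving_eval (fun _ : Fin B => μ) a)

lemma hasMoments_sum_eval {h : Ω → ℝ} (hh : HasMoments h μ) :
    HasMoments (fun ω : Fin B → Ω => ∑ a, h (ω a)) (Measure.pi fun _ => μ) :=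
  HasMoments.sum _ fun a _ => hasMoments_eval hh a

lemma integral_comp_eval_pi {h : Ω → ℝ} (hh : AEStronglyMeasurable h μ) (a : Fin B) :
    ∫ ω : Fin B → Ω, h (ω a) ∂(Measure.pi fun _ => μ) = ∫ x, h x ∂μ := by
  have := measurePreserving_eval (fun _ : Fin B => μ) a
  rw [← this.map_eq] at hh ⊢
  rw [integral_map this.measurable.aemeasurable hh]
  simp [this.map_eq]

lemma integral_sum_eval {h : Ω → ℝ} (hh : HasMoments h μ) :
    ∫ ω : Fin B → Ω, ∑ a, h (ω a) ∂(Measure.pi fun _ => μ) = B * ∫ x, h x ∂μ := by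
  rw [integral_finsetSum _ fun a _ => (hasMoments_eval hh a).integrable]
  simp [integral_comp_eval_pi hh.integrable.aestronglyMeasurable]

/-- Second moment of a sum of i.i.d. random variables. -/
lemma integral_sq_sum_eval_le {h : Ω → ℝ} (hh : HasMoments h μ) :
    ∫ ω : Fin B → Ω, (∑ a, h (ω a)) ^ 2 ∂(Measure.pi fun _ => μ)
      ≤ B * ∫ x, h x ^ 2 ∂μ + (B * ∫ x, h x ∂μ) ^ 2 := by
  have hs := hasMoments_sum_eval (B := B) hh
  have h1 := variance_sum_pi (ι := Fin B) (μ := fun _ => μ) (X := fun _ => h)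
    (fun _ => hh.memLp_two)
  have e : (∑ i : Fin B, fun ω : Fin B → Ω => h (ω i)) = fun ω => ∑ i, h (ω i) := by
    ext ω; simp
  rw [e, variance_eq_sub hs.memLp_two, integral_sum_eval hh] at h1
  have h2 : Var[h; μ] ≤ ∫ x, h x ^ 2 ∂μ := by
    have := variance_le_expectation_sq (μ := μ) (X := h) hh.integrable.aestronglyMeasurable
    simpa using this
  have h3 : ∑ i : Fin B, Var[h; μ] ≤ B * ∫ x, h x ^ 2 ∂μ := by
    simpa using mul_le_mul_of_nonneg_left h2 (Nat.cast_nonneg B)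
  simp only [Pi.pow_apply] at h1
  linarith

/-- Written as a product over all coordinates, the integrand factorises by Fubini; the conditionals
cover every pattern of coincidences among `a`, `b`, `c` at once. -/
lemma integral_mul_mul_eval {g h k : Ω → ℝ} (a b c : Fin B) :
    ∫ ω : Fin B → Ω, g (ω a) * h (ω b) * k (ω c) ∂(Measure.pi fun _ => μ)
      = ∏ d, ∫ x, (if d = a then g x else 1) * (if d = b then h x else 1)
          * (if d = c then k x else 1) ∂μ := by
  rw [← integral_fintype_prod_eq_prod (f := fun (d : Fin B) x => (if d = a then g x else 1)
    * (if d = b then h x else 1) * (if d = c then k x else 1))]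
  congr 1; ext ω
  rw [Finset.prod_mul_distrib, Finset.prod_mul_distrib]
  simp only [Finset.prod_ite_eq', Finset.mem_univ, if_true]

/-- The mixed moment `E[(∑ g) (∑ h)²]` of i.i.d. pairs with `E h = 0` and `g ≥ 0`. -/
lemma integral_sum_mul_sum_sq_le {g h : Ω → ℝ} (hg : HasMoments g μ) (hh : HasMoments h μ)
    {K : ℝ} (h0 : ∫ x, h x ∂μ = 0)
    (hK : ∫ x, g x * h x ^ 2 ∂μ ≤ K) (hK' : (∫ x, g x ∂μ) * ∫ x, h x ^ 2 ∂μ ≤ K) :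
    ∫ ω : Fin B → Ω, (∑ a, g (ω a)) * (∑ a, h (ω a)) ^ 2 ∂(Measure.pi fun _ => μ)
      ≤ (B : ℝ) ^ 2 * K := by
  have e : ∀ ω : Fin B → Ω, (∑ a, g (ω a)) * (∑ a, h (ω a)) ^ 2
      = ∑ a, ∑ b, ∑ c, g (ω a) * h (ω b) * h (ω c) := by
    intro ω
    rw [sq, Finset.sum_mul_sum, Finset.sum_mul]
    refine Finset.sum_congr rfl fun a _ => ?_
    rw [Finset.mul_sum]
    refine Finset.sum_congr rfl fun b _ => ?_
    rw [Finset.mul_sum]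
    exact Finset.sum_congr rfl fun c _ => by ring
  simp_rw [e]
  have hm : ∀ a b c : Fin B, HasMoments (fun ω : Fin B → Ω => g (ω a) * h (ω b) * h (ω c))
      (Measure.pi fun _ => μ) := fun a b c =>
    ((hasMoments_eval hg a).mul (hasMoments_eval hh b)).mul (hasMoments_eval hh c)
  -- If `b ≠ c`, at least one of them differs from `a` as well, and its coordinate contributes the
  -- factor `∫ h = 0`. Only `B²` of the `B³` terms survive.
  have off : ∀ a b c : Fin B, b ≠ c →
      ∫ ω : Fin B → Ω, g (ω a) * h (ω b) * h (ω c) ∂(Measure.pi fun _ => μ) = 0 := by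
    intro a b c hbc
    rw [integral_mul_mul_eval]
    by_cases hab : a = b
    · refine Finset.prod_eq_zero (Finset.mem_univ c) ?_
      simp [hbc.symm, hab, h0]
    · refine Finset.prod_eq_zero (Finset.mem_univ b) ?_
      simp [hbc, Ne.symm hab, h0]
  have diag : ∀ a b : Fin B,
      ∫ ω : Fin B → Ω, g (ω a) * h (ω b) * h (ω b) ∂(Measure.pi fun _ => μ) ≤ K := by
    intro a b
    by_cases hab : a = b
    · subst hab
      have := integral_comp_eval_pi (μ := μ) (h := fun x => g x * h x ^ 2)
        (hg.mul (hh.pow 2)).integrable.aestronglyMeasurable a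
      simp_rw [mul_assoc, ← sq]
      rw [this]; exact hK
    · rw [integral_mul_mul_eval, ← Finset.mul_prod_erase _ _ (Finset.mem_univ a),
        ← Finset.mul_prod_erase _ _ (Finset.mem_erase.2 ⟨Ne.symm hab, Finset.mem_univ b⟩),
        Finset.prod_eq_one]
      · simpa [hab, Ne.symm hab, ← sq] using hK'
      · intro d hd
        simp only [Finset.mem_erase] at hd
        simp [hd.1, hd.2.1]
  rw [integral_finsetSum _ fun a _ => (HasMoments.sum _ fun b _ =>
    HasMoments.sum _ fun c _ => hm a b c).integrable]
  have : ∀ a : Fin B, ∫ ω : Fin B → Ω, ∑ b, ∑ c, g (ω a) * h (ω b) * h (ω c)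
      ∂(Measure.pi fun _ => μ) ≤ B * K := by
    intro a
    rw [integral_finsetSum _ fun b _ => (HasMoments.sum _ fun c _ => hm a b c).integrable]
    have : ∀ b ∈ (Finset.univ : Finset (Fin B)), ∫ ω : Fin B → Ω, ∑ c, g (ω a) * h (ω b) * h (ω c)
      ∂(Measure.pi fun _ => μ) ≤ K := by
      intro b _
      rw [integral_finsetSum _ fun c _ => (hm a b c).integrable,
        Finset.sum_eq_single b (fun c _ hc => off a b c (Ne.symm hc)) (by simp)]
      exact diag a b
    simpa using Finset.sum_le_card_nsmul _ _ _ this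
  have := Finset.sum_le_card_nsmul Finset.univ _ _ fun a _ => this a
  simp only [Finset.card_univ, Fintype.card_fin, nsmul_eq_mul] at this
  calc _ ≤ _ := this
    _ = _ := by ring

/-- Lower tail (Chernoff) bound for sums of i.i.d. nonnegative random variables. -/
lemma measure_sum_eval_le {ζ : Ω → ℝ} (hm : Measurable ζ) (hζ : HasMoments ζ μ)
    (h0 : ∀ x, 0 ≤ ζ x) {L m₁ m₂ c : ℝ} (hL : 0 ≤ L)
    (h1 : m₁ ≤ ∫ x, ζ x ∂μ) (h2 : ∫ x, ζ x ^ 2 ∂μ ≤ m₂) :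
    (Measure.pi fun _ => μ).real {ω : Fin B → Ω | ∑ a, ζ (ω a) < B * c}
      ≤ Real.exp (-(B * (L * (m₁ - c) - L ^ 2 * m₂ / 2))) := by
  have hle : ∫ x, Real.exp (-(L * ζ x)) ∂μ ≤ Real.exp (- (L * m₁) + L ^ 2 * m₂ / 2) := by
    -- With `y = L ζ x` this follows from `e^y ≥ 1 + y + y²/2` and `(1 + y + y²/2)(1 - y + y²/2) = 1
    -- + y⁴/4 ≥ 1`.
    have hb : ∀ x, Real.exp (-(L * ζ x)) ≤ 1 - L * ζ x + L ^ 2 / 2 * ζ x ^ 2 := by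
      intro x
      have hx : 0 ≤ L * ζ x := mul_nonneg hL (h0 x)
      have := Real.quadratic_le_exp_of_nonneg hx
      have h3 : 0 < Real.exp (L * ζ x) := Real.exp_pos _
      rw [Real.exp_neg, inv_le_comm₀ h3 (by nlinarith [sq_nonneg (L * ζ x - 1)])]
      refine le_trans ?_ this
      rw [inv_le_iff_one_le_mul₀ (by nlinarith [sq_nonneg (L * ζ x - 1)])]
      nlinarith [sq_nonneg ((L * ζ x) ^ 2)]
    have hi : Integrable (fun x => 1 - L * ζ x + L ^ 2 / 2 * ζ x ^ 2) μ :=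
      (((HasMoments.const 1).sub ((HasMoments.const L).mul hζ)).add
        ((HasMoments.const (L ^ 2 / 2)).mul (hζ.pow 2))).integrable
    have hi' : Integrable (fun x => Real.exp (-(L * ζ x))) μ :=
      Integrable.of_bound (by fun_prop) 1 (Filter.Eventually.of_forall fun x => by
        simpa using mul_nonneg hL (h0 x))
    have h4 := integral_mono hi' hi hb
    rw [integral_add (((HasMoments.const 1).sub ((HasMoments.const L).mul hζ)).integrable)
      (((HasMoments.const (L ^ 2 / 2)).mul (hζ.pow 2)).integrable),
      integral_sub (integrable_const _) ((HasMoments.const L).mul hζ).integrable,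
      integral_const_mul, integral_const_mul] at h4
    simp only [integral_const, probReal_univ, smul_eq_mul, mul_one] at h4
    have h5 := Real.add_one_le_exp (- (L * m₁) + L ^ 2 * m₂ / 2)
    have := mul_le_mul_of_nonneg_left h1 hL
    have := mul_le_mul_of_nonneg_left h2 (sq_nonneg L)
    linarith
  have hpi : ∫ ω : Fin B → Ω, ∏ a, Real.exp (-(L * ζ (ω a))) ∂(Measure.pi fun _ => μ)
      ≤ Real.exp (B * (- (L * m₁) + L ^ 2 * m₂ / 2)) := by
    rw [integral_fintype_prod_eq_pow (ι := Fin B) (fun x => Real.exp (-(L * ζ x))), Fintype.card_fin,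
      Real.exp_nat_mul]
    exact pow_le_pow_left₀ (integral_nonneg fun x => (Real.exp_pos _).le) hle _
  have hme : Measurable (fun ω : Fin B → Ω => ∏ a, Real.exp (-(L * ζ (ω a)))) := by fun_prop
  have hprod : ∀ ω : Fin B → Ω, ∏ a, Real.exp (-(L * ζ (ω a))) = Real.exp (-(L * ∑ a, ζ (ω a))) := by
    intro ω; rw [← Real.exp_sum]; simp [Finset.mul_sum]
  have hi : Integrable (fun ω : Fin B → Ω => ∏ a, Real.exp (-(L * ζ (ω a))))
      (Measure.pi fun _ => μ) :=
    Integrable.of_bound hme.aestronglyMeasurable 1 (Filter.Eventually.of_forall fun ω => by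
      rw [hprod]
      simpa using mul_nonneg hL (Finset.sum_nonneg fun a _ => h0 (ω a)))
  have hmk := mul_meas_ge_le_integral_of_nonneg (μ := Measure.pi fun _ : Fin B => μ)
    (Filter.Eventually.of_forall fun ω => Finset.prod_nonneg fun a _ => (Real.exp_pos _).le) hi
    (Real.exp (-(L * (B * c))))
  have hsub : (Measure.pi fun _ => μ).real {ω : Fin B → Ω | ∑ a, ζ (ω a) < B * c}
      ≤ (Measure.pi fun _ => μ).real {ω : Fin B → Ω | Real.exp (-(L * (B * c)))
        ≤ ∏ a, Real.exp (-(L * ζ (ω a)))} := by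
    refine measureReal_mono fun ω hω => ?_
    simp only [Set.mem_ofPred_eq] at hω ⊢
    rw [hprod, Real.exp_le_exp]
    nlinarith
  have hp := Real.exp_pos (-(L * (B * c)))
  have h6 : Real.exp (-(L * (B * c))) * (Measure.pi fun _ => μ).real
      {ω : Fin B → Ω | ∑ a, ζ (ω a) < B * c}
      ≤ Real.exp (B * (- (L * m₁) + L ^ 2 * m₂ / 2)) :=
    (mul_le_mul_of_nonneg_left hsub hp.le).trans (hmk.trans hpi)
  rw [mul_comm, ← le_div_iff₀ hp, ← Real.exp_sub] at h6
  refine h6.trans_eq ?_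
  congr 1; ring

end IIDSums

/-! ### The mean sign of a Gaussian and its expansions. -/

section GaussianSign

@[fun_prop]
lemma measurable_sign : Measurable Real.sign := by
  unfold Real.sign
  exact Measurable.ite measurableSet_Iio measurable_const
    (Measurable.ite measurableSet_Ioi measurable_const measurable_const)

lemma abs_sign_le_one (x : ℝ) : |Real.sign x| ≤ 1 := by
  rcases Real.sign_apply_eq x with h | h | h <;> simp [h]

/-- The mean sign of a Gaussian of mean `M` and variance `s`. -/
noncomputable def meanSign (M s : ℝ) : ℝ := ∫ g, Real.sign (M + √s * g) ∂gauss

lemma abs_meanSign_le_one (M s : ℝ) : |meanSign M s| ≤ 1 := by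
  have := norm_integral_le_of_norm_le_const (μ := gauss) (f := fun g => Real.sign (M + √s * g))
    (C := 1) (Filter.Eventually.of_forall fun g => abs_sign_le_one _)
  simpa [meanSign] using this

lemma measurable_meanSign : Measurable (fun z : ℝ × ℝ => meanSign z.1 z.2) := by
  have : StronglyMeasurable (fun w : (ℝ × ℝ) × ℝ => Real.sign (w.1.1 + √w.1.2 * w.2)) :=
    Measurable.stronglyMeasurable (by fun_prop)
  exact this.integral_prod_right'.measurable

lemma integrable_sign_comp {Ω : Type*} [MeasurableSpace Ω] {μ : Measure Ω} [IsFiniteMeasure μ]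
    {f : Ω → ℝ} (hf : Measurable f) : Integrable (fun x => Real.sign (f x)) μ :=
  Integrable.of_bound (measurable_sign.comp hf).aestronglyMeasurable 1
    (Filter.Eventually.of_forall fun _ => abs_sign_le_one _)

lemma sign_mul_of_pos {a : ℝ} (ha : 0 < a) (x : ℝ) : Real.sign (a * x) = Real.sign x := by
  rcases lt_trichotomy x 0 with h | h | h
  · rw [Real.sign_of_neg h, Real.sign_of_neg (mul_neg_of_pos_of_neg ha h)]
  · simp [h]
  · rw [Real.sign_of_pos h, Real.sign_of_pos (mul_pos ha h)]

lemma meanSign_eq_div {s : ℝ} (hs : 0 < s) (M : ℝ) : meanSign M s = meanSign (M / √s) 1 := by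
  have h := Real.sqrt_pos.2 hs
  unfold meanSign
  congr 1; ext g
  rw [← sign_mul_of_pos h (M / √s + √1 * g)]
  congr 1
  rw [mul_add, mul_div_cancel₀ _ h.ne']; simp

lemma meanSign_neg (M s : ℝ) : meanSign (-M) s = - meanSign M s := by
  unfold meanSign
  rw [← integral_neg, ← measurePreserving_neg_gauss.integral_comp
    (Homeomorph.neg ℝ).measurableEmbedding]
  congr 1; ext g
  rw [← Real.sign_neg]; congr 1; ring

/-- `√(2/π)`, twice the standard Gaussian density at the origin. -/
noncomputable def signSlope : ℝ := √(2 / Real.pi)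

lemma signSlope_pos : 0 < signSlope := by unfold signSlope; positivity

lemma signSlope_le_one : signSlope ≤ 1 := by
  unfold signSlope
  rw [Real.sqrt_le_left (by norm_num), one_pow, div_le_one Real.pi_pos]
  linarith [Real.pi_gt_three]

lemma two_mul_gaussianPDFReal (x : ℝ) :
    2 * gaussianPDFReal 0 1 x = signSlope * Real.exp (-x ^ 2 / 2) := by
  rw [gaussianPDFReal_std, ← mul_assoc]
  congr 1
  unfold signSlope
  rw [Real.sqrt_div (by norm_num), Real.sqrt_mul (by norm_num), mul_inv]
  have h : √(2 : ℝ) ≠ 0 := by positivity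
  have h2 : √(2 : ℝ) * √2 = 2 := Real.mul_self_sqrt (by norm_num)
  field_simp
  linarith

/-- The two signs differ, by exactly 2, only for `g` between `-b` and `-a`; the endpoints are null.
Estimates of the mean sign thus become estimates of the Gaussian density on an interval. -/
lemma meanSign_sub {a b : ℝ} (hab : a ≤ b) :
    meanSign b 1 - meanSign a 1 = ∫ x in Set.Ioc (-b) (-a), signSlope * Real.exp (-x ^ 2 / 2) := by
  unfold meanSign
  rw [← integral_sub (integrable_sign_comp (by fun_prop)) (integrable_sign_comp (by fun_prop))]
  have : NullSingletonClass gauss := nullSingletonClass_gaussianReal one_ne_zero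
  have hne : ∀ c : ℝ, ∀ᵐ g ∂gauss, g ≠ c := fun c => by rw [ae_iff]; simp
  have e : ∀ᵐ g ∂gauss, Real.sign (b + √1 * g) - Real.sign (a + √1 * g)
      = (Set.Ioc (-b) (-a)).indicator (fun _ => (2 : ℝ)) g := by
    filter_upwards [hne (-b), hne (-a)] with g h1 h2
    rw [Real.sqrt_one, one_mul]
    by_cases h3 : g < -b
    · rw [Real.sign_of_neg (by linarith), Real.sign_of_neg (by linarith),
        Set.indicator_of_notMem (by simp only [Set.mem_Ioc]; intro h; linarith [h.1]), sub_self]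
    · have h3' : -b < g := lt_of_le_of_ne (not_lt.1 h3) (Ne.symm h1)
      rw [Real.sign_of_pos (by linarith : 0 < b + g)]
      by_cases h4 : g < -a
      · rw [Real.sign_of_neg (by linarith), Set.indicator_of_mem (by exact ⟨h3', h4.le⟩)]; norm_num
      · have h4' : -a < g := lt_of_le_of_ne (not_lt.1 h4) (Ne.symm h2)
        rw [Real.sign_of_pos (by linarith), Set.indicator_of_notMem
          (by simp only [Set.mem_Ioc]; intro h; linarith [h.2]), sub_self]
  rw [integral_congr_ae e, integral_indicator measurableSet_Ioc, setIntegral_const, smul_eq_mul,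
    measureReal_def, gauss, gaussianReal_apply_eq_integral _ one_ne_zero, ENNReal.toReal_ofReal
      (integral_nonneg fun x => gaussianPDFReal_nonneg 0 1 x), mul_comm, ← integral_const_mul]
  simp_rw [two_mul_gaussianPDFReal]

lemma integrableOn_slope_exp (a b : ℝ) :
    IntegrableOn (fun x : ℝ => signSlope * Real.exp (-x ^ 2 / 2)) (Set.Ioc a b) :=
  (by fun_prop : Continuous fun x : ℝ => signSlope * Real.exp (-x ^ 2 / 2)).integrableOn_Ioc

lemma meanSign_sub_le {a b : ℝ} (hab : a ≤ b) :
    meanSign b 1 - meanSign a 1 ≤ signSlope * (b - a) := by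
  rw [meanSign_sub hab]
  have := setIntegral_mono_on (μ := volume) (integrableOn_slope_exp (-b) (-a))
    (integrableOn_const (C := signSlope) (by simp)) measurableSet_Ioc fun x _ => by
      have : Real.exp (-x ^ 2 / 2) ≤ 1 := Real.exp_le_one_iff.2 (by nlinarith [sq_nonneg x])
      nlinarith [signSlope_pos]
  refine this.trans_eq ?_
  rw [setIntegral_const, smul_eq_mul, Real.volume_real_Ioc_of_le (by linarith)]; ring

lemma le_meanSign_sub {a b R : ℝ} (hab : a ≤ b) (ha : a ^ 2 ≤ R) (hb : b ^ 2 ≤ R) :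
    signSlope * (b - a) * (1 - R / 2) ≤ meanSign b 1 - meanSign a 1 := by
  rw [meanSign_sub hab]
  have := setIntegral_mono_on (μ := volume) (s := Set.Ioc (-b) (-a))
    (integrableOn_const (C := signSlope * (1 - R / 2)) (by simp))
    (integrableOn_slope_exp (-b) (-a)) measurableSet_Ioc fun x hx => by
      have h1 : 1 - R / 2 ≤ Real.exp (-x ^ 2 / 2) := by
        have := Real.add_one_le_exp (-x ^ 2 / 2)
        have : x ^ 2 ≤ R := by
          rcases le_total 0 x with h | h
          · nlinarith [hx.2]
          · nlinarith [hx.1]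
        linarith
      exact mul_le_mul_of_nonneg_left h1 signSlope_pos.le
  refine le_trans (le_of_eq ?_) this
  rw [setIntegral_const, smul_eq_mul, Real.volume_real_Ioc_of_le (by linarith)]; ring

lemma abs_meanSign_sub_le (a b : ℝ) : |meanSign b 1 - meanSign a 1| ≤ |b - a| := by
  wlog hab : a ≤ b generalizing a b
  · rw [abs_sub_comm, abs_sub_comm b]; exact this b a (le_of_not_ge hab)
  have h1 := meanSign_sub_le hab
  have h2 : 0 ≤ meanSign b 1 - meanSign a 1 := by
    rw [meanSign_sub hab]
    exact integral_nonneg fun x => mul_nonneg signSlope_pos.le (Real.exp_pos _).le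
  rw [abs_of_nonneg h2, abs_of_nonneg (by linarith)]
  nlinarith [signSlope_le_one]

/-- By oddness the average is half the increment of the mean sign over `[b - a, b + a]`, an interval
of length `2a`. The density there lies between `1 - (a² + b²)` and `1` times its value at the
origin. The error keeps a factor `|a|`, however large `b` is in comparison. -/
lemma abs_meanSign_add_sub_one (a b : ℝ) :
    |(meanSign (a + b) 1 + meanSign (a - b) 1) / 2 - signSlope * a| ≤ |a| * (a ^ 2 + b ^ 2) := by
  wlog ha : 0 ≤ a generalizing a b
  · have := this (-a) b (by linarith)
    rw [show -a + b = -(a - b) by ring, show -a - b = -(a + b) by ring, meanSign_neg, meanSign_neg,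
      abs_neg, neg_sq] at this
    rw [← abs_neg]
    refine le_trans (le_of_eq ?_) this
    congr 1; ring
  have e : meanSign (a - b) 1 = - meanSign (b - a) 1 := by rw [← meanSign_neg]; congr 1; ring
  have h1 := meanSign_sub_le (a := b - a) (b := a + b) (by linarith)
  have h2 := le_meanSign_sub (a := b - a) (b := a + b) (R := 2 * (a ^ 2 + b ^ 2)) (by linarith)
    (by nlinarith [sq_nonneg (a + b)]) (by nlinarith [sq_nonneg (a - b)])
  have h3 : signSlope * (a * (a ^ 2 + b ^ 2)) ≤ 1 * (a * (a ^ 2 + b ^ 2)) :=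
    mul_le_mul_of_nonneg_right signSlope_le_one (by positivity)
  rw [e, abs_le, abs_of_nonneg ha]
  constructor
  · nlinarith
  · have : 0 ≤ a * (a ^ 2 + b ^ 2) := by positivity
    linarith

/-- Symmetrised linearisation of the mean sign in its mean. -/
lemma abs_meanSign_add_sub {s τ : ℝ} (hτ : 0 < τ) (hs : τ ≤ s) (m z : ℝ) :
    |(meanSign (m + z) s + meanSign (m - z) s) / 2 - signSlope * (m / √s)|
      ≤ |m| * (m ^ 2 + z ^ 2) / (τ * √τ) := by
  have hs0 : 0 < s := hτ.trans_le hs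
  have hq := Real.sqrt_pos.2 hs0
  rw [meanSign_eq_div hs0, meanSign_eq_div hs0 (m - z), add_div m, sub_div m]
  refine (abs_meanSign_add_sub_one _ _).trans ?_
  rw [div_pow, div_pow, Real.sq_sqrt hs0.le, ← add_div, abs_div, abs_of_pos hq, div_mul_div_comm]
  have h2 : 0 < τ * √τ := by positivity
  have h1 : τ * √τ ≤ √s * s := by
    rw [mul_comm (√s)]; exact mul_le_mul hs (Real.sqrt_le_sqrt hs) (by positivity) hs0.le
  gcongr

/-- Continuity of the mean sign in its variance. -/
lemma abs_meanSign_sub_meanSign {s s' τ : ℝ} (hτ : 0 < τ) (hs : 0 ≤ s) (hs' : τ ≤ s') (M : ℝ) :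
    |meanSign M s - meanSign M s'|
      ≤ 8 * (s - s') ^ 2 / τ ^ 2 + 2 * (|M| * |s - s'|) / (τ * √τ) := by
  have hs0 : 0 < s' := hτ.trans_le hs'
  -- If `s` is far below `s'`, the trivial bound 2 is paid for by the quadratic term, since `(s -
  -- s')² ≥ τ²/4`. Otherwise both variances are at least `τ/2` and the mean sign is Lipschitz in `M
  -- / √s`.
  by_cases h : s < s' / 2
  · have h1 : |meanSign M s - meanSign M s'| ≤ 2 := by
      have := abs_sub (meanSign M s) (meanSign M s')
      linarith [abs_meanSign_le_one M s, abs_meanSign_le_one M s']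
    have h2 : 2 ≤ 8 * (s - s') ^ 2 / τ ^ 2 := by
      rw [le_div_iff₀ (by positivity)]; nlinarith
    have h3 : 0 ≤ 2 * (|M| * |s - s'|) / (τ * √τ) := by positivity
    linarith
  · push Not at h
    have hsp : 0 < s := by linarith
    have h3 : 0 ≤ 8 * (s - s') ^ 2 / τ ^ 2 := by positivity
    refine le_trans ?_ (le_add_of_nonneg_left h3)
    rw [meanSign_eq_div hsp, meanSign_eq_div hs0]
    refine (abs_meanSign_sub_le _ _).trans ?_
    have p := Real.sqrt_pos.2 hsp
    have p' := Real.sqrt_pos.2 hs0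
    have e : M / √s - M / √s' = M * (s' - s) / (√s * √s' * (√s + √s')) := by
      rw [div_sub_div _ _ p.ne' p'.ne', div_eq_div_iff (by positivity) (by positivity)]
      have e1 := Real.sq_sqrt hsp.le
      have e2 := Real.sq_sqrt hs0.le
      calc _ = M * (√s * √s') * (√s' ^ 2 - √s ^ 2) := by ring
        _ = _ := by rw [e1, e2]; ring
    rw [e, abs_div, abs_mul, abs_sub_comm s' s, abs_of_pos (a := √s * √s' * (√s + √s')) (by positivity),
      div_le_div_iff₀ (by positivity) (by positivity)]
    have h4 : √s' / 2 ≤ √s := by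
      rw [div_le_iff₀ (by norm_num), Real.sqrt_le_left (by positivity), mul_pow, Real.sq_sqrt hsp.le]
      linarith
    have h5 : τ * √τ ≤ 2 * (√s * √s' * (√s + √s')) := by
      have : τ * √τ ≤ s' * √s' := mul_le_mul hs' (Real.sqrt_le_sqrt hs') (by positivity) hs0.le
      have h6 : √s' / 2 * √s' * (0 + √s') ≤ √s * √s' * (√s + √s') := by gcongr
      have := Real.mul_self_sqrt hs0.le
      nlinarith
    have : 0 ≤ |M| * |s - s'| := by positivity
    nlinarith

/-- Second-order expansion of `A / √D` at `A = D = 1`, with a cut-off at small `D`. -/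
lemma abs_ite_div_sqrt_sub_le {A D : ℝ} (hD : 0 ≤ D) :
    |(if 1 / 4 ≤ D then A / √D else 0) - (A - (D - 1) / 2)| ≤ 10 * ((A - 1) ^ 2 + (D - 1) ^ 2) := by
  split_ifs with h
  · set w := √D
    have hw : 1 / 2 ≤ w := Real.le_sqrt_of_sq_le (by norm_num; linarith)
    have hw0 : 0 < w := by linarith
    have e : D = w ^ 2 := (Real.sq_sqrt hD).symm
    rw [e]
    have e2 : A / w - (A - (w ^ 2 - 1) / 2) = (A - 1) * ((1 - w) / w) + (w - 1) ^ 2 * ((w + 2) / (2 * w)) := by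
      field_simp; ring
    have h1 : |(1 - w) / w| ≤ 2 * |w ^ 2 - 1| := by
      rw [abs_div, abs_of_pos hw0, div_le_iff₀ hw0, show w ^ 2 - 1 = (w + 1) * (w - 1) by ring,
        abs_mul, abs_sub_comm, abs_of_pos (by linarith : 0 < w + 1)]
      have : 1 ≤ 2 * (w + 1) * w := by nlinarith
      nlinarith [abs_nonneg (w - 1)]
    have h2 : (w - 1) ^ 2 * ((w + 2) / (2 * w)) ≤ 3 * (w ^ 2 - 1) ^ 2 := by
      have h3 : (w + 2) / (2 * w) ≤ 3 := by rw [div_le_iff₀ (by linarith)]; linarith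
      have h4 : (w - 1) ^ 2 ≤ (w ^ 2 - 1) ^ 2 := by
        rw [show (w ^ 2 - 1) ^ 2 = (w + 1) ^ 2 * (w - 1) ^ 2 by ring]
        nlinarith [sq_nonneg (w - 1)]
      have h5 : 0 ≤ (w + 2) / (2 * w) := by positivity
      nlinarith [sq_nonneg (w - 1), sq_nonneg (w ^ 2 - 1)]
    have h6 : 0 ≤ (w - 1) ^ 2 * ((w + 2) / (2 * w)) := by positivity
    rw [e2]
    refine (abs_add_le _ _).trans ?_
    rw [abs_mul, abs_of_nonneg h6]
    have h7 := mul_le_mul_of_nonneg_left h1 (abs_nonneg (A - 1))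
    nlinarith [sq_nonneg (|A - 1| - |w ^ 2 - 1|), sq_abs (A - 1), sq_abs (w ^ 2 - 1)]
  -- Below the cut-off `(D - 1)²` is at least `9/16`, which absorbs the whole expansion.
  · push Not at h
    rw [abs_le]
    constructor <;> nlinarith [sq_nonneg (A - 1), sq_nonneg (A - 2), sq_nonneg (D - 1), sq_nonneg A]

/-- With `A = w²` the difference is exactly `-(w - 1)²/2`. -/
lemma abs_sqrt_sub_le {A : ℝ} (hA : 0 ≤ A) : |√A - (1 + (A - 1) / 2)| ≤ (A - 1) ^ 2 := by
  obtain ⟨w, hw, rfl⟩ : ∃ w : ℝ, 0 ≤ w ∧ A = w ^ 2 := ⟨√A, Real.sqrt_nonneg _, (Real.sq_sqrt hA).symm⟩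
  rw [Real.sqrt_sq hw, show w - (1 + (w ^ 2 - 1) / 2) = -((w - 1) ^ 2 / 2) by ring, abs_neg,
    abs_of_nonneg (by positivity), show (w ^ 2 - 1) ^ 2 = (w + 1) ^ 2 * (w - 1) ^ 2 by ring]
  nlinarith [sq_nonneg (w - 1), mul_nonneg hw (sq_nonneg (w - 1)),
    mul_nonneg (sq_nonneg w) (sq_nonneg (w - 1))]

end GaussianSign

/-! ### Moments of a single sample. -/

section Sample

/-- The variables of one sample: one distinguished output and input coordinate, and the output
vector. -/
abbrev Smp (p : ℕ) : Type := ℝ × ℝ × (Fin p → ℝ)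

/-- The standard Gaussian law of a sample. -/
noncomputable abbrev smpLaw (p : ℕ) : Measure (Smp p) := gauss.prod (gauss.prod (gaussPi (Fin p)))

variable {p q B : ℕ}

/-- `u² v²`. -/
def sqProd (t : Smp p) : ℝ := t.1 ^ 2 * t.2.1 ^ 2

/-- `u v² ⟨w, x⟩`. -/
def noiseTerm (w : Fin p → ℝ) (t : Smp p) : ℝ := t.1 * t.2.1 ^ 2 * lin w t.2.2

/-- `u² v² |W x|²`. -/
def freeVar (W : Fin q → Fin p → ℝ) (t : Smp p) : ℝ := sqProd t * ∑ l, lin (W l) t.2.2 ^ 2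

/-- `u² v² |u e + W x|²`. -/
def fullVar (e : Fin q → ℝ) (W : Fin q → Fin p → ℝ) (t : Smp p) : ℝ :=
  sqProd t * ∑ l, (e l * t.1 + lin (W l) t.2.2) ^ 2

@[fun_prop]
lemma measurable_sqProd : Measurable (sqProd (p := p)) := by unfold sqProd; fun_prop

@[fun_prop]
lemma measurable_noiseTerm (w : Fin p → ℝ) : Measurable (noiseTerm w) := by
  unfold noiseTerm; fun_prop

@[fun_prop]
lemma measurable_freeVar (W : Fin q → Fin p → ℝ) : Measurable (freeVar W) := by
  unfold freeVar; fun_prop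

@[fun_prop]
lemma measurable_fullVar (e : Fin q → ℝ) (W : Fin q → Fin p → ℝ) : Measurable (fullVar e W) := by
  unfold fullVar; fun_prop

lemma sqProd_nonneg (t : Smp p) : 0 ≤ sqProd t := by unfold sqProd; positivity

lemma freeVar_nonneg (W : Fin q → Fin p → ℝ) (t : Smp p) : 0 ≤ freeVar W t :=
  mul_nonneg (sqProd_nonneg t) (by positivity)

lemma fullVar_nonneg (e : Fin q → ℝ) (W : Fin q → Fin p → ℝ) (t : Smp p) : 0 ≤ fullVar e W t :=
  mul_nonneg (sqProd_nonneg t) (by positivity)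

lemma hasMoments_smp_out : HasMoments (fun t : Smp p => t.1) (smpLaw p) :=
  hasMoments_id_gauss.comp measurePreserving_fst

lemma hasMoments_smp_in : HasMoments (fun t : Smp p => t.2.1) (smpLaw p) :=
  hasMoments_id_gauss.comp (measurePreserving_fst.comp measurePreserving_snd)

lemma hasMoments_smp_lin (w : Fin p → ℝ) : HasMoments (fun t : Smp p => lin w t.2.2) (smpLaw p) :=
  (hasMoments_lin w).comp (measurePreserving_snd.comp measurePreserving_snd)

lemma hasMoments_sqProd : HasMoments (sqProd (p := p)) (smpLaw p) :=
  (hasMoments_smp_out.pow 2).mul (hasMoments_smp_in.pow 2)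

lemma hasMoments_noiseTerm (w : Fin p → ℝ) : HasMoments (noiseTerm w) (smpLaw p) :=
  (hasMoments_smp_out.mul (hasMoments_smp_in.pow 2)).mul (hasMoments_smp_lin w)

lemma hasMoments_freeVar (W : Fin q → Fin p → ℝ) : HasMoments (freeVar W) (smpLaw p) :=
  hasMoments_sqProd.mul (HasMoments.sum _ fun l _ => (hasMoments_smp_lin (W l)).pow 2)

lemma hasMoments_fullVar (e : Fin q → ℝ) (W : Fin q → Fin p → ℝ) :
    HasMoments (fullVar e W) (smpLaw p) :=
  hasMoments_sqProd.mul (HasMoments.sum _ fun l _ =>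
    (((HasMoments.const (e l)).mul hasMoments_smp_out).add (hasMoments_smp_lin (W l))).pow 2)

/-- Fubini for the three independent parts of a sample; the moments below are read off from it. -/
lemma integral_smp (a b : ℕ) (F : (Fin p → ℝ) → ℝ) :
    ∫ t : Smp p, t.1 ^ a * t.2.1 ^ b * F t.2.2 ∂(smpLaw p)
      = (∫ x, x ^ a ∂gauss) * (∫ x, x ^ b ∂gauss) * ∫ x, F x ∂(gaussPi (Fin p)) := by
  simp_rw [mul_assoc]
  rw [integral_prod_mul (fun x : ℝ => x ^ a) (fun t : ℝ × (Fin p → ℝ) => t.1 ^ b * F t.2),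
    integral_prod_mul (fun x : ℝ => x ^ b) F]

lemma integral_sqProd : ∫ t : Smp p, sqProd t ∂(smpLaw p) = 1 := by
  have := integral_smp (p := p) 2 2 (fun _ => 1)
  simpa [integral_sq_gauss, sqProd] using this

lemma integral_sqProd_sq : ∫ t : Smp p, sqProd t ^ 2 ∂(smpLaw p) = 9 := by
  have := integral_smp (p := p) 4 4 (fun _ => 1)
  rw [integral_pow_four_gauss] at this
  norm_num at this
  rw [← this]; congr 1; ext t; simp only [sqProd]; ring

lemma integral_sqProd_cube : ∫ t : Smp p, sqProd t ^ 3 ∂(smpLaw p) = 225 := by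
  have := integral_smp (p := p) 6 6 (fun _ => 1)
  rw [integral_pow_six_gauss] at this
  norm_num at this
  rw [← this]; congr 1; ext t; simp only [sqProd]; ring

lemma integral_noiseTerm (w : Fin p → ℝ) : ∫ t, noiseTerm w t ∂(smpLaw p) = 0 := by
  have := integral_smp (p := p) 1 2 (lin w)
  rw [integral_lin, mul_zero] at this
  simpa [noiseTerm] using this

lemma integral_noiseTerm_sq (w : Fin p → ℝ) :
    ∫ t, noiseTerm w t ^ 2 ∂(smpLaw p) = 3 * ∑ k, w k ^ 2 := by
  have := integral_smp (p := p) 2 4 (fun x => lin w x ^ 2)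
  rw [integral_lin_sq, integral_pow_four_gauss, integral_sq_gauss, one_mul] at this
  rw [← this]; congr 1; ext t; simp only [noiseTerm]; ring

lemma integral_sqProd_mul_noiseTerm_sq (w : Fin p → ℝ) :
    ∫ t, sqProd t * noiseTerm w t ^ 2 ∂(smpLaw p) = 45 * ∑ k, w k ^ 2 := by
  have := integral_smp (p := p) 4 6 (fun x => lin w x ^ 2)
  rw [integral_lin_sq, integral_pow_four_gauss, integral_pow_six_gauss] at this
  norm_num at this
  rw [← this]; congr 1; ext t; simp only [noiseTerm, sqProd]; ring

lemma integral_freeVar (W : Fin q → Fin p → ℝ) :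
    ∫ t, freeVar W t ∂(smpLaw p) = ∑ l, ∑ k, W l k ^ 2 := by
  have := integral_smp (p := p) 2 2 (fun x => ∑ l, lin (W l) x ^ 2)
  rw [integral_finsetSum _ fun l _ => ((hasMoments_lin (W l)).pow 2).integrable] at this
  simp_rw [integral_lin_sq, integral_sq_gauss, one_mul] at this
  exact this

/-- Expand the square and apply Cauchy-Schwarz to each cross term; a centred Gaussian of variance
`σ²` has fourth moment `3σ⁴`. No independence between the forms is needed. -/
lemma integral_sum_lin_sq_sq_le (W : Fin q → Fin p → ℝ) :
    ∫ x, (∑ l, lin (W l) x ^ 2) ^ 2 ∂(gaussPi (Fin p)) ≤ 3 * (∑ l, ∑ k, W l k ^ 2) ^ 2 := by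
  have hm : ∀ l l', HasMoments (fun x => lin (W l) x ^ 2 * lin (W l') x ^ 2) (gaussPi (Fin p)) :=
    fun l l' => ((hasMoments_lin (W l)).pow 2).mul ((hasMoments_lin (W l')).pow 2)
  have h : ∀ l l', ∫ x, lin (W l) x ^ 2 * lin (W l') x ^ 2 ∂(gaussPi (Fin p))
      ≤ 3 * ((∑ k, W l k ^ 2) * ∑ k, W l' k ^ 2) := by
    intro l l'
    have := integral_abs_mul_le ((hasMoments_lin (W l)).pow 2) ((hasMoments_lin (W l')).pow 2)
    simp only [abs_pow, sq_abs, ← pow_mul] at this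
    norm_num at this
    rw [integral_lin_pow_four, integral_lin_pow_four, ← Real.sqrt_mul (by positivity)] at this
    refine this.trans_eq ?_
    rw [show 3 * (∑ k, W l k ^ 2) ^ 2 * (3 * (∑ k, W l' k ^ 2) ^ 2)
      = (3 * ((∑ k, W l k ^ 2) * ∑ k, W l' k ^ 2)) ^ 2 by ring, Real.sqrt_sq (by positivity)]
  have e : ∀ x, (∑ l, lin (W l) x ^ 2) ^ 2 = ∑ l, ∑ l', lin (W l) x ^ 2 * lin (W l') x ^ 2 := by
    intro x; rw [sq, Finset.sum_mul_sum]
  simp_rw [e]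
  rw [integral_finsetSum _ fun l _ => (HasMoments.sum _ fun l' _ => hm l l').integrable]
  calc _ ≤ ∑ l, ∑ l', 3 * ((∑ k, W l k ^ 2) * ∑ k, W l' k ^ 2) := by
        refine Finset.sum_le_sum fun l _ => ?_
        rw [integral_finsetSum _ fun l' _ => (hm l l').integrable]
        exact Finset.sum_le_sum fun l' _ => h l l'
    _ = _ := by simp_rw [← Finset.mul_sum]; rw [← Finset.sum_mul, sq]

lemma integral_freeVar_sq_le (W : Fin q → Fin p → ℝ) :
    ∫ t, freeVar W t ^ 2 ∂(smpLaw p) ≤ 27 * (∑ l, ∑ k, W l k ^ 2) ^ 2 := by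
  have := integral_smp (p := p) 4 4 (fun x => (∑ l, lin (W l) x ^ 2) ^ 2)
  rw [integral_pow_four_gauss] at this
  have e : ∫ t, freeVar W t ^ 2 ∂(smpLaw p)
      = ∫ t : Smp p, t.1 ^ 4 * t.2.1 ^ 4 * (∑ l, lin (W l) t.2.2 ^ 2) ^ 2 ∂(smpLaw p) := by
    congr 1; ext t; simp only [freeVar, sqProd]; ring
  rw [e, this]
  linarith [integral_sum_lin_sq_sq_le W]

/-- The transpose action `Wᵀ e`. -/
def pull (e : Fin q → ℝ) (W : Fin q → Fin p → ℝ) (k : Fin p) : ℝ := ∑ l, e l * W l k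

lemma lin_pull (e : Fin q → ℝ) (W : Fin q → Fin p → ℝ) (x : Fin p → ℝ) :
    lin (pull e W) x = ∑ l, e l * lin (W l) x := by
  simp only [lin, pull, Finset.sum_mul, Finset.mul_sum]
  rw [Finset.sum_comm]
  exact Finset.sum_congr rfl fun l _ => Finset.sum_congr rfl fun k _ => by ring

lemma sum_pull_sq_le (e : Fin q → ℝ) (W : Fin q → Fin p → ℝ) :
    ∑ k, pull e W k ^ 2 ≤ (∑ l, e l ^ 2) * ∑ l, ∑ k, W l k ^ 2 := by
  rw [Finset.sum_comm, Finset.mul_sum]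
  exact Finset.sum_le_sum fun k _ => Finset.sum_mul_sq_le_sq_mul_sq _ _ _

/-- The cross term of the square is linear in `x`, hence centred. The excess variance due to row `i`
therefore has mean of order `|e|²`, although its fluctuations are of order `|e| |W|`. -/
lemma fullVar_sub_freeVar (e : Fin q → ℝ) (W : Fin q → Fin p → ℝ) (t : Smp p) :
    fullVar e W t - freeVar W t
      = t.1 ^ 4 * t.2.1 ^ 2 * (∑ l, e l ^ 2) + 2 * (t.1 ^ 3 * t.2.1 ^ 2 * lin (pull e W) t.2.2) := by
  rw [lin_pull, fullVar, freeVar, ← mul_sub, ← Finset.sum_sub_distrib]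
  have : ∑ l, ((e l * t.1 + lin (W l) t.2.2) ^ 2 - lin (W l) t.2.2 ^ 2)
      = t.1 ^ 2 * ∑ l, e l ^ 2 + 2 * t.1 * ∑ l, e l * lin (W l) t.2.2 := by
    rw [Finset.mul_sum, Finset.mul_sum, ← Finset.sum_add_distrib]
    exact Finset.sum_congr rfl fun l _ => by ring
  rw [this, sqProd]; ring

lemma hasMoments_smp_monomial (a b : ℕ) (w : Fin p → ℝ) :
    HasMoments (fun t : Smp p => t.1 ^ a * t.2.1 ^ b * lin w t.2.2) (smpLaw p) :=
  ((hasMoments_smp_out.pow a).mul (hasMoments_smp_in.pow b)).mul (hasMoments_smp_lin w)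

lemma hasMoments_smp_pow (a b : ℕ) (c : ℝ) :
    HasMoments (fun t : Smp p => t.1 ^ a * t.2.1 ^ b * c) (smpLaw p) :=
  ((hasMoments_smp_out.pow a).mul (hasMoments_smp_in.pow b)).mul (HasMoments.const c)

lemma integral_fullVar_sub_freeVar (e : Fin q → ℝ) (W : Fin q → Fin p → ℝ) :
    ∫ t, (fullVar e W t - freeVar W t) ∂(smpLaw p) = 3 * ∑ l, e l ^ 2 := by
  simp_rw [fullVar_sub_freeVar]
  rw [integral_add (hasMoments_smp_pow _ _ _).integrable
    ((HasMoments.const 2).mul (hasMoments_smp_monomial _ _ _)).integrable, integral_const_mul,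
    integral_smp 4 2 (fun _ => ∑ l, e l ^ 2), integral_smp 3 2, integral_lin,
    integral_pow_four_gauss, integral_sq_gauss]
  simp

lemma integral_fullVar_sub_freeVar_sq_le (e : Fin q → ℝ) (W : Fin q → Fin p → ℝ) :
    ∫ t, (fullVar e W t - freeVar W t) ^ 2 ∂(smpLaw p)
      ≤ 630 * (∑ l, e l ^ 2) ^ 2 + 360 * ((∑ l, e l ^ 2) * ∑ l, ∑ k, W l k ^ 2) := by
  -- The constants come from the Gaussian moments: `630 = 2 · 105 · 3` and `360 = 8 · 15 · 3`.
  have hb : ∀ t : Smp p, (fullVar e W t - freeVar W t) ^ 2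
      ≤ 2 * (t.1 ^ 8 * t.2.1 ^ 4 * (∑ l, e l ^ 2) ^ 2)
        + 8 * (t.1 ^ 6 * t.2.1 ^ 4 * lin (pull e W) t.2.2 ^ 2) := by
    intro t
    rw [fullVar_sub_freeVar]
    refine (add_sq_le).trans (le_of_eq ?_)
    ring
  have i1 := (HasMoments.const 2).mul (hasMoments_smp_pow (p := p) 8 4 ((∑ l, e l ^ 2) ^ 2))
  have i2 := (HasMoments.const 8).mul
    (((hasMoments_smp_out.pow 6).mul (hasMoments_smp_in.pow 4)).mul
      ((hasMoments_smp_lin (pull e W)).pow 2))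
  have := integral_mono (((hasMoments_fullVar e W).sub (hasMoments_freeVar W)).pow 2).integrable
    (i1.add i2).integrable hb
  rw [integral_add i1.integrable i2.integrable, integral_const_mul, integral_const_mul,
    integral_smp 8 4 (fun _ => (∑ l, e l ^ 2) ^ 2), integral_smp 6 4 (fun x => lin (pull e W) x ^ 2),
    integral_lin_sq, integral_pow_four_gauss, integral_pow_eight_gauss, integral_pow_six_gauss] at this
  simp only [integral_const, probReal_univ, smul_eq_mul, one_mul] at this
  linarith [sum_pull_sq_le e W]

lemma integral_mean_sq_le (d : ℝ) (w : Fin p → ℝ) :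
    ∫ t, (d * sqProd t + noiseTerm w t) ^ 2 ∂(smpLaw p) ≤ 18 * d ^ 2 + 6 * ∑ k, w k ^ 2 := by
  have i1 := (HasMoments.const (2 * d ^ 2)).mul ((hasMoments_sqProd (p := p)).pow 2)
  have i2 := (HasMoments.const 2).mul ((hasMoments_noiseTerm w).pow 2)
  have := integral_mono
    ((((HasMoments.const d).mul hasMoments_sqProd).add (hasMoments_noiseTerm w)).pow 2).integrable
    (i1.add i2).integrable (fun t => (add_sq_le (a := d * sqProd t) (b := noiseTerm w t)).trans
      (le_of_eq (by ring : _ = 2 * d ^ 2 * sqProd t ^ 2 + 2 * noiseTerm w t ^ 2)))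
  rw [integral_add i1.integrable i2.integrable, integral_const_mul, integral_const_mul,
    integral_sqProd_sq, integral_noiseTerm_sq] at this
  linarith

/-- Reversing the sign of the output vector preserves the law of a sample. -/
lemma measurePreserving_flip :
    MeasurePreserving (fun t : Smp p => (t.1, t.2.1, -t.2.2)) (smpLaw p) (smpLaw p) := by
  have h : MeasurePreserving (fun x : Fin p → ℝ => -x) (gaussPi (Fin p)) (gaussPi (Fin p)) :=
    measurePreserving_pi _ _ fun _ => measurePreserving_neg_gauss
  exact (MeasurePreserving.id _).prod ((MeasurePreserving.id _).prod h)

lemma lin_neg {ι : Type*} [Fintype ι] (w x : ι → ℝ) : lin w (-x) = - lin w x := by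
  simp [lin]

end Sample

/-! ### Mean sign of one entry: the separate approximations. -/

section Entry

variable {p q B : ℕ}

/-- The law of `B` independent samples. -/
noncomputable abbrev batchLaw (B p : ℕ) : Measure (Fin B → Smp p) := Measure.pi fun _ => smpLaw p

/-- The sum of a function over a batch of samples. -/
def total (h : Smp p → ℝ) (ω : Fin B → Smp p) : ℝ := ∑ a, h (ω a)

lemma measurable_total {h : Smp p → ℝ} (hh : Measurable h) : Measurable (total (B := B) h) := by
  unfold total; fun_prop

lemma hasMoments_total {h : Smp p → ℝ} (hh : HasMoments h (smpLaw p)) :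
    HasMoments (total (B := B) h) (batchLaw B p) := hasMoments_sum_eval hh

lemma total_nonneg {h : Smp p → ℝ} (hh : ∀ t, 0 ≤ h t) (ω : Fin B → Smp p) : 0 ≤ total h ω :=
  Finset.sum_nonneg fun a _ => hh (ω a)

/-- The event on which the variance `∑ u² v² |W x|²` is not unusually small. -/
def goodEvent (W : Fin q → Fin p → ℝ) : Set (Fin B → Smp p) :=
  {ω | B * (1 / 4 : ℝ) ≤ total (freeVar W) ω}

lemma measurableSet_goodEvent (W : Fin q → Fin p → ℝ) :
    MeasurableSet (goodEvent (B := B) W) :=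
  measurableSet_le measurable_const (measurable_total (measurable_freeVar W))

lemma exp_neg_le_div_sq {x : ℝ} (hx : 0 < x) : Real.exp (-(x / 216)) ≤ 93312 / x ^ 2 := by
  -- Only the quadratic term of the exponential is used: `93312 = 2 · 216²`.
  have h := Real.quadratic_le_exp_of_nonneg (x := x / 216) (by positivity)
  rw [Real.exp_neg, inv_le_comm₀ (Real.exp_pos _) (by positivity)]
  refine le_trans ?_ h
  rw [inv_div, div_le_iff₀ (by norm_num)]
  nlinarith

/-- If `r² + c² ≤ 1/4`, the mean of `freeVar W` is at least `3/4` and its second moment at most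
`27`. The Chernoff exponent `L/2 - 27L²/2` is largest at `L = 1/54`, where it equals `1/216`.
Otherwise `r³ + c³` is bounded below and the second term alone exceeds 1. -/
lemma measure_goodEvent_compl_le {W : Fin q → Fin p → ℝ} {r c : ℝ} (hB : 0 < B) (hr : 0 ≤ r)
    (hc : 0 ≤ c) (hV : ∑ l, ∑ k, W l k ^ 2 ≤ 1) (hV' : 1 ≤ ∑ l, ∑ k, W l k ^ 2 + r ^ 2 + c ^ 2) :
    (batchLaw B p).real (goodEvent W)ᶜ ≤ 93312 / (B : ℝ) ^ 2 + 23 * (r ^ 3 + c ^ 3) := by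
  have hB' : (0 : ℝ) < B := by exact_mod_cast hB
  by_cases h : r ^ 2 + c ^ 2 ≤ 1 / 4
  · have hV0 : 0 ≤ ∑ l, ∑ k, W l k ^ 2 := by positivity
    have := measure_sum_eval_le (B := B) (μ := smpLaw p) (measurable_freeVar W)
      (hasMoments_freeVar W) (freeVar_nonneg W) (L := 1 / 54) (m₁ := 3 / 4) (m₂ := 27) (c := 1 / 4)
      (by norm_num) (by rw [integral_freeVar]; linarith)
      ((integral_freeVar_sq_le W).trans (by nlinarith))
    have e : (goodEvent (B := B) W)ᶜ = {ω | ∑ a, freeVar W (ω a) < B * (1 / 4 : ℝ)} := by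
      ext ω; simp [goodEvent, total]
    rw [e]
    refine this.trans ?_
    have h2 := exp_neg_le_div_sq hB'
    have h3 : (B : ℝ) * (1 / 54 * (3 / 4 - 1 / 4) - (1 / 54) ^ 2 * 27 / 2) = B / 216 := by ring
    rw [h3]
    have : 0 ≤ 23 * (r ^ 3 + c ^ 3) := by positivity
    linarith
  · push Not at h
    have h1 : (batchLaw B p).real (goodEvent W)ᶜ ≤ 1 := measureReal_le_one
    have h2 : 0 ≤ 93312 / (B : ℝ) ^ 2 := by positivity
    have h3 : 1 ≤ 23 * (r ^ 3 + c ^ 3) := by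
      by_contra h4
      push Not at h4
      have h5 : r ^ 3 < 1 / 23 := by nlinarith [pow_nonneg hc 3]
      have h6 : c ^ 3 < 1 / 23 := by nlinarith [pow_nonneg hr 3]
      -- the difference of the two sides vanishes to second order at `t = 1 / 3`
      have key : ∀ t : ℝ, 0 ≤ t → t ^ 2 ≤ 2 * t ^ 3 + 1 / 27 := by
        intro t ht
        nlinarith [mul_nonneg (by linarith : (0:ℝ) ≤ 2 * t + 1 / 3) (sq_nonneg (t - 1 / 3))]
      nlinarith [key r hr, key c hc]
    linarith

lemma sqrt_sq_add_sq_le {a b x y : ℝ} (hx : 0 ≤ x) (hy : 0 ≤ y) (ha : a ≤ x ^ 2) (hb : b ≤ y ^ 2) :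
    √(a + b) ≤ x + y := by
  rw [Real.sqrt_le_left (by positivity)]
  nlinarith [mul_nonneg hx hy]

lemma integral_total_mean_sq_le {d c : ℝ} {w : Fin p → ℝ} (hw : ∑ k, w k ^ 2 ≤ c ^ 2)
    (hd : |d| ≤ c) :
    ∫ ω, (d * total sqProd ω + total (noiseTerm w) ω) ^ 2 ∂(batchLaw B p)
      ≤ B * (24 * c ^ 2) + (B * d) ^ 2 := by
  have hm : HasMoments (fun t => d * sqProd t + noiseTerm w t) (smpLaw p) :=
    ((HasMoments.const d).mul hasMoments_sqProd).add (hasMoments_noiseTerm w)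
  have := integral_sq_sum_eval_le (B := B) hm
  have e : ∀ ω : Fin B → Smp p, ∑ a, (d * sqProd (ω a) + noiseTerm w (ω a))
      = d * total sqProd ω + total (noiseTerm w) ω := by
    intro ω; simp [total, Finset.sum_add_distrib, Finset.mul_sum]
  simp_rw [e] at this
  have e2 : ∫ t, (d * sqProd t + noiseTerm w t) ∂(smpLaw p) = d := by
    rw [integral_add ((HasMoments.const d).mul hasMoments_sqProd).integrable
      (hasMoments_noiseTerm w).integrable, integral_const_mul, integral_sqProd, integral_noiseTerm]
    ring
  rw [e2] at this
  have h2 := integral_mean_sq_le d w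
  have h3 : d ^ 2 ≤ c ^ 2 := sq_le_sq' (by linarith [neg_abs_le d]) (by linarith [le_abs_self d])
  have h4 : (B : ℝ) * ∫ t, (d * sqProd t + noiseTerm w t) ^ 2 ∂(smpLaw p) ≤ B * (24 * c ^ 2) :=
    mul_le_mul_of_nonneg_left (by linarith) (Nat.cast_nonneg B)
  linarith

lemma integral_total_fullVar_sub_sq_le {e : Fin q → ℝ} {W : Fin q → Fin p → ℝ} {r : ℝ}
    (hr1 : r ^ 2 ≤ 1) (he : ∑ l, e l ^ 2 ≤ r ^ 2) (hV : ∑ l, ∑ k, W l k ^ 2 ≤ 1) :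
    ∫ ω, (total (fullVar e W) ω - total (freeVar W) ω) ^ 2 ∂(batchLaw B p)
      ≤ B * (990 * r ^ 2) + (B * (3 * r ^ 2)) ^ 2 := by
  have := integral_sq_sum_eval_le (B := B) ((hasMoments_fullVar e W).sub (hasMoments_freeVar W))
  have e1 : ∀ ω : Fin B → Smp p, ∑ a, (fullVar e W (ω a) - freeVar W (ω a))
      = total (fullVar e W) ω - total (freeVar W) ω := by
    intro ω; simp [total]
  simp_rw [e1, integral_fullVar_sub_freeVar] at this
  have h2 := integral_fullVar_sub_freeVar_sq_le e W
  have he0 : 0 ≤ ∑ l, e l ^ 2 := by positivity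
  have h3 : 630 * (∑ l, e l ^ 2) ^ 2 + 360 * ((∑ l, e l ^ 2) * ∑ l, ∑ k, W l k ^ 2) ≤ 990 * r ^ 2 := by
    nlinarith
  have h4 : (B : ℝ) * ∫ t, (fullVar e W t - freeVar W t) ^ 2 ∂(smpLaw p) ≤ B * (990 * r ^ 2) :=
    mul_le_mul_of_nonneg_left (by linarith) (Nat.cast_nonneg B)
  have h5 : ((B : ℝ) * (3 * ∑ l, e l ^ 2)) ^ 2 ≤ (B * (3 * r ^ 2)) ^ 2 := by gcongr
  linarith

lemma hasMoments_total_mean (d : ℝ) (w : Fin p → ℝ) :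
    HasMoments (fun ω => d * total sqProd ω + total (noiseTerm w) ω) (batchLaw B p) :=
  ((HasMoments.const d).mul (hasMoments_total hasMoments_sqProd)).add
    (hasMoments_total (hasMoments_noiseTerm w))

lemma hasMoments_total_sub (e : Fin q → ℝ) (W : Fin q → Fin p → ℝ) :
    HasMoments (fun ω => total (fullVar e W) ω - total (freeVar W) ω) (batchLaw B p) :=
  (hasMoments_total (hasMoments_fullVar e W)).sub (hasMoments_total (hasMoments_freeVar W))

lemma measurable_meanSign_comp {Ω : Type*} [MeasurableSpace Ω] {f g : Ω → ℝ} (hf : Measurable f)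
    (hg : Measurable g) : Measurable (fun x => meanSign (f x) (g x)) :=
  measurable_meanSign.comp (hf.prodMk hg)

lemma integrable_meanSign_comp {Ω : Type*} [MeasurableSpace Ω] {μ : Measure Ω} [IsFiniteMeasure μ]
    {f g : Ω → ℝ} (hf : Measurable f) (hg : Measurable g) :
    Integrable (fun x => meanSign (f x) (g x)) μ :=
  Integrable.of_bound (measurable_meanSign_comp hf hg).aestronglyMeasurable 1
    (Filter.Eventually.of_forall fun _ => abs_meanSign_le_one _ _)

lemma quarter_mul_sqrt {b : ℝ} (hb : 0 ≤ b) : b * (1 / 4) * √(b * (1 / 4)) = b * √b / 8 := by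
  rw [Real.sqrt_mul hb, show (1 / 4 : ℝ) = (1 / 2) ^ 2 by norm_num, Real.sqrt_sq (by norm_num)]
  ring

/-- Row `i` makes the conditional variance uneven in `x`; its contribution is dropped here so that
the symmetrisation applies afterwards. On the good event the reference variance is at least `B/4`
and the mean sign is continuous in the variance; off it the sign is bounded by 1. -/
lemma abs_integral_meanSign_sub_le {d r c : ℝ} {w : Fin p → ℝ} {e : Fin q → ℝ}
    {W : Fin q → Fin p → ℝ} (hB : 0 < B) (hr : 0 ≤ r) (hr1 : r ≤ 1) (hc : 0 ≤ c)
    (he : ∑ l, e l ^ 2 ≤ r ^ 2) (hw : ∑ k, w k ^ 2 ≤ c ^ 2) (hd : |d| ≤ c)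
    (hV : ∑ l, ∑ k, W l k ^ 2 ≤ 1) :
    |∫ ω, meanSign (d * total sqProd ω + total (noiseTerm w) ω) (total (fullVar e W) ω)
        ∂(batchLaw B p)
      - ∫ ω, (goodEvent W).indicator (fun ω =>
        meanSign (d * total sqProd ω + total (noiseTerm w) ω) (total (freeVar W) ω)) ω
        ∂(batchLaw B p)|
      ≤ (batchLaw B p).real (goodEvent W)ᶜ
        + 128 * (B * (990 * r ^ 2) + (B * (3 * r ^ 2)) ^ 2) / (B : ℝ) ^ 2
        + 16 * ((5 * √B * c + B * |d|) * (32 * √B * r + 3 * B * r ^ 2)) / (B * √B) := by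
  have hB' : (0 : ℝ) < B := by exact_mod_cast hB
  have hsB : 0 < √(B : ℝ) := Real.sqrt_pos.2 hB'
  have hsq : √(B : ℝ) ^ 2 = B := Real.sq_sqrt hB'.le
  have hr2 : r ^ 2 ≤ 1 := by nlinarith
  set M : (Fin B → Smp p) → ℝ := fun ω => d * total sqProd ω + total (noiseTerm w) ω with hM
  set X : (Fin B → Smp p) → ℝ := fun ω => total (fullVar e W) ω - total (freeVar W) ω with hX
  have mM : Measurable M := ((measurable_total measurable_sqProd).const_mul d).add
    (measurable_total (measurable_noiseTerm w))
  have mF := measurable_total (B := B) (measurable_fullVar e W)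
  have mV := measurable_total (B := B) (measurable_freeVar W)
  have hMm : HasMoments M (batchLaw B p) := hasMoments_total_mean d w
  have hXm : HasMoments X (batchLaw B p) := hasMoments_total_sub e W
  have i1 := integrable_meanSign_comp (μ := batchLaw B p) mM mF
  have i2 := (integrable_meanSign_comp (μ := batchLaw B p) mM mV).indicator
    (measurableSet_goodEvent (B := B) W)
  rw [← integral_sub i1 i2]
  -- Continuity in the variance with `τ = B/4`: `8/τ² = 128/B²` and `2/(τ√τ) = 16/(B√B)`.
  have hpt : ∀ ω, ‖meanSign (M ω) (total (fullVar e W) ω)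
      - (goodEvent W).indicator (fun ω => meanSign (M ω) (total (freeVar W) ω)) ω‖
      ≤ (goodEvent W)ᶜ.indicator (fun _ => (1 : ℝ)) ω + 128 / (B : ℝ) ^ 2 * X ω ^ 2
        + 16 / (B * √B) * (|M ω| * |X ω|) := by
    intro ω
    rw [Real.norm_eq_abs]
    by_cases hω : ω ∈ goodEvent W
    · have := abs_meanSign_sub_meanSign (τ := B * (1 / 4)) (by positivity)
        (total_nonneg (fullVar_nonneg e W) ω) hω (M ω)
      rw [quarter_mul_sqrt hB'.le] at this
      rw [Set.indicator_of_mem hω, Set.indicator_of_notMem (by simpa using hω)]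
      refine this.trans (le_of_eq ?_)
      simp only [hX]
      field_simp
      ring
    · rw [Set.indicator_of_notMem hω, Set.indicator_of_mem (by simpa using hω), sub_zero]
      have := abs_meanSign_le_one (M ω) (total (fullVar e W) ω)
      have : 0 ≤ 128 / (B : ℝ) ^ 2 * X ω ^ 2 := by positivity
      have : 0 ≤ 16 / (B * √B) * (|M ω| * |X ω|) := by positivity
      linarith
  have j1 : Integrable ((goodEvent W)ᶜ.indicator (fun _ => (1 : ℝ))) (batchLaw B p) :=
    (integrable_const 1).indicator (measurableSet_goodEvent W).compl
  have j2 := ((HasMoments.const (128 / (B : ℝ) ^ 2)).mul (hXm.pow 2)).integrable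
  have j3 := ((HasMoments.const (16 / (B * √(B : ℝ)))).mul (hMm.abs.mul hXm.abs)).integrable
  have := norm_integral_le_of_norm_le ((j1.add j2).add j3) (Filter.Eventually.of_forall hpt)
  rw [Real.norm_eq_abs] at this
  refine this.trans ?_
  rw [integral_add' (j1.add j2) j3, integral_add' j1 j2, integral_const_mul, integral_const_mul,
    integral_indicator_const _ (measurableSet_goodEvent W).compl, smul_eq_mul, mul_one]
  have b1 := integral_total_fullVar_sub_sq_le (B := B) hr2 he hV
  have b2 := integral_total_mean_sq_le (B := B) hw hd
  have b3 := integral_abs_mul_le hMm hXm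
  -- Here `5 ≥ √24`, and in the next bound `32 ≥ √990`.
  have b4 : √(∫ ω, M ω ^ 2 ∂(batchLaw B p)) ≤ 5 * √B * c + B * |d| :=
    (Real.sqrt_le_sqrt b2).trans (sqrt_sq_add_sq_le (by positivity) (by positivity)
      (by rw [mul_pow, mul_pow, hsq]; nlinarith [mul_nonneg hB'.le (sq_nonneg c)])
      (by rw [mul_pow, mul_pow, sq_abs]))
  have b5 : √(∫ ω, X ω ^ 2 ∂(batchLaw B p)) ≤ 32 * √B * r + 3 * B * r ^ 2 :=
    (Real.sqrt_le_sqrt b1).trans (sqrt_sq_add_sq_le (by positivity) (by positivity)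
      (by rw [mul_pow, mul_pow, hsq]; nlinarith [mul_nonneg hB'.le (sq_nonneg r)])
      (le_of_eq (by ring)))
  have b6 : ∫ ω, |M ω| * |X ω| ∂(batchLaw B p)
      ≤ (5 * √B * c + B * |d|) * (32 * √B * r + 3 * B * r ^ 2) :=
    b3.trans (mul_le_mul b4 b5 (Real.sqrt_nonneg _) (by positivity))
  rw [div_mul_eq_mul_div, div_mul_eq_mul_div]
  gcongr

lemma total_flip (h h' : Smp p → ℝ) (hh : ∀ t : Smp p, h (t.1, t.2.1, -t.2.2) = h' t)
    (ω : Fin B → Smp p) :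
    total h (fun a => ((ω a).1, (ω a).2.1, -(ω a).2.2)) = total h' ω :=
  Finset.sum_congr rfl fun a _ => hh (ω a)

/-- Reversing every output vector changes the sign of the noise total and fixes the law, `sqProd`,
`freeVar`, and hence the good event. The full variance is not invariant, because of its cross term.
-/
lemma integral_goodEvent_symm (d : ℝ) (w : Fin p → ℝ) (W : Fin q → Fin p → ℝ) :
    ∫ ω, (goodEvent W).indicator (fun ω =>
        meanSign (d * total sqProd ω + total (noiseTerm w) ω) (total (freeVar W) ω)) ω
        ∂(batchLaw B p)
      = ∫ ω, (goodEvent W).indicator (fun ω =>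
        (meanSign (d * total sqProd ω + total (noiseTerm w) ω) (total (freeVar W) ω)
        + meanSign (d * total sqProd ω - total (noiseTerm w) ω) (total (freeVar W) ω)) / 2) ω
        ∂(batchLaw B p) := by
  have mS := measurable_total (B := B) (measurable_sqProd (p := p))
  have mZ := measurable_total (B := B) (measurable_noiseTerm w)
  have mV := measurable_total (B := B) (measurable_freeVar W)
  have i1 := (integrable_meanSign_comp (μ := batchLaw B p) ((mS.const_mul d).add mZ) mV).indicator
    (measurableSet_goodEvent (B := B) W)
  have i2 := (integrable_meanSign_comp (μ := batchLaw B p) ((mS.const_mul d).sub mZ) mV).indicator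
    (measurableSet_goodEvent (B := B) W)
  simp only [Pi.add_apply, Pi.sub_apply] at i1 i2
  have hflip : MeasurePreserving (fun (ω : Fin B → Smp p) a => ((ω a).1, (ω a).2.1, -(ω a).2.2))
      (batchLaw B p) (batchLaw B p) := measurePreserving_pi _ _ fun _ => measurePreserving_flip
  have e : ∫ ω, (goodEvent W).indicator (fun ω =>
        meanSign (d * total sqProd ω + total (noiseTerm w) ω) (total (freeVar W) ω)) ω
        ∂(batchLaw B p) = ∫ ω, (goodEvent W).indicator (fun ω =>
        meanSign (d * total sqProd ω - total (noiseTerm w) ω) (total (freeVar W) ω)) ω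
        ∂(batchLaw B p) := by
    conv_lhs => rw [← hflip.map_eq]
    rw [integral_map hflip.measurable.aemeasurable (by
      rw [hflip.map_eq]; exact i1.aestronglyMeasurable)]
    congr 1; ext ω
    have h1 := total_flip (B := B) (sqProd (p := p)) sqProd (fun t => rfl) ω
    have h2 := total_flip (B := B) (noiseTerm w) (fun t => - noiseTerm w t)
      (fun t => by simp [noiseTerm, lin_neg]) ω
    have h3 := total_flip (B := B) (freeVar W) (freeVar W)
      (fun t => by simp [freeVar, lin_neg, sqProd]) ω
    have h4 : total (B := B) (fun t => - noiseTerm w t) ω = - total (noiseTerm w) ω := by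
      simp [total]
    simp only [Set.indicator, goodEvent, Set.mem_ofPred_eq, h1, h2, h3, h4, sub_eq_add_neg]
  have e2 : ∀ ω, (goodEvent (B := B) W).indicator (fun ω =>
        (meanSign (d * total sqProd ω + total (noiseTerm w) ω) (total (freeVar W) ω)
        + meanSign (d * total sqProd ω - total (noiseTerm w) ω) (total (freeVar W) ω)) / 2) ω
      = ((goodEvent W).indicator (fun ω =>
        meanSign (d * total sqProd ω + total (noiseTerm w) ω) (total (freeVar W) ω)) ω
        + (goodEvent W).indicator (fun ω =>
        meanSign (d * total sqProd ω - total (noiseTerm w) ω) (total (freeVar W) ω)) ω) / 2 := by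
    intro ω
    by_cases hω : ω ∈ goodEvent W <;> simp [hω]
  simp_rw [e2]
  rw [integral_div, integral_add i1 i2, ← e]
  ring

/-- The power mean inequality reduces the cube of the sum to the sum of the cubes. -/
lemma integral_total_cube_le :
    ∫ ω, total sqProd ω ^ 3 ∂(batchLaw B p) ≤ 225 * (B : ℝ) ^ 3 := by
  have hb : ∀ ω : Fin B → Smp p, total sqProd ω ^ 3 ≤ (B : ℝ) ^ 2 * ∑ a, sqProd (ω a) ^ 3 := by
    intro ω
    simpa [total] using pow_sum_le_card_mul_sum_pow (s := Finset.univ)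
      (fun a _ => sqProd_nonneg (ω a)) 2
  have i := hasMoments_sum_eval (B := B) ((hasMoments_sqProd (p := p)).pow 3)
  have := integral_mono ((hasMoments_total hasMoments_sqProd).pow 3).integrable
    ((HasMoments.const ((B : ℝ) ^ 2)).mul i).integrable hb
  rw [integral_const_mul, integral_sum_eval (hasMoments_sqProd.pow 3), integral_sqProd_cube] at this
  refine this.trans (le_of_eq (by ring))

/-- The linearisation of the symmetrised sign applies pointwise on the good event, and the cut-off
in the second integral is that same event. The error involves `d² S³ + S Z²`, with `S`, `Z` the
totals of `sqProd` and the noise; centredness of the noise gives `E[S Z²] = O(B² c²)`. -/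
lemma abs_integral_symm_sub_le {d c : ℝ} {w : Fin p → ℝ} {W : Fin q → Fin p → ℝ} (hB : 0 < B)
    (hw : ∑ k, w k ^ 2 ≤ c ^ 2) :
    |∫ ω, (goodEvent W).indicator (fun ω =>
        (meanSign (d * total sqProd ω + total (noiseTerm w) ω) (total (freeVar W) ω)
        + meanSign (d * total sqProd ω - total (noiseTerm w) ω) (total (freeVar W) ω)) / 2) ω
        ∂(batchLaw B p)
      - signSlope * (d * √B) * ∫ ω, (if 1 / 4 ≤ total (freeVar W) ω / B
        then total sqProd ω / B / √(total (freeVar W) ω / B) else 0) ∂(batchLaw B p)|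
      ≤ 8 * |d| * (d ^ 2 * (225 * (B : ℝ) ^ 3) + (B : ℝ) ^ 2 * (45 * c ^ 2)) / (B * √B) := by
  have hB' : (0 : ℝ) < B := by exact_mod_cast hB
  have hsB : 0 < √(B : ℝ) := Real.sqrt_pos.2 hB'
  have mS := measurable_total (B := B) (measurable_sqProd (p := p))
  have mZ := measurable_total (B := B) (measurable_noiseTerm w)
  have mV := measurable_total (B := B) (measurable_freeVar W)
  have hS := hasMoments_total (B := B) (hasMoments_sqProd (p := p))
  have hZ := hasMoments_total (B := B) (hasMoments_noiseTerm w)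
  have i1 := (((integrable_meanSign_comp (μ := batchLaw B p) ((mS.const_mul d).add mZ) mV).add
    (integrable_meanSign_comp (μ := batchLaw B p) ((mS.const_mul d).sub mZ) mV)).div_const 2).indicator
    (measurableSet_goodEvent (B := B) W)
  simp only [Pi.add_apply, Pi.sub_apply] at i1
  have mite : Measurable (fun ω : Fin B → Smp p => if 1 / 4 ≤ total (freeVar W) ω / B
        then total sqProd ω / B / √(total (freeVar W) ω / B) else 0) :=
    Measurable.ite (measurableSet_le measurable_const (mV.div_const _))
      ((mS.div_const _).div (mV.div_const _).sqrt) measurable_const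
  have hite : HasMoments (fun ω : Fin B → Smp p => if 1 / 4 ≤ total (freeVar W) ω / B
        then total sqProd ω / B / √(total (freeVar W) ω / B) else 0) (batchLaw B p) := by
    refine HasMoments.mono ((HasMoments.const (2 / (B : ℝ))).mul hS) mite.aestronglyMeasurable fun ω => ?_
    have hS0 := total_nonneg sqProd_nonneg ω
    split_ifs with h
    · have : 1 / 2 ≤ √(total (freeVar W) ω / B) :=
        Real.le_sqrt_of_sq_le (by norm_num; linarith)
      rw [abs_of_nonneg (by positivity), abs_of_nonneg (by positivity), div_le_iff₀ (by linarith)]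
      have h3 : 0 ≤ total sqProd ω / B := by positivity
      calc total sqProd ω / B ≤ 2 * (total sqProd ω / B) * √(total (freeVar W) ω / B) := by nlinarith
        _ = _ := by ring
    · rw [abs_zero]; positivity
  rw [← integral_const_mul, ← integral_sub i1 (hite.integrable.const_mul _)]
  have hpt : ∀ ω : Fin B → Smp p, ‖(goodEvent W).indicator (fun ω =>
        (meanSign (d * total sqProd ω + total (noiseTerm w) ω) (total (freeVar W) ω)
        + meanSign (d * total sqProd ω - total (noiseTerm w) ω) (total (freeVar W) ω)) / 2) ω
      - signSlope * (d * √B) * (if 1 / 4 ≤ total (freeVar W) ω / B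
        then total sqProd ω / B / √(total (freeVar W) ω / B) else 0)‖
      ≤ 8 * |d| / (B * √B) * (d ^ 2 * total sqProd ω ^ 3
        + total sqProd ω * total (noiseTerm w) ω ^ 2) := by
    intro ω
    rw [Real.norm_eq_abs]
    have hS0 := total_nonneg sqProd_nonneg ω
    by_cases hω : ω ∈ goodEvent W
    · have hτ : B * (1 / 4 : ℝ) ≤ total (freeVar W) ω := hω
      have := abs_meanSign_add_sub (τ := B * (1 / 4)) (by positivity) hτ (d * total sqProd ω)
        (total (noiseTerm w) ω)
      rw [quarter_mul_sqrt hB'.le] at this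
      have hV0 : 0 < total (freeVar W) ω := by linarith
      have hq := Real.sqrt_pos.2 hV0
      rw [Set.indicator_of_mem hω, if_pos (by rw [le_div_iff₀ hB']; linarith)]
      have e1 : signSlope * (d * √B) * (total sqProd ω / B / √(total (freeVar W) ω / B))
          = signSlope * (d * total sqProd ω / √(total (freeVar W) ω)) := by
        rw [Real.sqrt_div hV0.le]
        have := Real.sq_sqrt hB'.le
        field_simp
        rw [this]; ring
      rw [e1]
      refine this.trans (le_of_eq ?_)
      rw [abs_mul, abs_of_nonneg hS0]
      field_simp
    · have hτ : ¬ B * (1 / 4 : ℝ) ≤ total (freeVar W) ω := hω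
      rw [Set.indicator_of_notMem hω, if_neg (by rw [le_div_iff₀ hB']; intro h; apply hτ; linarith)]
      simp only [mul_zero, sub_zero, abs_zero]
      positivity
  have j1 := (HasMoments.const (d ^ 2)).mul (hS.pow 3)
  have j2 := hS.mul (hZ.pow 2)
  have := norm_integral_le_of_norm_le
    ((HasMoments.const (8 * |d| / (B * √(B : ℝ)))).mul (j1.add j2)).integrable
    (Filter.Eventually.of_forall hpt)
  rw [Real.norm_eq_abs] at this
  refine this.trans ?_
  rw [integral_const_mul, integral_add j1.integrable j2.integrable, integral_const_mul,
    div_mul_eq_mul_div]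
  have b1 := integral_total_cube_le (B := B) (p := p)
  have b2 := integral_sum_mul_sum_sq_le (B := B) (hasMoments_sqProd (p := p))
    (hasMoments_noiseTerm w) (K := 45 * c ^ 2) (integral_noiseTerm w)
    (by rw [integral_sqProd_mul_noiseTerm_sq]; linarith)
    (by rw [integral_sqProd, integral_noiseTerm_sq]; nlinarith [sq_nonneg c])
  gcongr
  exact b2

/-- Expand `A/√D` to second order at `A = D = 1`, where `A` and `D` are the two totals divided by
`B`. The linear part is integrated exactly, so fluctuations enter only through variances: the error
is `O(1/B)` rather than `O(1/√B)`, plus the deficit of the mean of `D`. -/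
lemma abs_integral_ite_sub_one_le {W : Fin q → Fin p → ℝ} {r c : ℝ} (hB : 0 < B)
    (hr : r ^ 2 ≤ 1) (hc : c ^ 2 ≤ 1) (hV : ∑ l, ∑ k, W l k ^ 2 ≤ 1)
    (hV' : 1 ≤ ∑ l, ∑ k, W l k ^ 2 + r ^ 2 + c ^ 2) :
    |∫ ω, (if 1 / 4 ≤ total (freeVar W) ω / B
        then total sqProd ω / B / √(total (freeVar W) ω / B) else 0) ∂(batchLaw B p) - 1|
      ≤ 21 * (r ^ 2 + c ^ 2) + 360 / B := by
  have hB' : (0 : ℝ) < B := by exact_mod_cast hB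
  have hB1 : (1 : ℝ) ≤ B := by exact_mod_cast hB
  set V := ∑ l, ∑ k, W l k ^ 2 with hVdef
  have hV0 : 0 ≤ V := by positivity
  have hS := hasMoments_total (B := B) (hasMoments_sqProd (p := p))
  have hT := hasMoments_total (B := B) (hasMoments_freeVar W)
  have mS := measurable_total (B := B) (measurable_sqProd (p := p))
  have mV := measurable_total (B := B) (measurable_freeVar W)
  have mite : Measurable (fun ω : Fin B → Smp p => if 1 / 4 ≤ total (freeVar W) ω / B
        then total sqProd ω / B / √(total (freeVar W) ω / B) else 0) :=
    Measurable.ite (measurableSet_le measurable_const (mV.div_const _))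
      ((mS.div_const _).div (mV.div_const _).sqrt) measurable_const
  have hA : HasMoments (fun ω : Fin B → Smp p => (B : ℝ)⁻¹ * total sqProd ω) (batchLaw B p) :=
    (HasMoments.const _).mul hS
  have hD : HasMoments (fun ω : Fin B → Smp p => (B : ℝ)⁻¹ * total (freeVar W) ω) (batchLaw B p) :=
    (HasMoments.const _).mul hT
  have hL : HasMoments (fun ω : Fin B → Smp p => (B : ℝ)⁻¹ * total sqProd ω
      - 1 / 2 * ((B : ℝ)⁻¹ * total (freeVar W) ω - 1)) (batchLaw B p) :=
    hA.sub ((HasMoments.const (1 / 2)).mul (hD.sub (HasMoments.const 1)))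
  have hQ1 := (hA.sub (HasMoments.const 1)).pow 2
  have hQ2 := (hD.sub (HasMoments.const 1)).pow 2
  have hpt : ∀ ω : Fin B → Smp p, ‖(if 1 / 4 ≤ total (freeVar W) ω / B
        then total sqProd ω / B / √(total (freeVar W) ω / B) else 0)
        - ((B : ℝ)⁻¹ * total sqProd ω - 1 / 2 * ((B : ℝ)⁻¹ * total (freeVar W) ω - 1))‖
      ≤ 10 * (((B : ℝ)⁻¹ * total sqProd ω - 1) ^ 2 + ((B : ℝ)⁻¹ * total (freeVar W) ω - 1) ^ 2) := by
    intro ω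
    have := abs_ite_div_sqrt_sub_le (A := total sqProd ω / B) (D := total (freeVar W) ω / B)
      (div_nonneg (total_nonneg (freeVar_nonneg W) ω) hB'.le)
    rw [Real.norm_eq_abs, inv_mul_eq_div, inv_mul_eq_div, one_div_mul_eq_div]
    exact this
  have hK : HasMoments (fun ω => 10 * (((B : ℝ)⁻¹ * total sqProd ω - 1) ^ 2
      + ((B : ℝ)⁻¹ * total (freeVar W) ω - 1) ^ 2)) (batchLaw B p) :=
    (HasMoments.const 10).mul (hQ1.add hQ2)
  have hdiff := Integrable.mono' hK.integrable
    (mite.aestronglyMeasurable.sub hL.integrable.aestronglyMeasurable)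
    (Filter.Eventually.of_forall hpt)
  have hite : Integrable (fun ω : Fin B → Smp p => if 1 / 4 ≤ total (freeVar W) ω / B
        then total sqProd ω / B / √(total (freeVar W) ω / B) else 0) (batchLaw B p) := by
    refine (hdiff.add hL.integrable).congr (Filter.Eventually.of_forall fun ω => ?_)
    simp
  have hb := norm_integral_le_of_norm_le hK.integrable (Filter.Eventually.of_forall hpt)
  rw [integral_sub hite hL.integrable, integral_sub hA.integrable
    ((HasMoments.const (1 / 2)).mul (hD.sub (HasMoments.const 1))).integrable,
    integral_const_mul, integral_const_mul, integral_const_mul,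
    integral_sub hD.integrable (integrable_const _), integral_const_mul,
    integral_add hQ1.integrable hQ2.integrable, Real.norm_eq_abs] at hb
  have eS : ∫ ω, total sqProd ω ∂(batchLaw B p) = B := by
    have := integral_sum_eval (B := B) (hasMoments_sqProd (p := p))
    rw [integral_sqProd, mul_one] at this; exact this
  have eT : ∫ ω, total (freeVar W) ω ∂(batchLaw B p) = B * V := by
    have := integral_sum_eval (B := B) (hasMoments_freeVar W)
    rw [integral_freeVar] at this; exact this
  rw [eS, eT, inv_mul_cancel₀ hB'.ne', inv_mul_cancel_left₀ hB'.ne'] at hb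
  simp only [integral_const, probReal_univ, smul_eq_mul, mul_one] at hb
  have q1 : ∫ ω, ((B : ℝ)⁻¹ * total sqProd ω - 1) ^ 2 ∂(batchLaw B p) ≤ (8 : ℝ) / B := by
    have h1 := (hasMoments_sqProd (p := p)).sub (HasMoments.const 1)
    have := integral_sq_sum_eval_le (B := B) h1
    rw [integral_sub hasMoments_sqProd.integrable (integrable_const _), integral_sqProd] at this
    have e2 : ∫ t : Smp p, (sqProd t - 1) ^ 2 ∂(smpLaw p) = 8 := by
      have : ∀ t : Smp p, (sqProd t - 1) ^ 2 = sqProd t ^ 2 - (2 * sqProd t - 1) := fun t => by ring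
      simp_rw [this]
      rw [integral_sub (hasMoments_sqProd.pow 2).integrable
        (((HasMoments.const 2).mul hasMoments_sqProd).sub (HasMoments.const 1)).integrable,
        integral_sub ((HasMoments.const 2).mul hasMoments_sqProd).integrable (integrable_const _),
        integral_const_mul, integral_sqProd_sq, integral_sqProd]
      simp; norm_num
    rw [e2] at this
    have e3 : ∀ ω : Fin B → Smp p, ((B : ℝ)⁻¹ * total sqProd ω - 1) ^ 2
        = ((B : ℝ)⁻¹) ^ 2 * (∑ a, (sqProd (ω a) - 1)) ^ 2 := by
      intro ω
      rw [Finset.sum_sub_distrib, ← mul_pow, mul_sub]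
      simp [total, hB'.ne']
    simp_rw [e3]
    rw [integral_const_mul]
    simp only [integral_const, probReal_univ, smul_eq_mul, mul_one, sub_self, mul_zero] at this
    calc _ ≤ ((B : ℝ)⁻¹) ^ 2 * (B * 8 + 0 ^ 2) := by gcongr
      _ = 8 / B := by field_simp; norm_num
  have q2 : ∫ ω, ((B : ℝ)⁻¹ * total (freeVar W) ω - 1) ^ 2 ∂(batchLaw B p)
      ≤ 28 / B + (V - 1) ^ 2 := by
    have h1 := (hasMoments_freeVar W).sub (HasMoments.const 1)
    have := integral_sq_sum_eval_le (B := B) h1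
    rw [integral_sub (hasMoments_freeVar W).integrable (integrable_const _), integral_freeVar] at this
    have e2 : ∫ t : Smp p, (freeVar W t - 1) ^ 2 ∂(smpLaw p) ≤ 28 := by
      have hle : ∀ t : Smp p, (freeVar W t - 1) ^ 2 ≤ freeVar W t ^ 2 + 1 := fun t => by
        nlinarith [freeVar_nonneg W t]
      have := integral_mono (h1.pow 2).integrable
        (((hasMoments_freeVar W).pow 2).add (HasMoments.const 1)).integrable hle
      rw [integral_add ((hasMoments_freeVar W).pow 2).integrable (integrable_const _)] at this
      simp only [integral_const, probReal_univ, smul_eq_mul, mul_one] at this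
      have h5 := integral_freeVar_sq_le W
      rw [← hVdef] at h5
      nlinarith
    have e3 : ∀ ω : Fin B → Smp p, ((B : ℝ)⁻¹ * total (freeVar W) ω - 1) ^ 2
        = ((B : ℝ)⁻¹) ^ 2 * (∑ a, (freeVar W (ω a) - 1)) ^ 2 := by
      intro ω
      rw [Finset.sum_sub_distrib, ← mul_pow, mul_sub]
      simp [total, hB'.ne']
    simp_rw [e3]
    rw [integral_const_mul]
    simp only [integral_const, probReal_univ, smul_eq_mul, mul_one] at this
    calc _ ≤ ((B : ℝ)⁻¹) ^ 2 * (B * 28 + (B * (V - 1)) ^ 2) := by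
          gcongr; exact this.trans (by gcongr)
      _ = 28 / B + (V - 1) ^ 2 := by field_simp
  -- The deficit `1 - V` is at most `r² + c² ≤ 2`. It enters halved in the linear part and as `10 (V
  -- - 1)²` in the remainder, a total of `20.5`, rounded up to 21.
  have hv1 : (V - 1) ^ 2 ≤ 2 * (r ^ 2 + c ^ 2) := by nlinarith [sq_nonneg r, sq_nonneg c]
  have h360 : (360 : ℝ) / B = 10 * (8 / B + 28 / B) := by ring
  rw [h360]
  rw [abs_le] at hb ⊢
  constructor <;> linarith [hb.1, hb.2]

end Entry

/-! ### Mean sign of one entry: assembly and link with the gradient. -/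

section EntryBound

variable {p q B : ℕ}

/-- The error scale, per entry, of the linear approximation to the mean gradient sign; `r` and `c`
are the row and column norms and `δ` is the size of the entry. -/
noncomputable def entryError (B : ℕ) (r c δ : ℝ) : ℝ :=
  1 / (B : ℝ) ^ 2 + r ^ 3 + c ^ 3 + r ^ 2 / B + c * r / √B + c * r ^ 2 + δ * r
    + δ * √B * (r ^ 2 + c ^ 2) + δ ^ 3 * (B * √B) + δ / √B

/-- Triangle inequality through the variance replacement, the symmetrised linearisation and the
concentration of `S / √V`. The largest coefficient that arises is `126720`, whence `200000`. -/
lemma abs_integral_meanSign_sub_linear_le {d r c : ℝ} {w : Fin p → ℝ} {e : Fin q → ℝ}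
    {W : Fin q → Fin p → ℝ} (hB : 0 < B) (hr : 0 ≤ r) (hr1 : r ≤ 1) (hc : 0 ≤ c) (hc1 : c ≤ 1)
    (he : ∑ l, e l ^ 2 ≤ r ^ 2) (hw : ∑ k, w k ^ 2 ≤ c ^ 2) (hd : |d| ≤ c)
    (hV : ∑ l, ∑ k, W l k ^ 2 ≤ 1) (hV' : 1 ≤ ∑ l, ∑ k, W l k ^ 2 + r ^ 2 + c ^ 2) :
    |∫ ω, meanSign (d * total sqProd ω + total (noiseTerm w) ω) (total (fullVar e W) ω)
        ∂(batchLaw B p) - signSlope * (d * √B)| ≤ 200000 * entryError B r c |d| := by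
  have hB' : (0 : ℝ) < B := by exact_mod_cast hB
  have h1 := abs_integral_meanSign_sub_le hB hr hr1 hc he hw hd hV
  rw [integral_goodEvent_symm] at h1
  have h2 := abs_integral_symm_sub_le (W := W) (d := d) hB hw
  have h3 := abs_integral_ite_sub_one_le (B := B) hB (by nlinarith) (by nlinarith) hV hV'
  have h4 := measure_goodEvent_compl_le (B := B) hB hr hc hV hV'
  set I1 := ∫ ω, meanSign (d * total sqProd ω + total (noiseTerm w) ω) (total (fullVar e W) ω)
        ∂(batchLaw B p)
  set I2 := ∫ ω, (goodEvent W).indicator (fun ω =>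
        (meanSign (d * total sqProd ω + total (noiseTerm w) ω) (total (freeVar W) ω)
        + meanSign (d * total sqProd ω - total (noiseTerm w) ω) (total (freeVar W) ω)) / 2) ω
        ∂(batchLaw B p)
  set I3 := ∫ ω, (if 1 / 4 ≤ total (freeVar W) ω / B
        then total sqProd ω / B / √(total (freeVar W) ω / B) else 0) ∂(batchLaw B p)
  have h5 : |signSlope * (d * √B) * (I3 - 1)|
      ≤ |d| * √B * (21 * (r ^ 2 + c ^ 2) + 360 / B) := by
    rw [abs_mul, abs_mul, abs_mul, abs_of_pos signSlope_pos, abs_of_nonneg (Real.sqrt_nonneg _)]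
    refine mul_le_mul ?_ h3 (abs_nonneg _) (by positivity)
    have : 0 ≤ |d| * √(B : ℝ) := by positivity
    nlinarith [signSlope_le_one]
  have e0 : I1 - signSlope * (d * √B) = (I1 - I2) + (I2 - signSlope * (d * √B) * I3)
      + signSlope * (d * √B) * (I3 - 1) := by ring
  have h6 := abs_add_three (I1 - I2) (I2 - signSlope * (d * √B) * I3)
    (signSlope * (d * √B) * (I3 - 1))
  rw [← e0] at h6
  have hδ := abs_nonneg d
  rw [← sq_abs d] at h2
  generalize |d| = δ at h1 h2 h5 hδ ⊢
  unfold entryError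
  -- Writing `B = b²` turns all powers of `B` and `√B` into monomials.
  obtain ⟨b, hb, hbB⟩ : ∃ b : ℝ, 0 < b ∧ (B : ℝ) = b ^ 2 :=
    ⟨√B, Real.sqrt_pos.2 hB', (Real.sq_sqrt hB'.le).symm⟩
  rw [hbB, Real.sqrt_sq hb.le] at h1 h2 h5 h6 ⊢
  rw [hbB] at h4
  have r43 : r ^ 4 ≤ r ^ 3 := by nlinarith [pow_nonneg hr 3]
  have f1 : 128 * (b ^ 2 * (990 * r ^ 2) + (b ^ 2 * (3 * r ^ 2)) ^ 2) / (b ^ 2) ^ 2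
      = 126720 * (r ^ 2 / b ^ 2) + 1152 * r ^ 4 := by field_simp; ring
  have f2 : 16 * ((5 * b * c + b ^ 2 * δ) * (32 * b * r + 3 * b ^ 2 * r ^ 2)) / (b ^ 2 * b)
      = 2560 * (c * r / b) + 240 * (c * r ^ 2) + 512 * (δ * r) + 48 * (δ * b * r ^ 2) := by
    field_simp; ring
  have f3 : 8 * δ * (δ ^ 2 * (225 * (b ^ 2) ^ 3) + (b ^ 2) ^ 2 * (45 * c ^ 2)) / (b ^ 2 * b)
      = 1800 * (δ ^ 3 * (b ^ 2 * b)) + 360 * (δ * b * c ^ 2) := by field_simp; ring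
  have f4 : δ * b * (21 * (r ^ 2 + c ^ 2) + 360 / b ^ 2)
      = 21 * (δ * b * r ^ 2) + 21 * (δ * b * c ^ 2) + 360 * (δ / b) := by field_simp
  have f5 : 93312 / (b ^ 2) ^ 2 = 93312 * (1 / (b ^ 2) ^ 2) := by ring
  rw [f1, f2] at h1
  rw [f3] at h2
  rw [f4] at h5
  rw [f5] at h4
  have g1 : 0 ≤ 1 / (b ^ 2) ^ 2 := by positivity
  have g2 : 0 ≤ r ^ 3 := by positivity
  have g3 : 0 ≤ c ^ 3 := by positivity
  have g4 : 0 ≤ r ^ 2 / b ^ 2 := by positivity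
  have g5 : 0 ≤ c * r / b := by positivity
  have g6 : 0 ≤ c * r ^ 2 := by positivity
  have g7 : 0 ≤ δ * r := by positivity
  have g8 : 0 ≤ δ * b * r ^ 2 := by positivity
  have g9 : 0 ≤ δ * b * c ^ 2 := by positivity
  have g10 : 0 ≤ δ ^ 3 * (b ^ 2 * b) := by positivity
  have g11 : 0 ≤ δ / b := by positivity
  have f6 : δ * b * (r ^ 2 + c ^ 2) = δ * b * r ^ 2 + δ * b * c ^ 2 := by ring
  rw [f6]
  linarith

/-- The law of one data point, as a pair of vectors. -/
noncomputable abbrev dataLaw (p q : ℕ) : Measure ((Fin p → ℝ) × (Fin q → ℝ)) :=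
  (gaussPi (Fin p)).prod (gaussPi (Fin q))

/-- The unnormalised `(i, j)` entry of the minibatch gradient. -/
def gradSum (D : Matrix (Fin p) (Fin q) ℝ) (i : Fin p) (j : Fin q)
    (ω : Fin B → (Fin p → ℝ) × (Fin q → ℝ)) : ℝ :=
  ∑ a, (ω a).1 i * (ω a).2 j * ∑ k, ∑ l, (ω a).1 k * (ω a).2 l * D k l

lemma measurable_gradSum (D : Matrix (Fin p) (Fin q) ℝ) (i : Fin p) (j : Fin q) :
    Measurable (gradSum (B := B) D i j) := by
  unfold gradSum; fun_prop

/-- Insertion of the distinguished coordinates of a sample into a data point. -/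
def insertSmp (i : Fin p) (j : Fin q) (z : Smp p × (Fin q → ℝ)) : (Fin p → ℝ) × (Fin q → ℝ) :=
  (Function.update z.1.2.2 i z.1.1, Function.update z.2 j z.1.2.1)

/-- A sample carries a full output vector whose coordinate `i` is a dummy, overwritten by `u`;
likewise coordinate `j` of the input vector by `v`. This isolates the two coordinates without
splitting the index types. -/
lemma measurePreserving_insertSmp (i : Fin p) (j : Fin q) :
    MeasurePreserving (insertSmp i j) ((smpLaw p).prod (gaussPi (Fin q))) (dataLaw p q) := by
  have h1 : MeasurePreserving (fun z : Smp p => (z.1, (z.2.2, z.2.1))) (smpLaw p)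
      (gauss.prod ((gaussPi (Fin p)).prod gauss)) :=
    (MeasurePreserving.id gauss).prod Measure.measurePreserving_swap
  have h2 := (measurePreserving_prodAssoc gauss (gaussPi (Fin p)) gauss).symm
  have h3 := (h2.comp h1).prod (MeasurePreserving.id (gaussPi (Fin q)))
  have h4 := measurePreserving_prodAssoc (gauss.prod (gaussPi (Fin p))) gauss (gaussPi (Fin q))
  have h5 := (measurePreserving_update (μ := gauss) i).prod (measurePreserving_update (μ := gauss) j)
  exact h5.comp (h4.comp h3)

lemma sum_update_mul {ι : Type*} [Fintype ι] [DecidableEq ι] (x w : ι → ℝ) (i : ι) (u : ℝ) :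
    ∑ k, Function.update x i u k * w k = u * w i + lin (fun k => if k = i then 0 else w k) x := by
  unfold lin
  rw [← Finset.add_sum_erase _ _ (Finset.mem_univ i), ← Finset.add_sum_erase (a := i)
    (f := fun k => (if k = i then 0 else w k) * x k) _ (Finset.mem_univ i)]
  simp only [Function.update_self, if_true, zero_mul, zero_add]
  congr 1
  refine Finset.sum_congr rfl fun k hk => ?_
  have := Finset.ne_of_mem_erase hk
  rw [Function.update_of_ne this, if_neg this, mul_comm]

/-- The column `l` of `D` without its entry `i`. -/
def colRest (D : Matrix (Fin p) (Fin q) ℝ) (i : Fin p) (l : Fin q) (k : Fin p) : ℝ :=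
  if k = i then 0 else D k l

/-- The row `i` of `D` without its entry `j`. -/
def rowRest (D : Matrix (Fin p) (Fin q) ℝ) (i : Fin p) (j l : Fin q) : ℝ :=
  if l = j then 0 else D i l

/-- The columns of `D` without row `i` and column `j`. -/
def minorRest (D : Matrix (Fin p) (Fin q) ℝ) (i : Fin p) (j l : Fin q) (k : Fin p) : ℝ :=
  if l = j then 0 else colRest D i l k

/-- The coefficients of the summand of the gradient as a linear form in the input vector. -/
def gradCoef (D : Matrix (Fin p) (Fin q) ℝ) (i : Fin p) (j : Fin q) (t : Smp p) (l : Fin q) : ℝ :=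
  t.1 * t.2.1 * (rowRest D i j l * t.1 + lin (minorRest D i j l) t.2.2)

/-- Split the double sum according to `k = i` or not and `l = j` or not. The part with `l = j` is
the conditional mean; the rest is linear in the input vector. The dummy coordinates receive
coefficient zero. -/
lemma grad_insertSmp (D : Matrix (Fin p) (Fin q) ℝ) (i : Fin p) (j : Fin q)
    (z : Smp p × (Fin q → ℝ)) :
    (insertSmp i j z).1 i * (insertSmp i j z).2 j
        * ∑ k, ∑ l, (insertSmp i j z).1 k * (insertSmp i j z).2 l * D k l
      = D i j * sqProd z.1 + noiseTerm (colRest D i j) z.1 + lin (gradCoef D i j z.1) z.2 := by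
  obtain ⟨⟨u, v, x⟩, y⟩ := z
  have e1 : ∑ k, ∑ l, Function.update x i u k * Function.update y j v l * D k l
      = ∑ l, Function.update y j v l * (u * D i l + lin (colRest D i l) x) := by
    rw [Finset.sum_comm]
    refine Finset.sum_congr rfl fun l _ => ?_
    rw [show lin (colRest D i l) x = lin (fun k => if k = i then 0 else D k l) x from rfl,
      ← sum_update_mul x (fun k => D k l) i u, Finset.mul_sum]
    exact Finset.sum_congr rfl fun k _ => by ring
  simp only [insertSmp, Function.update_self]
  rw [e1, sum_update_mul, sqProd, noiseTerm, mul_add]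
  have e2 : u * v * lin (fun l => if l = j then 0 else u * D i l + lin (colRest D i l) x) y
      = lin (gradCoef D i j (u, v, x)) y := by
    unfold lin
    rw [Finset.mul_sum]
    refine Finset.sum_congr rfl fun l _ => ?_
    simp only [gradCoef, rowRest, minorRest, lin]
    by_cases h : l = j
    · simp [h]
    · simp [h]; ring
  rw [e2]; ring

lemma sum_gradCoef_sq (D : Matrix (Fin p) (Fin q) ℝ) (i : Fin p) (j : Fin q) (t : Smp p) :
    ∑ l, gradCoef D i j t l ^ 2 = fullVar (rowRest D i j) (minorRest D i j) t := by
  rw [fullVar, Finset.mul_sum]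
  exact Finset.sum_congr rfl fun l _ => by rw [gradCoef, sqProd]; ring

lemma integral_sign_add_sum_lin (m : ℝ) (w : Fin B → Fin q → ℝ) :
    ∫ y, Real.sign (m + ∑ a, lin (w a) (y a)) ∂(Measure.pi fun _ : Fin B => gaussPi (Fin q))
      = meanSign m (∑ a, ∑ l, w a l ^ 2) := by
  have h := map_sum_pi_gaussianReal (ι := Fin B) (μ := gaussPi (Fin q)) (f := fun a => lin (w a))
    (fun a => measurable_lin _) (fun a => map_lin_gaussPi (w a))
  rw [← Real.toNNReal_sum_of_nonneg fun a _ => Finset.sum_nonneg fun l _ => sq_nonneg _,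
    ← map_sqrt_mul_gauss (by positivity)] at h
  have hs : Measurable fun s : ℝ => Real.sign (m + s) := by fun_prop
  rw [← integral_map (φ := fun y : Fin B → Fin q → ℝ => ∑ a, lin (w a) (y a))
    (f := fun s => Real.sign (m + s)) (Finset.measurable_sum _ fun a _ =>
      (measurable_lin (w a)).comp (measurable_pi_apply a)).aemeasurable hs.aestronglyMeasurable, h,
    integral_map (by fun_prop) hs.aestronglyMeasurable, meanSign]

/-- Fubini, integrating the input vectors first: for fixed samples the gradient entry is a Gaussian
whose mean and variance are the totals of `grad_insertSmp` and `sum_gradCoef_sq`. -/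
lemma integral_sign_gradSum (D : Matrix (Fin p) (Fin q) ℝ) (i : Fin p) (j : Fin q) :
    ∫ ω, Real.sign (gradSum D i j ω) ∂(Measure.pi fun _ : Fin B => dataLaw p q)
      = ∫ ω, meanSign (D i j * total sqProd ω + total (noiseTerm (colRest D i j)) ω)
        (total (fullVar (rowRest D i j) (minorRest D i j)) ω) ∂(batchLaw B p) := by
  have h1 : MeasurePreserving (fun (z : Fin B → Smp p × (Fin q → ℝ)) a => insertSmp i j (z a))
      (Measure.pi fun _ => (smpLaw p).prod (gaussPi (Fin q))) (Measure.pi fun _ => dataLaw p q) :=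
    measurePreserving_pi _ _ fun _ => measurePreserving_insertSmp i j
  have h2 := (measurePreserving_arrowProdEquivProdArrow (Smp p) (Fin q → ℝ) (Fin B)
    (fun _ => smpLaw p) (fun _ => gaussPi (Fin q))).symm
  have h3 := h1.comp h2
  have hm : Measurable fun ω : Fin B → (Fin p → ℝ) × (Fin q → ℝ) => Real.sign (gradSum D i j ω) :=
    measurable_sign.comp (measurable_gradSum D i j)
  rw [← h3.map_eq, integral_map h3.measurable.aemeasurable hm.aestronglyMeasurable, integral_prod]
  · congr 1; ext ω
    have e : ∀ y : Fin B → Fin q → ℝ, gradSum D i j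
        (((fun (z : Fin B → Smp p × (Fin q → ℝ)) a => insertSmp i j (z a)) ∘
          (MeasurableEquiv.arrowProdEquivProdArrow (Smp p) (Fin q → ℝ) (Fin B)).symm) (ω, y))
        = (D i j * total sqProd ω + total (noiseTerm (colRest D i j)) ω)
          + ∑ a, lin (gradCoef D i j (ω a)) (y a) := by
      intro y
      simp only [total, Finset.mul_sum]
      rw [← Finset.sum_add_distrib, ← Finset.sum_add_distrib]
      exact Finset.sum_congr rfl fun a _ => grad_insertSmp D i j (ω a, y a)
    simp_rw [e]
    rw [integral_sign_add_sum_lin]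
    congr 1
    exact Finset.sum_congr rfl fun a _ => sum_gradCoef_sq D i j (ω a)
  · exact integrable_sign_comp ((measurable_gradSum D i j).comp h3.measurable)

/-- The Euclidean norm of row `i`. -/
noncomputable def rowNorm (D : Matrix (Fin p) (Fin q) ℝ) (i : Fin p) : ℝ := √(∑ l, D i l ^ 2)

/-- The Euclidean norm of column `j`. -/
noncomputable def colNorm (D : Matrix (Fin p) (Fin q) ℝ) (j : Fin q) : ℝ := √(∑ k, D k j ^ 2)

lemma rowNorm_sq (D : Matrix (Fin p) (Fin q) ℝ) (i : Fin p) : rowNorm D i ^ 2 = ∑ l, D i l ^ 2 :=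
  Real.sq_sqrt (by positivity)

lemma colNorm_sq (D : Matrix (Fin p) (Fin q) ℝ) (j : Fin q) : colNorm D j ^ 2 = ∑ k, D k j ^ 2 :=
  Real.sq_sqrt (by positivity)

lemma rowNorm_nonneg (D : Matrix (Fin p) (Fin q) ℝ) (i : Fin p) : 0 ≤ rowNorm D i :=
  Real.sqrt_nonneg _

lemma colNorm_nonneg (D : Matrix (Fin p) (Fin q) ℝ) (j : Fin q) : 0 ≤ colNorm D j :=
  Real.sqrt_nonneg _

lemma abs_le_colNorm (D : Matrix (Fin p) (Fin q) ℝ) (i : Fin p) (j : Fin q) :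
    |D i j| ≤ colNorm D j :=
  Real.abs_le_sqrt (Finset.single_le_sum (f := fun k => D k j ^ 2) (fun _ _ => sq_nonneg _)
    (Finset.mem_univ i))

lemma sum_rowNorm_sq (D : Matrix (Fin p) (Fin q) ℝ) :
    ∑ i, rowNorm D i ^ 2 = ∑ i, ∑ j, D i j ^ 2 := by simp_rw [rowNorm_sq]

lemma sum_colNorm_sq (D : Matrix (Fin p) (Fin q) ℝ) :
    ∑ j, colNorm D j ^ 2 = ∑ i, ∑ j, D i j ^ 2 := by
  simp_rw [colNorm_sq]; rw [Finset.sum_comm]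

lemma abs_integral_sign_gradSum_sub_le (D : Matrix (Fin p) (Fin q) ℝ)
    (hD : ∑ i, ∑ j, D i j ^ 2 = 1) (hB : 0 < B) (i : Fin p) (j : Fin q) :
    |∫ ω, Real.sign (gradSum D i j ω) ∂(Measure.pi fun _ : Fin B => dataLaw p q)
      - signSlope * (D i j * √B)|
      ≤ 200000 * entryError B (rowNorm D i) (colNorm D j) |D i j| := by
  rw [integral_sign_gradSum]
  have hr1 : rowNorm D i ^ 2 ≤ 1 := by
    rw [← hD, ← sum_rowNorm_sq]
    exact Finset.single_le_sum (f := fun i => rowNorm D i ^ 2) (fun l _ => sq_nonneg _)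
      (Finset.mem_univ i)
  have hc1 : colNorm D j ^ 2 ≤ 1 := by
    rw [← hD, ← sum_colNorm_sq]
    exact Finset.single_le_sum (f := fun j => colNorm D j ^ 2) (fun l _ => sq_nonneg _)
      (Finset.mem_univ j)
  have hcol : ∀ l, ∑ k, D k l ^ 2 = ∑ k, colRest D i l k ^ 2 + D i l ^ 2 := by
    intro l
    rw [← Finset.sum_erase_add _ _ (Finset.mem_univ i), ← Finset.sum_erase_add (a := i)
      (f := fun k => colRest D i l k ^ 2) _ (Finset.mem_univ i)]
    simp only [colRest, if_true]
    rw [zero_pow two_ne_zero, add_zero]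
    congr 1
    refine Finset.sum_congr rfl fun k hk => ?_
    rw [if_neg (Finset.ne_of_mem_erase hk)]
  have hmin : ∑ l, ∑ k, colRest D i l k ^ 2
      = ∑ l, ∑ k, minorRest D i j l k ^ 2 + ∑ k, colRest D i j k ^ 2 := by
    rw [← Finset.sum_erase_add _ _ (Finset.mem_univ j), ← Finset.sum_erase_add (a := j)
      (f := fun l => ∑ k, minorRest D i j l k ^ 2) _ (Finset.mem_univ j)]
    simp only [minorRest, if_true]
    rw [zero_pow two_ne_zero, Finset.sum_const_zero, add_zero]
    congr 1
    refine Finset.sum_congr rfl fun k hk => ?_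
    simp_rw [if_neg (Finset.ne_of_mem_erase hk)]
  -- Row `i`, the rest of column `j` and the remaining minor partition the matrix; this yields the
  -- lower bound on the mean free variance.
  have htot : 1 = ∑ l, ∑ k, minorRest D i j l k ^ 2 + ∑ k, colRest D i j k ^ 2
      + rowNorm D i ^ 2 := by
    rw [← hD, Finset.sum_comm, rowNorm_sq, ← hmin, ← Finset.sum_add_distrib]
    exact Finset.sum_congr rfl fun l _ => hcol l
  have hcr : ∑ k, colRest D i j k ^ 2 ≤ colNorm D j ^ 2 := by
    rw [colNorm_sq, hcol j]; nlinarith [sq_nonneg (D i j)]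
  refine abs_integral_meanSign_sub_linear_le hB (rowNorm_nonneg D i) ?_ (colNorm_nonneg D j) ?_ ?_
    hcr (abs_le_colNorm D i j) ?_ ?_
  · nlinarith [rowNorm_nonneg D i]
  · nlinarith [colNorm_nonneg D j]
  · rw [rowNorm_sq]
    refine Finset.sum_le_sum fun l _ => ?_
    unfold rowRest
    split_ifs
    · simpa using sq_nonneg (D i l)
    · exact le_rfl
  · have : 0 ≤ ∑ k, colRest D i j k ^ 2 := by positivity
    nlinarith [sq_nonneg (rowNorm D i)]
  · linarith

end EntryBound

/-! ### Summing the entry errors. -/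

section Summation

lemma le_of_sq_le_sq {a b : ℝ} (h : a ^ 2 ≤ b ^ 2) (hb : 0 ≤ b) : a ≤ b :=
  (abs_le_of_sq_le_sq' h hb).2

variable {p q B : ℕ}

lemma sum_le_sqrt_mul_sqrt {ι : Type*} [Fintype ι] (f : ι → ℝ) {n s : ℝ}
    (hn : (Fintype.card ι : ℝ) ≤ n) (hs : ∑ i, f i ^ 2 ≤ s) : ∑ i, f i ≤ √n * √s := by
  have h := sq_sum_le_card_mul_sum_sq (s := Finset.univ) (f := f)
  have h0 : 0 ≤ ∑ i, f i ^ 2 := by positivity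
  have hn0 : 0 ≤ n := (Nat.cast_nonneg _).trans hn
  rw [← Real.sqrt_mul hn0]
  refine Real.le_sqrt_of_sq_le (h.trans ?_)
  rw [Finset.card_univ]
  exact mul_le_mul hn hs h0 hn0

/-- Summing against `|D i j|` gains over the worst entry: Cauchy-Schwarz gives `∑ⱼ |Dᵢⱼ| ≤ √n rᵢ`,
so for instance the `r³` term becomes `√n ∑ rᵢ⁴ ≤ √n ρ²` because `∑ rᵢ² = 1`. Terms already
containing `δ` are summed with `∑ Dᵢⱼ² = 1`. -/
lemma sum_sum_mul_entryError_le (D : Matrix (Fin p) (Fin q) ℝ) (hD : ∑ i, ∑ j, D i j ^ 2 = 1)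
    {n ρ L : ℝ} (hp : (p : ℝ) ≤ n) (hq : (q : ℝ) ≤ n) (hr : ∀ i, rowNorm D i ≤ ρ)
    (hc : ∀ j, colNorm D j ≤ ρ) (hL : ∀ i j, |D i j| ≤ L) :
    ∑ i, ∑ j, |D i j| * entryError B (rowNorm D i) (colNorm D j) |D i j|
      ≤ n / (B : ℝ) ^ 2 + 2 * (√n * ρ ^ 2) + √n / B + 2 / √B + 2 * ρ + 2 * (√B * ρ ^ 2)
        + L ^ 2 * (B * √B) := by
  have hn : 0 ≤ n := (Nat.cast_nonneg _).trans hp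
  have r0 := rowNorm_nonneg D
  have c0 := colNorm_nonneg D
  have hr2 : ∑ i, rowNorm D i ^ 2 = 1 := by rw [sum_rowNorm_sq, hD]
  have hc2 : ∑ j, colNorm D j ^ 2 = 1 := by rw [sum_colNorm_sq, hD]
  have hD2 : ∑ i, ∑ j, |D i j| ^ 2 = 1 := by simp_rw [sq_abs]; exact hD
  have hρ : 0 ≤ ρ := by
    by_contra h
    have : IsEmpty (Fin p) := ⟨fun i => h ((r0 i).trans (hr i))⟩
    simp at hD
  have hrow : ∀ i, ∑ j, |D i j| ≤ √n * rowNorm D i := fun i => by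
    have := sum_le_sqrt_mul_sqrt (fun j => |D i j|) (n := n) (by simpa using hq)
      (s := ∑ j, D i j ^ 2) (by simp)
    exact this
  have hcol : ∀ j, ∑ i, |D i j| ≤ √n * colNorm D j := fun j => by
    have := sum_le_sqrt_mul_sqrt (fun i => |D i j|) (n := n) (by simpa using hp)
      (s := ∑ i, D i j ^ 2) (by simp)
    exact this
  have hr1 : ∀ i, rowNorm D i ≤ 1 := fun i => by
    have := Finset.single_le_sum (f := fun i => rowNorm D i ^ 2) (fun _ _ => sq_nonneg _)
      (Finset.mem_univ i)
    rw [hr2] at this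
    nlinarith [r0 i]
  -- Arithmetic-geometric mean: `∑ Dᵢⱼ²` and `∑ rᵢ² cⱼ²` both equal 1.
  have hDcr : ∑ i, ∑ j, |D i j| * (colNorm D j * rowNorm D i) ≤ 1 := by
    have h1 : ∑ i, ∑ j, |D i j| * (colNorm D j * rowNorm D i)
        ≤ ∑ i, ∑ j, (|D i j| ^ 2 + rowNorm D i ^ 2 * colNorm D j ^ 2) / 2 :=
      Finset.sum_le_sum fun i _ => Finset.sum_le_sum fun j _ => by
        nlinarith [sq_nonneg (|D i j| - colNorm D j * rowNorm D i)]
    refine h1.trans (le_of_eq ?_)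
    simp_rw [← Finset.sum_div, Finset.sum_add_distrib, ← Finset.mul_sum]
    rw [hD2, hc2, ← Finset.sum_mul, hr2]; norm_num
  have t1 : ∑ i, ∑ j, |D i j| * (1 / (B : ℝ) ^ 2) ≤ n / (B : ℝ) ^ 2 := by
    simp_rw [← Finset.sum_mul]
    have h1 := sum_le_sqrt_mul_sqrt (fun i => rowNorm D i) (n := n) (by simpa using hp) hr2.le
    have : ∑ i, ∑ j, |D i j| ≤ n := by
      calc _ ≤ ∑ i, √n * rowNorm D i := Finset.sum_le_sum fun i _ => hrow i
        _ ≤ √n * (√n * √1) := by rw [← Finset.mul_sum]; gcongr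
        _ = n := by rw [Real.sqrt_one, mul_one, Real.mul_self_sqrt hn]
    rw [mul_one_div]; gcongr
  have t2 : ∑ i, ∑ j, |D i j| * rowNorm D i ^ 3 ≤ √n * ρ ^ 2 := by
    calc _ ≤ ∑ i, √n * ρ ^ 2 * rowNorm D i ^ 2 := Finset.sum_le_sum fun i _ => by
          rw [← Finset.sum_mul]
          calc _ ≤ √n * rowNorm D i * rowNorm D i ^ 3 :=
                mul_le_mul_of_nonneg_right (hrow i) (pow_nonneg (r0 i) 3)
            _ = √n * rowNorm D i ^ 2 * rowNorm D i ^ 2 := by ring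
            _ ≤ _ := by gcongr; exacts [r0 i, hr i]
      _ = _ := by rw [← Finset.mul_sum, hr2, mul_one]
  have t3 : ∑ i, ∑ j, |D i j| * colNorm D j ^ 3 ≤ √n * ρ ^ 2 := by
    rw [Finset.sum_comm]
    calc _ ≤ ∑ j, √n * ρ ^ 2 * colNorm D j ^ 2 := Finset.sum_le_sum fun j _ => by
          rw [← Finset.sum_mul]
          calc _ ≤ √n * colNorm D j * colNorm D j ^ 3 :=
                mul_le_mul_of_nonneg_right (hcol j) (pow_nonneg (c0 j) 3)
            _ = √n * colNorm D j ^ 2 * colNorm D j ^ 2 := by ring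
            _ ≤ _ := by gcongr; exacts [c0 j, hc j]
      _ = _ := by rw [← Finset.mul_sum, hc2, mul_one]
  have t4 : ∑ i, ∑ j, |D i j| * (rowNorm D i ^ 2 / B) ≤ √n / B := by
    calc _ ≤ ∑ i, √n / B * rowNorm D i ^ 2 := Finset.sum_le_sum fun i _ => by
          rw [← Finset.sum_mul]
          calc _ ≤ √n * rowNorm D i * (rowNorm D i ^ 2 / B) :=
                mul_le_mul_of_nonneg_right (hrow i) (by positivity)
            _ ≤ √n * 1 * (rowNorm D i ^ 2 / B) := by gcongr; exact hr1 i
            _ = _ := by ring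
      _ = _ := by rw [← Finset.mul_sum, hr2, mul_one]
  have t5 : ∑ i, ∑ j, |D i j| * (colNorm D j * rowNorm D i / √B) ≤ 1 / √B := by
    simp_rw [← mul_div_assoc, ← Finset.sum_div]
    gcongr
  have t6 : ∑ i, ∑ j, |D i j| * (colNorm D j * rowNorm D i ^ 2) ≤ ρ := by
    calc _ ≤ ∑ i, ∑ j, |D i j| * (colNorm D j * rowNorm D i) * ρ :=
          Finset.sum_le_sum fun i _ => Finset.sum_le_sum fun j _ => by
            calc _ = |D i j| * (colNorm D j * rowNorm D i) * rowNorm D i := by ring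
              _ ≤ _ := mul_le_mul_of_nonneg_left (hr i)
                (mul_nonneg (abs_nonneg _) (mul_nonneg (c0 j) (r0 i)))
      _ ≤ 1 * ρ := by simp_rw [← Finset.sum_mul]; gcongr
      _ = ρ := one_mul ρ
  have t7 : ∑ i, ∑ j, |D i j| * (|D i j| * rowNorm D i) ≤ ρ := by
    calc _ ≤ ∑ i, ∑ j, |D i j| ^ 2 * ρ :=
          Finset.sum_le_sum fun i _ => Finset.sum_le_sum fun j _ => by
            rw [← mul_assoc, ← sq]; gcongr; exact hr i
      _ = ρ := by simp_rw [← Finset.sum_mul]; rw [hD2, one_mul]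
  have t8 : ∑ i, ∑ j, |D i j| * (|D i j| * √B * (rowNorm D i ^ 2 + colNorm D j ^ 2))
      ≤ 2 * (√B * ρ ^ 2) := by
    calc _ ≤ ∑ i, ∑ j, |D i j| ^ 2 * (√B * (ρ ^ 2 + ρ ^ 2)) :=
          Finset.sum_le_sum fun i _ => Finset.sum_le_sum fun j _ => by
            rw [← mul_assoc, ← mul_assoc, ← sq, mul_assoc]
            gcongr
            exacts [r0 i, hr i, c0 j, hc j]
      _ = _ := by simp_rw [← Finset.sum_mul]; rw [hD2]; ring
  have t9 : ∑ i, ∑ j, |D i j| * (|D i j| ^ 3 * (B * √B)) ≤ L ^ 2 * (B * √B) := by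
    calc _ ≤ ∑ i, ∑ j, |D i j| ^ 2 * (L ^ 2 * (B * √B)) :=
          Finset.sum_le_sum fun i _ => Finset.sum_le_sum fun j _ => by
            calc _ = |D i j| ^ 2 * (|D i j| ^ 2 * (B * √B)) := by ring
              _ ≤ _ := by gcongr; exact hL i j
      _ = _ := by simp_rw [← Finset.sum_mul]; rw [hD2, one_mul]
  have t10 : ∑ i, ∑ j, |D i j| * (|D i j| / √B) ≤ 1 / √B := by
    simp_rw [← mul_div_assoc, ← sq, ← Finset.sum_div]
    rw [hD2]
  have e : 2 / √(B : ℝ) = 1 / √B + 1 / √B := by ring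
  simp only [entryError, mul_add, Finset.sum_add_distrib] at t8 ⊢
  rw [e]
  linarith

/-- The mean of the sign of the `(i, j)` entry of the minibatch gradient. -/
noncomputable def meanGradSign (B : ℕ) (D : Matrix (Fin p) (Fin q) ℝ) (i : Fin p) (j : Fin q) : ℝ :=
  ∫ ω, Real.sign (gradSum D i j ω) ∂(Measure.pi fun _ : Fin B => dataLaw p q)

lemma gradSum_smul (a : ℝ) (D : Matrix (Fin p) (Fin q) ℝ) (i : Fin p) (j : Fin q)
    (ω : Fin B → (Fin p → ℝ) × (Fin q → ℝ)) : gradSum (a • D) i j ω = a * gradSum D i j ω := by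
  simp only [gradSum, Matrix.smul_apply, smul_eq_mul, Finset.mul_sum]
  refine Finset.sum_congr rfl fun _ _ => Finset.sum_congr rfl fun _ _ =>
    Finset.sum_congr rfl fun _ _ => by ring

lemma meanGradSign_smul {a : ℝ} (ha : 0 < a) (D : Matrix (Fin p) (Fin q) ℝ) (i : Fin p)
    (j : Fin q) : meanGradSign B (a • D) i j = meanGradSign B D i j := by
  simp_rw [meanGradSign, gradSum_smul, sign_mul_of_pos ha]

lemma abs_sum_mul_meanGradSign_sub_le (D : Matrix (Fin p) (Fin q) ℝ)
    (hD : ∑ i, ∑ j, D i j ^ 2 = 1) (hB : 0 < B) :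
    |∑ i, ∑ j, D i j * meanGradSign B D i j - signSlope * √B|
      ≤ 200000 * ∑ i, ∑ j, |D i j| * entryError B (rowNorm D i) (colNorm D j) |D i j| := by
  have e : ∑ i, ∑ j, D i j * meanGradSign B D i j - signSlope * √B
      = ∑ i, ∑ j, D i j * (meanGradSign B D i j - signSlope * (D i j * √B)) := by
    have h : ∀ i j, D i j * (meanGradSign B D i j - signSlope * (D i j * √B))
        = D i j * meanGradSign B D i j - D i j ^ 2 * (signSlope * √B) := fun i j => by ring
    simp_rw [h, Finset.sum_sub_distrib, ← Finset.sum_mul]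
    rw [hD, one_mul]
  rw [e, Finset.mul_sum]
  refine (Finset.abs_sum_le_sum_abs _ _).trans (Finset.sum_le_sum fun i _ => ?_)
  rw [Finset.mul_sum]
  refine (Finset.abs_sum_le_sum_abs _ _).trans (Finset.sum_le_sum fun j _ => ?_)
  rw [abs_mul]
  exact (mul_le_mul_of_nonneg_left (abs_integral_sign_gradSum_sub_le D hD hB i j)
    (abs_nonneg (D i j))).trans (le_of_eq (by ring))

/-- Expand the square root at the mean `B` of the sum: the linear term is centred and the quadratic
one is controlled by `Var(x²y²) = 9 - 1 = 8`. -/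
lemma abs_NB_sub_sqrt_le (hB : 0 < B) : |NB B - √B| ≤ 8 / √B := by
  have hB' : (0 : ℝ) < B := by exact_mod_cast hB
  have hsB := Real.sqrt_pos.2 hB'
  set μ := gauss.prod gauss
  set h : ℝ × ℝ → ℝ := fun z => z.1 ^ 2 * z.2 ^ 2 with hdef
  have hh : HasMoments h μ := ((hasMoments_id_gauss.comp measurePreserving_fst).pow 2).mul
    ((hasMoments_id_gauss.comp measurePreserving_snd).pow 2)
  have m1 : ∫ z, h z ∂μ = 1 := by
    have := integral_prod_mul (μ := gauss) (ν := gauss) (fun x : ℝ => x ^ 2) (fun x : ℝ => x ^ 2)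
    rw [integral_sq_gauss, one_mul] at this; exact this
  have m2 : ∫ z, h z ^ 2 ∂μ = 9 := by
    have := integral_prod_mul (μ := gauss) (ν := gauss) (fun x : ℝ => x ^ 4) (fun x : ℝ => x ^ 4)
    rw [integral_pow_four_gauss] at this
    norm_num at this
    rw [← this]; congr 1; ext z; simp only [hdef]; ring
  have hs := hasMoments_sum_eval (B := B) hh
  have hc : ∫ z, (h z - 1) ∂μ = 0 := by
    rw [integral_sub hh.integrable (integrable_const _), m1]; simp
  have hc2 : ∫ z, (h z - 1) ^ 2 ∂μ = 8 := by
    have e : ∀ z, (h z - 1) ^ 2 = h z ^ 2 - (2 * h z - 1) := fun z => by ring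
    simp_rw [e]
    rw [integral_sub (hh.pow 2).integrable
      (((HasMoments.const 2).mul hh).sub (HasMoments.const 1)).integrable,
      integral_sub ((HasMoments.const 2).mul hh).integrable (integrable_const _),
      integral_const_mul, m1, m2]
    simp; norm_num
  have hvar := integral_sq_sum_eval_le (B := B) (hh.sub (HasMoments.const 1))
  rw [hc, hc2] at hvar
  have hpt : ∀ z : Fin B → ℝ × ℝ,
      ‖√(∑ a, h (z a)) - (√B + (2 * √B)⁻¹ * ∑ a, (h (z a) - 1))‖
        ≤ (B * √B)⁻¹ * (∑ a, (h (z a) - 1)) ^ 2 := by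
    intro z
    have hS : 0 ≤ ∑ a, h (z a) := Finset.sum_nonneg fun a _ => by simp only [hdef]; positivity
    have hb := abs_sqrt_sub_le (A := (∑ a, h (z a)) / B) (by positivity)
    have e1 : ∑ a, (h (z a) - 1) = ∑ a, h (z a) - B := by simp
    rw [e1, Real.norm_eq_abs]
    rw [Real.sqrt_div hS] at hb
    have hm := mul_le_mul_of_nonneg_left hb hsB.le
    rw [← abs_of_pos hsB, ← abs_mul, abs_of_pos hsB] at hm
    have hq := Real.sq_sqrt hB'.le
    obtain ⟨b, hb0, hbB⟩ : ∃ b : ℝ, 0 < b ∧ (B : ℝ) = b ^ 2 := ⟨√B, hsB, hq.symm⟩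
    rw [hbB, Real.sqrt_sq hb0.le] at hm ⊢
    refine le_trans (le_of_eq ?_) (hm.trans (le_of_eq ?_))
    · congr 1; field_simp
    · field_simp
  have hsc := hasMoments_sum_eval (B := B) (hh.sub (HasMoments.const 1))
  have hL := (HasMoments.const (μ := Measure.pi fun _ : Fin B => μ) (√(B : ℝ))).add
    ((HasMoments.const ((2 * √(B : ℝ))⁻¹)).mul hsc)
  have hK := (HasMoments.const (((B : ℝ) * √(B : ℝ))⁻¹)).mul (hsc.pow 2)
  have hmeas : Measurable fun z : Fin B → ℝ × ℝ => √(∑ a, h (z a)) := by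
    simp only [hdef]; fun_prop
  have hdiff := Integrable.mono' hK.integrable
    (hmeas.aestronglyMeasurable.sub hL.integrable.aestronglyMeasurable)
    (Filter.Eventually.of_forall hpt)
  have hsq : Integrable (fun z : Fin B → ℝ × ℝ => √(∑ a, h (z a))) (Measure.pi fun _ => μ) :=
    (hdiff.add hL.integrable).congr (Filter.Eventually.of_forall fun z => by simp)
  have hb := norm_integral_le_of_norm_le hK.integrable (Filter.Eventually.of_forall hpt)
  rw [integral_sub hsq hL.integrable, integral_add (integrable_const _)
    ((HasMoments.const ((2 * √(B : ℝ))⁻¹)).mul hsc).integrable, integral_const_mul,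
    integral_const_mul, integral_sum_eval (hh.sub (HasMoments.const 1)), hc] at hb
  simp only [integral_const, probReal_univ, smul_eq_mul, one_mul, mul_zero, add_zero] at hb
  have hNB : NB B = ∫ z : Fin B → ℝ × ℝ, √(∑ a, h (z a)) ∂(Measure.pi fun _ => μ) := rfl
  rw [hNB, ← Real.norm_eq_abs]
  refine hb.trans ?_
  calc _ ≤ ((B : ℝ) * √B)⁻¹ * (B * 8 + (B * 0) ^ 2) := by gcongr
    _ = 8 / √B := by field_simp; norm_num

lemma rowNorm_le {D : Matrix (Fin p) (Fin q) ℝ} {L n : ℝ} (hL0 : 0 ≤ L) (hL : ∀ i j, |D i j| ≤ L)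
    (hq : (q : ℝ) ≤ n) (i : Fin p) : rowNorm D i ≤ √n * L := by
  have hn0 : 0 ≤ n := (Nat.cast_nonneg _).trans hq
  have h1 : ∑ j, D i j ^ 2 ≤ n * L ^ 2 := by
    refine (Finset.sum_le_card_nsmul _ _ (L ^ 2) fun j _ => ?_).trans ?_
    · rw [← sq_abs]; exact pow_le_pow_left₀ (abs_nonneg _) (hL i j) 2
    · rw [nsmul_eq_mul, Finset.card_univ, Fintype.card_fin]; gcongr
  rw [rowNorm, Real.sqrt_le_left (by positivity), mul_pow, Real.sq_sqrt hn0]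
  exact h1

lemma colNorm_le {D : Matrix (Fin p) (Fin q) ℝ} {L n : ℝ} (hL0 : 0 ≤ L) (hL : ∀ i j, |D i j| ≤ L)
    (hp : (p : ℝ) ≤ n) (j : Fin q) : colNorm D j ≤ √n * L :=
  rowNorm_le (D := Dᵀ) hL0 (fun i j => hL j i) hp j

/-- Bookkeeping with `m = s²`, `B = b²`, `κ = k²` and Frobenius norm `f`: `k s` bounds the square
roots of the dimensions and `C / (s² f)` the normalised entries. Each of seven error types times
`f²` is at most `k⁶ C² / s`, and their coefficients add up to less than `3000000`. -/
lemma total_error_le {f b s k C : ℝ} (hf0 : 0 < f) (hb0 : 0 < b) (hs0 : 0 < s) (hC : 0 < C) (hk1 : 1 ≤ k)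
    (hs1 : 1 ≤ s) (hsb : s ≤ b) (hbk : b ≤ k * s) (hfC : f ≤ k ^ 2 * C) :
    f ^ 2 * (200000 * ((k * s) ^ 2 / (b ^ 2) ^ 2
      + 2 * (k * s * (k * s * (C / (s ^ 2 * f))) ^ 2) + k * s / b ^ 2 + 2 / b
      + 2 * (k * s * (C / (s ^ 2 * f))) + 2 * (b * (k * s * (C / (s ^ 2 * f))) ^ 2)
        + (C / (s ^ 2 * f)) ^ 2 * (b ^ 2 * b)) + 8 / b) ≤ 3000000 * (k ^ 2) ^ 3 * C ^ 2 / s := by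
  have hk0 : 0 < k := by linarith
  have hf2 : f ^ 2 ≤ k ^ 4 * C ^ 2 := by
    calc f ^ 2 ≤ (k ^ 2 * C) ^ 2 := by gcongr
      _ = _ := by ring
  have kle : ∀ n : ℕ, n ≤ 6 → k ^ n * C ^ 2 / s ≤ k ^ 6 * C ^ 2 / s := fun n hn => by
    gcongr
  have a1 : f ^ 2 * ((k * s) ^ 2 / (b ^ 2) ^ 2) ≤ k ^ 6 * C ^ 2 / s := by
    calc _ ≤ k ^ 4 * C ^ 2 * ((k * s) ^ 2 / (s ^ 2 * s)) := by
          have h : s ^ 2 * s ≤ (b ^ 2) ^ 2 := by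
            calc s ^ 2 * s ≤ s ^ 2 * s ^ 2 := by nlinarith [sq_nonneg s]
              _ ≤ b ^ 2 * b ^ 2 := by gcongr
              _ = _ := by ring
          gcongr
      _ = _ := by field_simp
  have a2 : f ^ 2 * (k * s * (k * s * (C / (s ^ 2 * f))) ^ 2) ≤ k ^ 6 * C ^ 2 / s := by
    refine le_trans (le_of_eq ?_) (kle 3 (by norm_num)); field_simp
  have a3 : f ^ 2 * (k * s / b ^ 2) ≤ k ^ 6 * C ^ 2 / s := by
    calc _ ≤ k ^ 4 * C ^ 2 * (k * s / s ^ 2) := by gcongr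
      _ = k ^ 5 * C ^ 2 / s := by field_simp
      _ ≤ _ := kle 5 (by norm_num)
  have a4 : f ^ 2 * (1 / b) ≤ k ^ 6 * C ^ 2 / s := by
    calc _ ≤ k ^ 4 * C ^ 2 * (1 / s) := by gcongr
      _ = k ^ 4 * C ^ 2 / s := by field_simp
      _ ≤ _ := kle 4 (by norm_num)
  have a5 : f ^ 2 * (k * s * (C / (s ^ 2 * f))) ≤ k ^ 6 * C ^ 2 / s := by
    calc _ = f * (k * C / s) := by field_simp
      _ ≤ k ^ 2 * C * (k * C / s) := by gcongr
      _ = k ^ 3 * C ^ 2 / s := by field_simp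
      _ ≤ _ := kle 3 (by norm_num)
  have a6 : f ^ 2 * (b * (k * s * (C / (s ^ 2 * f))) ^ 2) ≤ k ^ 6 * C ^ 2 / s := by
    calc _ = b * (k ^ 2 * C ^ 2 / s ^ 2) := by field_simp
      _ ≤ k * s * (k ^ 2 * C ^ 2 / s ^ 2) := by gcongr
      _ = k ^ 3 * C ^ 2 / s := by field_simp
      _ ≤ _ := kle 3 (by norm_num)
  have a7 : f ^ 2 * ((C / (s ^ 2 * f)) ^ 2 * (b ^ 2 * b)) ≤ k ^ 6 * C ^ 2 / s := by
    calc _ = b ^ 2 * b * (C ^ 2 / s ^ 4) := by field_simp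
      _ ≤ (k * s) ^ 2 * (k * s) * (C ^ 2 / s ^ 4) := by gcongr
      _ = k ^ 3 * C ^ 2 / s := by field_simp
      _ ≤ _ := kle 3 (by norm_num)
  have e : 3000000 * (k ^ 2) ^ 3 * C ^ 2 / s = 3000000 * (k ^ 6 * C ^ 2 / s) := by ring
  rw [e]
  have h0 : 0 ≤ k ^ 6 * C ^ 2 / s := by positivity
  calc _ = 200000 * (f ^ 2 * ((k * s) ^ 2 / (b ^ 2) ^ 2))
      + 400000 * (f ^ 2 * (k * s * (k * s * (C / (s ^ 2 * f))) ^ 2))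
      + 200000 * (f ^ 2 * (k * s / b ^ 2)) + 400008 * (f ^ 2 * (1 / b))
      + 400000 * (f ^ 2 * (k * s * (C / (s ^ 2 * f))))
      + 400000 * (f ^ 2 * (b * (k * s * (C / (s ^ 2 * f))) ^ 2))
      + 200000 * (f ^ 2 * ((C / (s ^ 2 * f)) ^ 2 * (b ^ 2 * b))) := by ring
    _ ≤ _ := by linarith

/-- Normalising divides the entries by `f`, which degrades diffuseness when `f` is small. One factor
`f` returns on undoing the normalisation; the other is kept on the left and becomes the `1/√R` of
the final error. -/
lemma mul_abs_sum_mul_meanGradSign_sub_le (D : Matrix (Fin p) (Fin q) ℝ) {m : ℕ} {C κ : ℝ}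
    (hC : 0 < C) (hκ : 1 ≤ κ) (hm : 0 < m) (hmB : m ≤ B) (hp : (p : ℝ) ≤ κ * m)
    (hq : (q : ℝ) ≤ κ * m) (hB : (B : ℝ) ≤ κ * m) (hD : ∀ i j, |D i j| ≤ C / m) {f : ℝ}
    (hf0 : 0 < f) (hfD : ∑ i, ∑ j, D i j ^ 2 = f ^ 2) :
    f * |∑ i, ∑ j, D i j * meanGradSign B D i j - signSlope * NB B * f|
      ≤ 3000000 * κ ^ 3 * C ^ 2 / √m := by
  have hB0 : 0 < B := hm.trans_le hmB
  have hm' : (0 : ℝ) < m := by exact_mod_cast hm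
  have hmB' : (m : ℝ) ≤ B := by exact_mod_cast hmB
  have hfinv : 0 < f⁻¹ := by positivity
  have hDD : ∀ i j, (f⁻¹ • D) i j = f⁻¹ * D i j := fun i j => rfl
  have hD'1 : ∑ i, ∑ j, (f⁻¹ • D) i j ^ 2 = 1 := by
    simp_rw [hDD, mul_pow, ← Finset.mul_sum]
    rw [hfD]; field_simp
  have hL0 : 0 ≤ f⁻¹ * (C / m) := by positivity
  have hL : ∀ i j, |(f⁻¹ • D) i j| ≤ f⁻¹ * (C / m) := fun i j => by
    rw [hDD, abs_mul, abs_of_pos hfinv]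
    exact mul_le_mul_of_nonneg_left (hD i j) hfinv.le
  -- Diffuseness also bounds the Frobenius norm: at most `(κ m)²` entries, each of size at most
  -- `C/m`.
  have hfC : f ≤ κ * C := by
    refine le_of_sq_le_sq ?_ (by positivity)
    rw [← hfD, ← sum_rowNorm_sq]
    have h2 : ∀ i, rowNorm D i ^ 2 ≤ (√(κ * m) * (C / m)) ^ 2 := fun i =>
      pow_le_pow_left₀ (rowNorm_nonneg D i) (rowNorm_le (by positivity) hD hq i) 2
    refine (Finset.sum_le_card_nsmul _ _ _ fun i _ => h2 i).trans ?_
    rw [nsmul_eq_mul, Finset.card_univ, Fintype.card_fin, mul_pow, Real.sq_sqrt (by positivity)]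
    calc (p : ℝ) * (κ * m * (C / m) ^ 2) ≤ κ * m * (κ * m * (C / m) ^ 2) := by gcongr
      _ = _ := by field_simp
  have hS := sum_sum_mul_entryError_le (B := B) (f⁻¹ • D) hD'1 hp hq (rowNorm_le hL0 hL hq)
    (colNorm_le hL0 hL hp) hL
  have hE := abs_sum_mul_meanGradSign_sub_le (f⁻¹ • D) hD'1 hB0
  have hN := abs_NB_sub_sqrt_le hB0
  have hX : ∑ i, ∑ j, D i j * meanGradSign B D i j
      = f * ∑ i, ∑ j, (f⁻¹ • D) i j * meanGradSign B (f⁻¹ • D) i j := by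
    simp_rw [Finset.mul_sum, meanGradSign_smul hfinv, hDD]
    refine Finset.sum_congr rfl fun i _ => Finset.sum_congr rfl fun j _ => ?_
    field_simp
  rw [hX]
  generalize ∑ i, ∑ j, (f⁻¹ • D) i j * meanGradSign B (f⁻¹ • D) i j = X at hE ⊢
  have hXN : |X - signSlope * NB B| ≤ |X - signSlope * √B| + 8 / √B := by
    have e : X - signSlope * NB B = (X - signSlope * √B) - signSlope * (NB B - √B) := by ring
    rw [e]
    refine (abs_sub _ _).trans ?_
    rw [abs_mul signSlope, abs_of_pos signSlope_pos]
    nlinarith [abs_nonneg (NB B - √(B : ℝ)), signSlope_le_one, signSlope_pos]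
  have hfac : f * |f * X - signSlope * NB B * f| = f ^ 2 * |X - signSlope * NB B| := by
    rw [show f * X - signSlope * NB B * f = f * (X - signSlope * NB B) by ring, abs_mul,
      abs_of_pos hf0]; ring
  rw [hfac]
  obtain ⟨s, hs0, hsm⟩ : ∃ s : ℝ, 0 < s ∧ (m : ℝ) = s ^ 2 :=
    ⟨√m, Real.sqrt_pos.2 hm', (Real.sq_sqrt hm'.le).symm⟩
  obtain ⟨b, hb0, hbB⟩ : ∃ b : ℝ, 0 < b ∧ (B : ℝ) = b ^ 2 :=
    ⟨√B, Real.sqrt_pos.2 (hm'.trans_le hmB'), (Real.sq_sqrt (hm'.trans_le hmB').le).symm⟩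
  obtain ⟨k, hk0, rfl⟩ : ∃ k : ℝ, 0 < k ∧ κ = k ^ 2 :=
    ⟨√κ, Real.sqrt_pos.2 (by linarith), (Real.sq_sqrt (by linarith)).symm⟩
  have hk1 : 1 ≤ k := by nlinarith
  have hs1 : 1 ≤ s := by
    have : (1 : ℝ) ≤ m := by exact_mod_cast hm
    nlinarith
  have hsb : s ≤ b := by rw [hsm, hbB] at hmB'; exact le_of_sq_le_sq hmB' hb0.le
  have hbk : b ≤ k * s := by
    rw [hbB, hsm, ← mul_pow] at hB; exact le_of_sq_le_sq hB (by positivity)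
  have hLe : f⁻¹ * (C / s ^ 2) = C / (s ^ 2 * f) := by field_simp
  have hks : 0 ≤ k * s := by positivity
  rw [hsm, hbB, hLe, ← mul_pow, Real.sqrt_sq hks, Real.sqrt_sq hb0.le] at hS
  rw [hbB, Real.sqrt_sq hb0.le] at hXN hE
  rw [hsm, Real.sqrt_sq hs0.le]
  refine le_trans ?_ (total_error_le hf0 hb0 hs0 hC hk1 hs1 hsb hbk hfC)
  gcongr
  linarith

end Summation

/-! ### The gradient has almost surely no zero entry. -/

section Nonvanishing

variable {p q B : ℕ}

lemma ae_quadratic_ne_zero {a b : ℝ} (h : a ≠ 0 ∨ b ≠ 0) (c : ℝ) :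
    ∀ᵐ t ∂gauss, a * t ^ 2 + b * t + c ≠ 0 := by
  set P : Polynomial ℝ := .C a * .X ^ 2 + .C b * .X + .C c with hP
  have hP0 : P ≠ 0 := by
    intro h0
    rcases h with h | h
    · exact h (by simpa [hP, Polynomial.coeff_X, Polynomial.coeff_C] using congrArg (Polynomial.coeff · 2) h0)
    · exact h (by simpa [hP, Polynomial.coeff_X, Polynomial.coeff_C] using congrArg (Polynomial.coeff · 1) h0)
  have := nullSingletonClass_gaussianReal (μ := 0) (one_ne_zero : (1 : NNReal) ≠ 0)
  refine measure_mono_null (t := {t | P.IsRoot t}) (fun t ht => ?_)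
    ((Polynomial.finite_setOfPred_isRoot hP0).measure_zero gauss)
  have ht' : a * t ^ 2 + b * t + c = 0 := not_not.1 ht
  simpa [hP] using ht'

/-- Resampling one coordinate preserves the law, so it suffices to check the property in that single
variable with the others held fixed. -/
lemma ae_pi_of_ae_update {ι Ω : Type*} [Fintype ι] [DecidableEq ι] [MeasurableSpace Ω]
    {μ : Measure Ω} [IsProbabilityMeasure μ] {r : (ι → Ω) → Prop} (hr : MeasurableSet {z | r z})
    (i : ι) (h : ∀ᵐ z ∂(Measure.pi fun _ : ι => μ), ∀ᵐ t ∂μ, r (Function.update z i t)) :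
    ∀ᵐ z ∂(Measure.pi fun _ : ι => μ), r z := by
  have hu := measurePreserving_update (μ := μ) i
  rw [← hu.map_eq, ae_map_iff hu.measurable.aemeasurable hr]
  exact (Measure.ae_prod_iff_ae_ae (hu.measurable hr)).2
    ((Measure.ae_ae_comm (p := fun t z => r (Function.update z i t)) (hu.measurable hr)).2 h)

lemma ae_coord_ne_zero (j : Fin q) : ∀ᵐ y ∂(gaussPi (Fin q)), y j ≠ 0 := by
  filter_upwards [ae_lin_ne_zero (w := Pi.single j (1 : ℝ)) (by simp)] with y hy
  simpa [lin, Pi.single_apply] using hy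

/-- As a function of a coordinate `y l` with `h l ≠ 0`, the expression is a quadratic if `l = j` and
a nonconstant affine function for almost every value of the others if `l ≠ j`. -/
lemma ae_coord_mul_lin_add_ne_zero {s : ℝ} (hs : s ≠ 0) {h : Fin q → ℝ} (hh : h ≠ 0) (j : Fin q)
    (c : ℝ) : ∀ᵐ y ∂(gaussPi (Fin q)), s * y j * lin h y + c ≠ 0 := by
  obtain ⟨l, hl⟩ := Function.ne_iff.1 hh
  have hl' : h l ≠ 0 := hl
  have hset : MeasurableSet {y : Fin q → ℝ | s * y j * lin h y + c ≠ 0} := by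
    have := measurable_lin h
    exact (measurableSet_singleton 0).compl.preimage (f := fun y => s * y j * lin h y + c)
      (by fun_prop)
  refine ae_pi_of_ae_update hset l ?_
  filter_upwards [ae_coord_ne_zero j] with y hy
  have e : ∀ t, lin h (Function.update y l t) = t * h l + lin (fun k => if k = l then 0 else h k) y :=
    fun t => by rw [← sum_update_mul, lin]; exact Finset.sum_congr rfl fun k _ => mul_comm _ _
  simp only [e]
  by_cases hj : j = l
  · subst hj
    filter_upwards [ae_quadratic_ne_zero (a := s * h j)
      (b := s * lin (fun k => if k = j then 0 else h k) y) (Or.inl (mul_ne_zero hs hl')) c] with t ht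
    rw [Function.update_self]
    convert ht using 1; ring
  · filter_upwards [ae_quadratic_ne_zero (a := 0) (b := s * y j * h l)
      (Or.inr (mul_ne_zero (mul_ne_zero hs hy) hl'))
      (s * y j * lin (fun k => if k = l then 0 else h k) y + c)] with t ht
    rw [Function.update_of_ne hj]
    convert ht using 1; ring

lemma ae_sample_add_ne_zero {D : Matrix (Fin p) (Fin q) ℝ} (hD : D ≠ 0) (i : Fin p) (j : Fin q)
    (c : ℝ) : ∀ᵐ z ∂(dataLaw p q),
      z.1 i * z.2 j * (∑ k, ∑ l, z.1 k * z.2 l * D k l) + c ≠ 0 := by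
  obtain ⟨k, l, hkl⟩ : ∃ k l, D k l ≠ 0 := by
    by_contra! h
    exact hD (by ext a b; exact h a b)
  refine (Measure.ae_prod_iff_ae_ae ?_).2 ?_
  · exact (measurableSet_singleton 0).compl.preimage
      (f := fun z : (Fin p → ℝ) × (Fin q → ℝ) =>
        z.1 i * z.2 j * (∑ k, ∑ l, z.1 k * z.2 l * D k l) + c) (by fun_prop)
  have hcol : (fun k => D k l) ≠ 0 := fun h => hkl (congrFun h k)
  filter_upwards [ae_coord_ne_zero i, ae_lin_ne_zero hcol] with x hx hx'
  have hh : (fun l => lin (fun k => D k l) x) ≠ 0 := fun h => hx' (congrFun h l)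
  filter_upwards [ae_coord_mul_lin_add_ne_zero hx hh j c] with y hy
  convert hy using 3
  simp only [lin, Finset.sum_mul]
  rw [Finset.sum_comm]
  exact Finset.sum_congr rfl fun _ _ => Finset.sum_congr rfl fun _ _ => by ring

/-- Only one sample is resampled; the others contribute a constant. Since `Real.sign 0 = 0`, this is
what makes every squared sign equal to 1. -/
lemma ae_gradSum_ne_zero {D : Matrix (Fin p) (Fin q) ℝ} (hD : D ≠ 0) (hB : 0 < B) (i : Fin p)
    (j : Fin q) : ∀ᵐ ω ∂(Measure.pi fun _ : Fin B => dataLaw p q), gradSum D i j ω ≠ 0 := by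
  set a₀ : Fin B := ⟨0, hB⟩
  have hset : MeasurableSet {ω : Fin B → (Fin p → ℝ) × (Fin q → ℝ) | gradSum D i j ω ≠ 0} :=
    (measurableSet_singleton 0).compl.preimage (measurable_gradSum D i j)
  refine ae_pi_of_ae_update hset a₀ (Filter.Eventually.of_forall fun ω => ?_)
  filter_upwards [ae_sample_add_ne_zero hD i j (∑ a ∈ Finset.univ.erase a₀,
    (ω a).1 i * (ω a).2 j * ∑ k, ∑ l, (ω a).1 k * (ω a).2 l * D k l)] with z hz
  rw [gradSum, ← Finset.add_sum_erase _ _ (Finset.mem_univ a₀)]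
  convert hz using 2
  · simp
  · refine Finset.sum_congr rfl fun a ha => ?_
    rw [Function.update_of_ne (Finset.ne_of_mem_erase ha)]

end Nonvanishing

/-! ### Conditional expectation given an independent σ-algebra. -/

section Conditioning

variable {Ω E F : Type*} {m m₀ : MeasurableSpace Ω} [MeasurableSpace E] [MeasurableSpace F]

/-- Freezing lemma: conditionally on `m`, an `m`-measurable argument is constant and an independent
argument is averaged over its law. -/
lemma condExp_comp_of_indep (hm : m ≤ m₀) {P : Measure Ω}
    [IsProbabilityMeasure P] {W : Ω → E} (hW : Measurable[m] W) {Z : Ω → F} (hZ : Measurable Z)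
    (hind : Indep m (MeasurableSpace.comap Z inferInstance) P) {f : E × F → ℝ} (hf : Measurable f)
    (hint : Integrable (fun ω => f (W ω, Z ω)) P) :
    P[fun ω => f (W ω, Z ω) | m] =ᵐ[P] fun ω => ∫ z, f (W ω, z) ∂(P.map Z) := by
  have hW' : Measurable W := hW.mono hm le_rfl
  have hZp : IsProbabilityMeasure (P.map Z) := Measure.isProbabilityMeasure_map hZ.aemeasurable
  -- The additional coordinate `c` will be the indicator of a set of `m`. Independence of the pair
  -- `(W, c)` from `Z` then turns integrals over that set into integrals against a product measure.
  have key : ∀ c : Ω → ℝ, Measurable[m] c →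
      P.map (fun ω => ((W ω, c ω), Z ω)) = (P.map fun ω => (W ω, c ω)).prod (P.map Z) := by
    intro c hc
    have h1 : Measurable[m] fun ω => (W ω, c ω) := hW.prodMk hc
    refine (indepFun_iff_map_prod_eq_prod_map_map (h1.mono hm le_rfl).aemeasurable
      hZ.aemeasurable).1 ?_
    exact (IndepFun_iff_Indep _ _ _).2 (indep_of_indep_of_le_left hind h1.comap_le)
  have hΦ : Measurable fun w => ∫ z, f (w, z) ∂(P.map Z) :=
    (hf.stronglyMeasurable.integral_prod_right' (ν := P.map Z)).measurable
  have hlaw : P.map (fun ω => (W ω, Z ω)) = (P.map W).prod (P.map Z) :=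
    (indepFun_iff_map_prod_eq_prod_map_map hW'.aemeasurable hZ.aemeasurable).1
      ((IndepFun_iff_Indep _ _ _).2 (indep_of_indep_of_le_left hind hW.comap_le))
  have hintp : Integrable f ((P.map W).prod (P.map Z)) := by
    rw [← hlaw]
    exact (integrable_map_measure hf.aestronglyMeasurable (hW'.prodMk hZ).aemeasurable).2 hint
  have hΦint : Integrable (fun ω => ∫ z, f (W ω, z) ∂(P.map Z)) P :=
    (integrable_map_measure hΦ.aestronglyMeasurable hW'.aemeasurable).1 hintp.integral_prod_left
  refine (ae_eq_condExp_of_forall_setIntegral_eq hm hint (fun s _ _ => Integrable.integrableOn hΦint)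
    (fun s hs _ => ?_) (Measurable.stronglyMeasurable (hΦ.comp hW)).aestronglyMeasurable).symm
  set c : Ω → ℝ := s.indicator fun _ => 1 with hcdef
  have hc : Measurable[m] c := measurable_const.indicator hs
  have hc' : Measurable c := hc.mono hm le_rfl
  have e : ∀ g : Ω → ℝ, ∫ ω in s, g ω ∂P = ∫ ω, c ω * g ω ∂P := fun g => by
    rw [← integral_indicator (hm s hs)]
    congr 1; ext ω
    by_cases h : ω ∈ s <;> simp [hcdef, h]
  rw [e, e]
  set g : (E × ℝ) × F → ℝ := fun u => u.1.2 * f (u.1.1, u.2) with hgdef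
  have hg : Measurable g := by fun_prop
  have hWcZ : Measurable fun ω => ((W ω, c ω), Z ω) := by fun_prop
  have hgint : Integrable g ((P.map fun ω => (W ω, c ω)).prod (P.map Z)) := by
    rw [← key c hc]
    refine (integrable_map_measure hg.aestronglyMeasurable hWcZ.aemeasurable).2 ?_
    refine hint.bdd_mul (c := 1) hc'.aestronglyMeasurable (Filter.Eventually.of_forall fun ω => ?_)
    by_cases h : ω ∈ s <;> simp [hcdef, h]
  have h1 : ∫ ω, c ω * f (W ω, Z ω) ∂P = ∫ u, g u ∂(P.map fun ω => ((W ω, c ω), Z ω)) :=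
    (integral_map hWcZ.aemeasurable hg.aestronglyMeasurable).symm
  rw [h1, key c hc, integral_prod _ hgint,
    integral_map (hW'.prodMk hc').aemeasurable
      (hg.stronglyMeasurable.integral_prod_right' (ν := P.map Z)).aestronglyMeasurable]
  simp only [hgdef, integral_const_mul]

end Conditioning

/-! ### The risk and its mean after one step. -/

section Risk

variable {p q B : ℕ}

lemma measurePreserving_ofLp (n : ℕ) :
    MeasurePreserving (fun x : EuclideanSpace ℝ (Fin n) => x.ofLp) (multivariateGaussian 0 1)
      (gaussPi (Fin n)) := by
  refine ⟨WithLp.measurable_ofLp 2 _, ?_⟩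
  rw [multivariateGaussian_zero_one, ← map_pi_eq_stdGaussian,
    Measure.map_map (WithLp.measurable_ofLp 2 _) (WithLp.measurable_toLp 2 _)]
  exact Measure.map_id

lemma hasMoments_coord {n : ℕ} (k : Fin n) : HasMoments (fun x : Fin n → ℝ => x k) (gaussPi (Fin n)) :=
  hasMoments_eval hasMoments_id_gauss k

/-- Integrating the input vector first leaves `|Dᵀ x|²`, whose mean is the squared Frobenius norm.
-/
lemma integral_pairing_sq (D : Matrix (Fin p) (Fin q) ℝ) :
    ∫ z, (∑ k, ∑ l, z.1 k * z.2 l * D k l) ^ 2 ∂(dataLaw p q) = ∑ k, ∑ l, D k l ^ 2 := by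
  have hm : HasMoments (fun z : (Fin p → ℝ) × (Fin q → ℝ) => ∑ k, ∑ l, z.1 k * z.2 l * D k l)
      (dataLaw p q) :=
    HasMoments.sum _ fun k _ => HasMoments.sum _ fun l _ =>
      (((hasMoments_coord k).comp measurePreserving_fst).mul
        ((hasMoments_coord l).comp measurePreserving_snd)).mul (HasMoments.const _)
  rw [integral_prod _ (hm.pow 2).integrable]
  have e : ∀ x : Fin p → ℝ, ∫ y, (∑ k, ∑ l, x k * y l * D k l) ^ 2 ∂(gaussPi (Fin q))
      = ∑ l, lin (fun k => D k l) x ^ 2 := fun x => by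
    rw [← integral_lin_sq]
    congr 1; ext y; congr 1
    simp only [lin, Finset.sum_mul]
    rw [Finset.sum_comm]
    exact Finset.sum_congr rfl fun _ _ => Finset.sum_congr rfl fun _ _ => by ring
  simp_rw [e]
  rw [integral_finsetSum _ fun l _ => ((hasMoments_lin _).pow 2).integrable]
  simp_rw [integral_lin_sq]
  exact Finset.sum_comm

lemma risk_one (Wstar W : Matrix (Fin p) (Fin q) ℝ) :
    risk 1 1 Wstar W = 1 / 2 * ∑ i, ∑ j, (W - Wstar) i j ^ 2 := by
  have h : MeasurePreserving _ _ (dataLaw p q) :=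
    (measurePreserving_ofLp p).prod (measurePreserving_ofLp q)
  rw [risk, ← integral_pairing_sq, ← h.map_eq, integral_map h.measurable.aemeasurable
    (by fun_prop)]
  rfl

/-- The risk, at distance `D` from the optimum, after one SignSGD step on the minibatch `ω`. -/
noncomputable def stepRisk (η : ℝ) (u : (Fin p → Fin q → ℝ) × (Fin B → (Fin p → ℝ) × (Fin q → ℝ))) :
    ℝ :=
  1 / 2 * ∑ i, ∑ j, (u.1 i j - η * Real.sign (gradSum (Matrix.of u.1) i j u.2)) ^ 2

lemma measurable_stepRisk (η : ℝ) : Measurable (stepRisk (p := p) (q := q) (B := B) η) := by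
  have h : ∀ i j, Measurable fun u : (Fin p → Fin q → ℝ) × (Fin B → (Fin p → ℝ) × (Fin q → ℝ)) =>
      Real.sign (gradSum (Matrix.of u.1) i j u.2) := fun i j =>
    measurable_sign.comp (by simp only [gradSum, Matrix.of_apply]; fun_prop)
  unfold stepRisk
  fun_prop

lemma norm_stepRisk_le {η : ℝ} (hη : 0 ≤ η) {L : ℝ} {D : Fin p → Fin q → ℝ}
    (hD : ∀ i j, |D i j| ≤ L) (ω : Fin B → (Fin p → ℝ) × (Fin q → ℝ)) :
    ‖stepRisk η (D, ω)‖ ≤ 1 / 2 * ∑ _i : Fin p, ∑ _j : Fin q, (L + η) ^ 2 := by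
  rw [Real.norm_of_nonneg (by unfold stepRisk; positivity), stepRisk]
  refine mul_le_mul_of_nonneg_left (Finset.sum_le_sum fun i _ => Finset.sum_le_sum fun j _ => ?_)
    (by norm_num)
  rw [← sq_abs]
  refine pow_le_pow_left₀ (abs_nonneg _) ?_ 2
  refine (abs_sub _ _).trans ?_
  rw [abs_mul, abs_of_nonneg hη]
  have := mul_le_mul_of_nonneg_left (abs_sign_le_one (gradSum (Matrix.of D) i j ω)) hη
  have := hD i j
  simp only at *
  linarith

lemma integral_stepRisk (η : ℝ) {D : Matrix (Fin p) (Fin q) ℝ} (hD : D ≠ 0) (hB : 0 < B) :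
    ∫ ω, stepRisk η (D, ω) ∂(Measure.pi fun _ : Fin B => dataLaw p q)
      = 1 / 2 * ∑ i, ∑ j, D i j ^ 2 - η * ∑ i, ∑ j, D i j * meanGradSign B D i j
        + η ^ 2 / 2 * (q * p) := by
  have hs : ∀ i j, Integrable (fun ω => Real.sign (gradSum D i j ω))
      (Measure.pi fun _ : Fin B => dataLaw p q) := fun i j =>
    integrable_sign_comp (measurable_gradSum D i j)
  have hi : ∀ i j, Integrable (fun ω => D i j ^ 2 / 2 + η ^ 2 / 2
      - η * D i j * Real.sign (gradSum D i j ω)) (Measure.pi fun _ : Fin B => dataLaw p q) :=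
    fun i j => (integrable_const _).sub ((hs i j).const_mul _)
  have h1 : ∀ᵐ ω ∂(Measure.pi fun _ : Fin B => dataLaw p q), stepRisk η (D, ω)
      = ∑ i, ∑ j, (D i j ^ 2 / 2 + η ^ 2 / 2 - η * D i j * Real.sign (gradSum D i j ω)) := by
    have h : ∀ᵐ ω ∂(Measure.pi fun _ : Fin B => dataLaw p q), ∀ i j, gradSum D i j ω ≠ 0 := by
      simp_rw [ae_all_iff]
      exact fun i j => ae_gradSum_ne_zero hD hB i j
    filter_upwards [h] with ω hω
    rw [stepRisk, Finset.mul_sum]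
    refine Finset.sum_congr rfl fun i _ => ?_
    rw [Finset.mul_sum]
    refine Finset.sum_congr rfl fun j _ => ?_
    have h2 : Real.sign (gradSum D i j ω) ^ 2 = 1 := by
      rcases (hω i j).lt_or_gt with h | h
      · rw [Real.sign_of_neg h]; norm_num
      · rw [Real.sign_of_pos h]; norm_num
    change 1 / 2 * (D i j - η * Real.sign (gradSum D i j ω)) ^ 2 = _
    linear_combination (η ^ 2 / 2) * h2
  rw [integral_congr_ae h1,
    integral_finsetSum _ fun i _ => integrable_finsetSum _ fun j _ => hi i j]
  have h2 : ∀ i, ∫ ω, ∑ j, (D i j ^ 2 / 2 + η ^ 2 / 2 - η * D i j * Real.sign (gradSum D i j ω))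
      ∂(Measure.pi fun _ : Fin B => dataLaw p q)
      = ∑ j, (D i j ^ 2 / 2 + η ^ 2 / 2 - η * D i j * meanGradSign B D i j) := fun i => by
    rw [integral_finsetSum _ fun j _ => hi i j]
    refine Finset.sum_congr rfl fun j _ => ?_
    rw [integral_sub (integrable_const _) ((hs i j).const_mul _), integral_const_mul]
    simp [meanGradSign]
  simp_rw [h2, Finset.sum_sub_distrib, Finset.sum_add_distrib, Finset.mul_sum]
  simp only [Finset.sum_const, Finset.card_univ, Fintype.card_fin, nsmul_eq_mul]
  have h3 : ∑ i, ∑ j, D i j ^ 2 / 2 = ∑ i, ∑ j, 1 / 2 * D i j ^ 2 :=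
    Finset.sum_congr rfl fun _ _ => Finset.sum_congr rfl fun _ _ => by ring
  simp_rw [h3, mul_assoc]
  ring

lemma abs_integral_stepRisk_sub_le {D : Matrix (Fin p) (Fin q) ℝ} {m : ℕ} {C κ ε η : ℝ}
    (hC : 0 < C) (hκ : 1 ≤ κ) (hη : 0 < η) (hm : 0 < m) (hmB : m ≤ B) (hp : (p : ℝ) ≤ κ * m)
    (hq : (q : ℝ) ≤ κ * m) (hB : (B : ℝ) ≤ κ * m)
    (hmε : 3000000 * κ ^ 3 * C ^ 2 / √m ≤ ε) (hD : ∀ i j, |D i j| ≤ C / m) {R : ℝ}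
    (hR : R = 1 / 2 * ∑ i, ∑ j, D i j ^ 2) (hR0 : 0 < R) :
    |∫ ω, stepRisk η (D, ω) ∂(Measure.pi fun _ : Fin B => dataLaw p q)
      - (R - η * NB B * √(4 * R / Real.pi) + η ^ 2 / 2 * (q * p))| ≤ ε * η / √R := by
  have hD0 : D ≠ 0 := by
    rintro rfl
    simp [hR] at hR0
  have hsR : 0 < √R := Real.sqrt_pos.2 hR0
  -- This is the Frobenius norm of `D`, and `√(4R/π) = √(2/π) f`. Since `√R ≤ f`, the factor `f` in
  -- the summed bound pays for `√R`.
  set f := √2 * √R with hf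
  have hf0 : 0 < f := by positivity
  have hf2 : ∑ i, ∑ j, D i j ^ 2 = f ^ 2 := by
    rw [hf, mul_pow, Real.sq_sqrt hR0.le, Real.sq_sqrt zero_le_two, hR]; ring
  have hmain := mul_abs_sum_mul_meanGradSign_sub_le D hC hκ hm hmB hp hq hB hD hf0 hf2
  have hsl : √(4 * R / Real.pi) = signSlope * f := by
    rw [signSlope, hf, ← mul_assoc, ← Real.sqrt_mul (by positivity), ← Real.sqrt_mul (by positivity)]
    congr 1; ring
  rw [integral_stepRisk η hD0 (hm.trans_le hmB), ← hR, hsl]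
  set S := ∑ i, ∑ j, D i j * meanGradSign B D i j
  have e : R - η * S + η ^ 2 / 2 * (q * p) - (R - η * NB B * (signSlope * f) + η ^ 2 / 2 * (q * p))
      = -(η * (S - signSlope * NB B * f)) := by ring
  rw [e, abs_neg, abs_mul, abs_of_pos hη, le_div_iff₀ hsR]
  have h1 : |S - signSlope * NB B * f| * √R ≤ ε := by
    refine le_trans ?_ (hmain.trans hmε)
    rw [mul_comm f]
    gcongr
    exact le_mul_of_one_le_left hsR.le (by norm_num)
  nlinarith

end Risk

/-! ### The iterates and the data stream. -/

section Stream

variable {p q B : ℕ}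

/-- The coordinates of the minibatch of step `t`. -/
def batch {Ω : Type*} (xout : ℕ → Fin B → Ω → EuclideanSpace ℝ (Fin p))
    (xin : ℕ → Fin B → Ω → EuclideanSpace ℝ (Fin q)) (t : ℕ) (ω : Ω) :
    Fin B → (Fin p → ℝ) × (Fin q → ℝ) :=
  fun a => ((xout t a ω).ofLp, (xin t a ω).ofLp)

lemma sign_minibatchGradient (hB : 0 < B) (x : Fin B → EuclideanSpace ℝ (Fin p))
    (y : Fin B → EuclideanSpace ℝ (Fin q)) (D : Matrix (Fin p) (Fin q) ℝ) (i : Fin p) (j : Fin q) :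
    Real.sign (minibatchGradient x y D i j)
      = Real.sign (gradSum D i j fun a => ((x a).ofLp, (y a).ofLp)) :=
  sign_mul_of_pos (by positivity) _

lemma iterate_succ_apply {η : ℝ} {Wstar W0 : Matrix (Fin p) (Fin q) ℝ} (hB : 0 < B)
    (x : ℕ → Fin B → EuclideanSpace ℝ (Fin p)) (y : ℕ → Fin B → EuclideanSpace ℝ (Fin q)) (t : ℕ)
    (i : Fin p) (j : Fin q) :
    iterate η Wstar W0 x y (t + 1) i j = iterate η Wstar W0 x y t i j
      - η * Real.sign (gradSum (iterate η Wstar W0 x y t - Wstar) i j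
        fun a => ((x t a).ofLp, (y t a).ofLp)) := by
  rw [← sign_minibatchGradient hB]
  rfl

/-- Measurability is required only of the samples before `t`, for an arbitrary σ-algebra, so that
the statement can be used with `past` itself. -/
lemma measurable_iterate {Ω : Type*} [MeasurableSpace Ω] (η : ℝ)
    (Wstar W0 : Matrix (Fin p) (Fin q) ℝ) (hB : 0 < B)
    {xout : ℕ → Fin B → Ω → EuclideanSpace ℝ (Fin p)}
    {xin : ℕ → Fin B → Ω → EuclideanSpace ℝ (Fin q)} (t : ℕ)
    (hout : ∀ s < t, ∀ a, Measurable (xout s a)) (hin : ∀ s < t, ∀ a, Measurable (xin s a))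
    (i : Fin p) (j : Fin q) :
    Measurable fun ω => iterate η Wstar W0 (fun s a => xout s a ω) (fun s a => xin s a ω) t i j := by
  induction t generalizing i j with
  | zero => exact measurable_const
  | succ t ih =>
    have ih' := ih (fun s hs => hout s (hs.trans t.lt_succ_self))
      (fun s hs => hin s (hs.trans t.lt_succ_self))
    have ho := hout t t.lt_succ_self
    have hi := hin t t.lt_succ_self
    simp only [iterate_succ_apply hB]
    refine (ih' i j).sub ((measurable_sign.comp ?_).const_mul η)
    simp only [gradSum, Matrix.sub_apply]
    fun_prop

/-- Each entry moves by at most `η` per step; this deterministic bound supplies integrability of the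
risk. -/
lemma abs_iterate_sub_le {η : ℝ} (hη : 0 ≤ η) (Wstar W0 : Matrix (Fin p) (Fin q) ℝ) (hB : 0 < B)
    (x : ℕ → Fin B → EuclideanSpace ℝ (Fin p)) (y : ℕ → Fin B → EuclideanSpace ℝ (Fin q)) (t : ℕ)
    (i : Fin p) (j : Fin q) : |iterate η Wstar W0 x y t i j - W0 i j| ≤ t * η := by
  induction t with
  | zero => simp [iterate]
  | succ t ih =>
    rw [iterate_succ_apply hB, sub_right_comm]
    refine (abs_sub _ _).trans ?_
    rw [abs_mul, abs_of_nonneg hη]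
    have := mul_le_mul_of_nonneg_left (abs_sign_le_one (gradSum (iterate η Wstar W0 x y t - Wstar)
      i j fun a => ((x t a).ofLp, (y t a).ofLp))) hη
    push_cast
    linarith

lemma risk_iterate_succ {η : ℝ} {Wstar W0 : Matrix (Fin p) (Fin q) ℝ} (hB : 0 < B)
    (x : ℕ → Fin B → EuclideanSpace ℝ (Fin p)) (y : ℕ → Fin B → EuclideanSpace ℝ (Fin q)) (t : ℕ) :
    risk 1 1 Wstar (iterate η Wstar W0 x y (t + 1))
      = stepRisk η (fun i j => iterate η Wstar W0 x y t i j - Wstar i j,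
          fun a => ((x t a).ofLp, (y t a).ofLp)) := by
  rw [risk_one, stepRisk]
  congr 1
  refine Finset.sum_congr rfl fun i _ => Finset.sum_congr rfl fun j _ => ?_
  rw [Matrix.sub_apply, iterate_succ_apply hB, sub_right_comm]
  rfl

lemma measurable_iterate_past {Ω : Type*} {xout : ℕ → Fin B → Ω → EuclideanSpace ℝ (Fin p)}
    {xin : ℕ → Fin B → Ω → EuclideanSpace ℝ (Fin q)} (η : ℝ) (Wstar W0 : Matrix (Fin p) (Fin q) ℝ) (hB : 0 < B) (t : ℕ)
    (i : Fin p) (j : Fin q) : Measurable[past xout xin t] fun ω =>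
      iterate η Wstar W0 (fun s a => xout s a ω) (fun s a => xin s a ω) t i j := by
  have key : ∀ s < t, ∀ a, Measurable[past xout xin t] fun ω => (xout s a ω, xin s a ω) :=
    fun s hs a => (comap_measurable _).mono
      (le_iSup₂_of_le s hs (le_iSup_of_le a le_rfl)) le_rfl
  exact @measurable_iterate _ _ _ _ (past xout xin t) η Wstar W0 hB _ _ t
    (fun s hs a => measurable_fst.comp (key s hs a))
    (fun s hs a => measurable_snd.comp (key s hs a)) i j

variable {Ω : Type*} [MeasurableSpace Ω] {P : Measure Ω}
  {xout : ℕ → Fin B → Ω → EuclideanSpace ℝ (Fin p)} {xin : ℕ → Fin B → Ω → EuclideanSpace ℝ (Fin q)}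

lemma measurable_batch (h : IsStream P 1 1 xout xin) (t : ℕ) : Measurable (batch xout xin t) := by
  have h1 := h.measurable_out t
  have h2 := h.measurable_in t
  unfold batch
  fun_prop

lemma map_batch [IsProbabilityMeasure P] (h : IsStream P 1 1 xout xin) (t : ℕ) :
    P.map (batch xout xin t) = Measure.pi fun _ : Fin B => dataLaw p q := by
  have h1 := h.measurable_out t
  have h2 := h.measurable_in t
  have hT : MeasurePreserving (Prod.map (fun x : EuclideanSpace ℝ (Fin p) => x.ofLp)
      (fun x : EuclideanSpace ℝ (Fin q) => x.ofLp)) _ (dataLaw p q) :=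
    (measurePreserving_ofLp p).prod (measurePreserving_ofLp q)
  have hind : iIndepFun (fun (a : Fin B) ω => (xout t a ω, xin t a ω)) P :=
    h.indep_samples.precomp (g := fun a : Fin B => (t, a)) fun a b hab => (Prod.mk.inj hab).2
  have hind' := hind.comp (fun _ => Prod.map (fun x : EuclideanSpace ℝ (Fin p) => x.ofLp)
      (fun x : EuclideanSpace ℝ (Fin q) => x.ofLp)) fun _ => hT.measurable
  have e := (iIndepFun_iff_map_fun_eq_pi_map fun a =>
    (hT.measurable.comp ((h1 a).prodMk (h2 a))).aemeasurable).1 hind'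
  refine e.trans ?_
  congr 1
  ext1 a
  rw [← Measure.map_map hT.measurable ((h1 a).prodMk (h2 a)),
    (indepFun_iff_map_prod_eq_prod_map_map (h1 a).aemeasurable (h2 a).aemeasurable).1
      (h.indep_out_in t a), h.law_out, h.law_in, hT.map_eq]

lemma past_le (h : IsStream P 1 1 xout xin) (t : ℕ) : past xout xin t ≤ ‹MeasurableSpace Ω› :=
  iSup₂_le fun s _ => iSup_le fun a =>
    ((h.measurable_out s a).prodMk (h.measurable_in s a)).comap_le

/-- The two σ-algebras are generated by disjoint sets of samples: steps before `t` and step `t`. -/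
lemma indep_past_batch (h : IsStream P 1 1 xout xin) (t : ℕ) :
    Indep (past xout xin t) (MeasurableSpace.comap (batch xout xin t) inferInstance) P := by
  set σ : ℕ × Fin B → MeasurableSpace Ω := fun k =>
    MeasurableSpace.comap (fun ω => (xout k.1 k.2 ω, xin k.1 k.2 ω)) inferInstance with hσ
  have hi := indep_iSup_of_disjoint (m := σ)
    (fun k => ((h.measurable_out k.1 k.2).prodMk (h.measurable_in k.1 k.2)).comap_le)
    ((iIndepFun_iff_iIndep _ _ _).1 h.indep_samples) (S := {k | k.1 < t}) (T := {k | k.1 = t})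
    (Set.disjoint_left.2 fun k (h1 : k.1 < t) (h2 : k.1 = t) => h1.ne h2)
  refine indep_of_indep_of_le_left (indep_of_indep_of_le_right hi ?_) ?_
  · refine Measurable.comap_le (@measurable_pi_lambda _ _ _ (_) _ _ fun a => ?_)
    have h1 : Measurable[σ (t, a)] fun ω => (xout t a ω, xin t a ω) := comap_measurable _
    have h2 : Measurable (Prod.map (fun x : EuclideanSpace ℝ (Fin p) => x.ofLp)
      (fun x : EuclideanSpace ℝ (Fin q) => x.ofLp)) := by fun_prop
    exact (h2.comp h1).mono (le_iSup₂_of_le (t, a) rfl le_rfl) le_rfl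
  · exact iSup₂_le fun s hs => iSup_le fun a => le_iSup₂_of_le (s, a) hs le_rfl

/-- The freezing lemma with the residual, which is measurable for the past, as frozen argument and
the fresh minibatch as independent one. -/
lemma condExp_risk_iterate_succ [IsProbabilityMeasure P] (h : IsStream P 1 1 xout xin) {η : ℝ} (hη : 0 ≤ η)
    (Wstar W0 : Matrix (Fin p) (Fin q) ℝ) (hB : 0 < B) (t : ℕ) :
    P[fun ω => risk 1 1 Wstar
        (iterate η Wstar W0 (fun s a => xout s a ω) (fun s a => xin s a ω) (t + 1)) |
      past xout xin t] =ᵐ[P] fun ω => ∫ z, stepRisk η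
        (iterate η Wstar W0 (fun s a => xout s a ω) (fun s a => xin s a ω) t - Wstar, z)
        ∂(Measure.pi fun _ : Fin B => dataLaw p q) := by
  set D : Ω → Fin p → Fin q → ℝ := fun ω i j =>
    iterate η Wstar W0 (fun s a => xout s a ω) (fun s a => xin s a ω) t i j - Wstar i j with hDdef
  have hD : Measurable[past xout xin t] D :=
    @measurable_pi_lambda _ _ _ (_) _ _ fun i => @measurable_pi_lambda _ _ _ (_) _ _ fun j =>
      (measurable_iterate_past η Wstar W0 hB t i j).sub_const _
  obtain ⟨L, hL⟩ : ∃ L, ∀ ω i j, |D ω i j| ≤ L := by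
    refine ⟨t * η + ∑ i, ∑ j, |W0 i j - Wstar i j|, fun ω i j => ?_⟩
    have h1 := abs_iterate_sub_le hη Wstar W0 hB (fun s a => xout s a ω) (fun s a => xin s a ω) t i j
    have h2 : |W0 i j - Wstar i j| ≤ ∑ i, ∑ j, |W0 i j - Wstar i j| :=
      (Finset.single_le_sum (f := fun j => |W0 i j - Wstar i j|) (fun _ _ => abs_nonneg _)
        (Finset.mem_univ j)).trans
        (Finset.single_le_sum (f := fun i => ∑ j, |W0 i j - Wstar i j|)
          (fun _ _ => Finset.sum_nonneg fun _ _ => abs_nonneg _) (Finset.mem_univ i))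
    exact (abs_sub_le _ (W0 i j) _).trans (add_le_add h1 h2)
  have hb := measurable_batch h t
  have hD' : Measurable D := hD.mono (past_le h t) le_rfl
  have hint : Integrable (fun ω => stepRisk η (D ω, batch xout xin t ω)) P :=
    Integrable.of_bound ((measurable_stepRisk η).comp (hD'.prodMk hb)).aestronglyMeasurable _
      (Filter.Eventually.of_forall fun ω => norm_stepRisk_le hη (hL ω) _)
  have hc := condExp_comp_of_indep (past_le h t) hD hb (indep_past_batch h t)
    (measurable_stepRisk η) hint
  rw [map_batch h t] at hc
  simp_rw [risk_iterate_succ hB]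
  exact hc

end Stream

end SignSGD

theorem propositionG1 (C κ ε : ℝ) (hC : 0 < C) (hκ : 1 ≤ κ) (hε : 0 < ε) :
    ∃ m₀ : ℕ, ∀ Nout Nin B m : ℕ,
      m = min (min Nin Nout) B → m₀ ≤ m →
      (Nin : ℝ) ≤ κ * m → (Nout : ℝ) ≤ κ * m → (B : ℝ) ≤ κ * m →
      ∀ (η : ℝ), 0 < η →
      ∀ (Wstar W0 : Matrix (Fin Nout) (Fin Nin) ℝ)
        (Ω : Type*) [MeasurableSpace Ω] (P : Measure Ω) [IsProbabilityMeasure P]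
        (xout : ℕ → Fin B → Ω → EuclideanSpace ℝ (Fin Nout))
        (xin : ℕ → Fin B → Ω → EuclideanSpace ℝ (Fin Nin)),
      SignSGD.IsStream P (1 : Matrix (Fin Nout) (Fin Nout) ℝ) (1 : Matrix (Fin Nin) (Fin Nin) ℝ)
        xout xin →
      ∀ (W : ℕ → Ω → Matrix (Fin Nout) (Fin Nin) ℝ) (R : ℕ → Ω → ℝ),
      (∀ t ω, W t ω =
        SignSGD.iterate η Wstar W0 (fun s a => xout s a ω) (fun s a => xin s a ω) t) →
      (∀ t ω, R t ω = SignSGD.risk 1 1 Wstar (W t ω)) →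
      ∀ t : ℕ, ∀ᵐ ω ∂P,
        (∀ i j, |(W t ω - Wstar) i j| ≤ C / m) → 0 < R t ω →
        |(P[R (t + 1) | SignSGD.past xout xin t]) ω
            - (R t ω - η * SignSGD.NB B * √(4 * R t ω / Real.pi)
                + η ^ 2 / 2 * (Nin * Nout))|
          ≤ ε * η / √(R t ω) := by
  -- Chosen so that the summed error `3000000 κ³ C² / √m` is at most `ε`. The threshold is then
  -- increased by one so that `m`, hence `B`, is positive.
  obtain ⟨m₀, hm₀⟩ := exists_nat_ge ((3000000 * κ ^ 3 * C ^ 2 / ε) ^ 2)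
  refine ⟨m₀ + 1, fun Nout Nin B m hm hm₀m hNin hNout hBκ η hη Wstar W0 Ω _ P _ xout xin hS W R hW
    hR t => ?_⟩
  have hm0 : 0 < m := by omega
  have hmB : m ≤ B := by omega
  have hB : 0 < B := by omega
  have hR1 : R (t + 1) = fun ω => SignSGD.risk 1 1 Wstar
      (SignSGD.iterate η Wstar W0 (fun s a => xout s a ω) (fun s a => xin s a ω) (t + 1)) := by
    ext ω; rw [hR, hW]
  have hmε : 3000000 * κ ^ 3 * C ^ 2 / √m ≤ ε := by
    have hκ0 : 0 < κ := by linarith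
    have h1 : 3000000 * κ ^ 3 * C ^ 2 / ε ≤ √m := by
      refine Real.le_sqrt_of_sq_le (hm₀.trans ?_)
      exact_mod_cast (by omega : m₀ ≤ m)
    have hsm : 0 < √(m : ℝ) := by positivity
    rw [div_le_iff₀ hε] at h1
    rw [div_le_iff₀ hsm]
    linarith
  filter_upwards [SignSGD.condExp_risk_iterate_succ hS hη.le Wstar W0 hB t] with ω hω hD hpos
  rw [hR1, hω, ← hW]
  exact SignSGD.abs_integral_stepRisk_sub_le hC hκ hη hm0 hmB hNout hNin hBκ hmε hD
    (by rw [hR, SignSGD.risk_one]) hpos
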